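/- **Setting.** Let $(\Xi,P)$ be a probability space and let $f(\cdot\,;\xi)\in C^3(\mathbb R^d)$, $\xi\in\Xi$, be random functions that are measurable in $\xi$. Let $f:\mathbb R^d\to\mathbb R$ have a local minimum at $0$ and satisfy $\mathbb E_\xi[\nabla f(x;\xi)]=\nabla f(x)$ for all $x\in\mathbb R^d$ (in particular these expectations exist). Let $\gamma,b,R_1>0$ be such that, for every $\xi\in\Xi$, $f(\cdot\,;\xi)-\frac\gamma2\|\cdot\|^2$ is convex on $B(0,R_1)$ and $\|\nabla f(0;\xi)\|\le b$, and such that $R_1>R_0:=\frac{16b}{3\gamma}$. Let $R\in(R_0,R_1]$, and assume that $f(\cdot\,;\xi)\in C^7(B(0,R))$ with norms bounded uniformly in $\xi$ (automatic from $f(\cdot\,;\xi)\in C^7(B(0,R))$, with finite norm, if $\Xi$ is finite). Put $$L=\sup_{\xi}\sup_{x\in B(0,R)}\|\nabla^2 f(x;\xi)\|,\qquad \eta_0=\min\Big\{\frac1{2\gamma},\ \frac{3R}{8b},\ \frac{3\gamma R^2/8-2bR}{2\gamma bR+b^2}\Big\},$$ and call $\eta$ admissible if $0<\eta\le\min\{\eta_0,\frac{2}{\gamma+L}\}$.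 For such $\eta$ consider the SGD iterates $X_{n+1}=X_n-\eta\nabla f(X_n;\xi_n)$ with $\xi_0,\xi_1,\dots$ i.i.d. of law $P$ and independent of $X_0$; $\mathbb E_x$ denotes expectation given $X_0=x$. Let $\Sigma(x)=\mathbb E_\xi[(\nabla f(x;\xi)-\nabla f(x))\otimes(\nabla f(x;\xi)-\nabla f(x))]$, $$\mathcal L_1=-\nabla f\cdot\nabla,\qquad \mathcal L_2=-\tfrac14\nabla\|\nabla f\|^2\cdot\nabla+\tfrac12\mathrm{Tr}(\Sigma\nabla^2).$$ For $\varphi\in C^6(B(0,R))$ (with finite norm) let $u_0,u_1$ be the classical solutions on $B(0,R)\times[0,\infty)$ of $$\partial_tu_0=\mathcal L_1u_0,\quad u_0(\cdot,0)=\varphi;\qquad \partial_tu_1=\mathcal L_1u_1+\mathcal L_2u_0,\quad u_1(\cdot,0)=0 .$$ **Statement.** For every admissible $\eta$ there is a probability measure $\pi=\pi_\eta$, stationary for SGD, such that for every initial law $\mu_0$ supported in $\overline{B(0,R)}$ the laws $\mu_n$ of $X_n$ satisfy $W_2(\mu_n,\pi)\to0$. There is a constant $K>0$, independent of $\varphi$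 and $\eta$, and for every $\varphi$ as above $u_0,u_1$ exist and there is a constant $C>0$, independent of $\eta$, $n$ and $x$, such that for every admissible $\eta$: 1. $\displaystyle\sup_{x\in B(0,R)}\big|\mathbb E_x[\varphi(X_n)]-\varphi(0)\big|\le C\eta$ for all integers $n\ge0$ with $n\ge K\,\eta^{-1}\log(1/\eta)$; 2. $\displaystyle\Big|\int_{\mathbb R^d}\varphi\,d\pi-\varphi(0)-\eta\varphi_1\Big|\le C\eta^2$, where $\displaystyle\varphi_1=\int_0^\infty\mathcal L_2u_0(0,s)\,ds$ is an absolutely convergent integral and $\displaystyle\varphi_1=\lim_{t\to\infty}u_1(x,t)$ for every $x\in B(0,R)$, so that this limit does not depend on $x$. -/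

import Mathlib

open MeasureTheory ProbabilityTheory Filter Topology Set Metric

noncomputable section

namespace SGD

/-- The Euclidean space `ℝ^d`. -/
abbrev E (d : ℕ) : Type := EuclideanSpace ℝ (Fin d)

variable {d : ℕ} {Ξ : Type*}

/-- `g ∈ C^k(U)` for an open set `U`, with `C^k(U)`-norm controlled by `M`: `g` is `k` times
continuously differentiable on `U` and all its derivatives of order at most `k` are bounded by `M`
on `U`. -/
def CkBound (k : ℕ) (U : Set (E d)) (M : ℝ) (g : E d → ℝ) : Prop :=
  ContDiffOn ℝ k g U ∧ ∀ j : ℕ, j ≤ k → ∀ x ∈ U, ‖iteratedFDeriv ℝ j g x‖ ≤ M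

/-- The standing assumption on the loss `f`, on the random functions `F ξ = f(·; ξ)`, where `ξ` has
law `P`, and on the constants. -/
structure StandingAssumption [MeasurableSpace Ξ] (P : Measure Ξ) (F : Ξ → E d → ℝ) (f : E d → ℝ)
    (γ b R₁ : ℝ) : Prop where
  measurable : ∀ x, Measurable fun ξ => F ξ x
  contDiff : ∀ ξ, ContDiff ℝ 3 (F ξ)
  isLocalMin : IsLocalMin f 0
  integrable_gradient : ∀ x, Integrable (fun ξ => gradient (F ξ) x) P
  unbiased : ∀ x, HasGradientAt f (∫ ξ, gradient (F ξ) x ∂P) x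
  gamma_pos : 0 < γ
  convex : ∀ ξ, ConvexOn ℝ (ball (0 : E d) R₁) fun x => F ξ x - γ / 2 * ‖x‖ ^ 2
  b_pos : 0 < b
  gradient_zero_le : ∀ ξ, ‖gradient (F ξ) 0‖ ≤ b
  lt_radius : 16 * b / (3 * γ) < R₁

/-- The step size threshold `η₀`. -/
def eta0 (γ b R : ℝ) : ℝ :=
  min (1 / (2 * γ)) (min (3 * R / (8 * b))
    ((3 * γ * R ^ 2 / 8 - 2 * b * R) / (2 * γ * b * R + b ^ 2)))

/-- The admissible step sizes: `0 < η ≤ min {η₀, 2 / (γ + L)}`. -/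
def Admissible (γ b R L η : ℝ) : Prop :=
  0 < η ∧ η ≤ eta0 γ b R ∧ η * (γ + L) ≤ 2

/-- The SGD iterates `X_{n+1} = X_n - η ∇f(X_n; ξ_n)` with `X_0 = x`, along a sample `ω = (ξ_n)`. -/
def iter (F : Ξ → E d → ℝ) (η : ℝ) (x : E d) (ω : ℕ → Ξ) : ℕ → E d
  | 0 => x
  | n + 1 => iter F η x ω n - η • gradient (F (ω n)) (iter F η x ω n)

section
variable [MeasurableSpace Ξ]

/-- The law `P^{⊗ℕ}` of an i.i.d. sequence `(ξ_n)` with common law `P`. -/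
def iidLaw (P : Measure Ξ) : Measure (ℕ → Ξ) := Measure.infinitePi fun _ => P

/-- The law `μ_n` of `X_n` when `X_0` has law `μ₀` and is independent of `(ξ_n)`. -/
def law (P : Measure Ξ) (F : Ξ → E d → ℝ) (η : ℝ) (μ₀ : Measure (E d))
    (n : ℕ) : Measure (E d) :=
  (μ₀.prod (iidLaw P)).map fun p => iter F η p.1 p.2 n

/-- The covariance matrix `Σ(x)` of the random gradient at `x`. -/
def covMatrix (P : Measure Ξ) (F : Ξ → E d → ℝ) (f : E d → ℝ) (x : E d) :
    Matrix (Fin d) (Fin d) ℝ :=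
  Matrix.of fun i j =>
    ∫ ξ, (gradient (F ξ) x - gradient f x) i * (gradient (F ξ) x - gradient f x) j ∂P

/-- The Hessian matrix of `v` at `x`. -/
def hessMatrix (v : E d → ℝ) (x : E d) : Matrix (Fin d) (Fin d) ℝ :=
  Matrix.of fun i j =>
    iteratedFDeriv ℝ 2 v x ![EuclideanSpace.single i 1, EuclideanSpace.single j 1]

/-- `𝓛₁ = -∇f · ∇`. -/
def L1 (f : E d → ℝ) (v : E d → ℝ) (x : E d) : ℝ :=
  -inner ℝ (gradient f x) (gradient v x)

/-- `𝓛₂ = -(1/4) ∇‖∇f‖² · ∇ + (1/2) Tr(Σ ∇²)`. -/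
def L2 (P : Measure Ξ) (F : Ξ → E d → ℝ) (f : E d → ℝ) (v : E d → ℝ) (x : E d) : ℝ :=
  -(1 / 4) * inner ℝ (gradient (fun y => ‖gradient f y‖ ^ 2) x) (gradient v x)
    + 1 / 2 * (covMatrix P F f x * hessMatrix v x).trace

end

/-- `u` is a classical solution on `[0, ∞) × B(0, R)` of the transport equation
`∂_t u = 𝓛₁ u + h`, `u(·, 0) = g`: it is jointly `C¹` and is `C²` in the space variable. (On `B(0, R)`
such a solution is unique, since the flow of `-∇f` maps the ball into itself.) -/
structure IsTransportSolution (f : E d → ℝ) (R : ℝ) (h : ℝ → E d → ℝ) (g : E d → ℝ)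
    (u : ℝ → E d → ℝ) : Prop where
  contDiffOn : ContDiffOn ℝ 1 (fun p : ℝ × E d => u p.1 p.2) (Ici 0 ×ˢ ball 0 R)
  contDiffOn_space : ∀ t, 0 ≤ t → ContDiffOn ℝ 2 (u t) (ball 0 R)
  initial : ∀ x ∈ ball (0 : E d) R, u 0 x = g x
  pde : ∀ t, 0 ≤ t → ∀ x ∈ ball (0 : E d) R,
    HasDerivWithinAt (fun s => u s x) (L1 f (u t) x + h t x) (Ici 0) t

/-- `(u₀, u₁)` are the first two coefficients of the formal expansion:
`∂_t u₀ = 𝓛₁ u₀`, `u₀(·, 0) = φ`, and `∂_t u₁ = 𝓛₁ u₁ + 𝓛₂ u₀`, `u₁(·, 0) = 0`. -/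
def IsExpansion [MeasurableSpace Ξ] (P : Measure Ξ) (F : Ξ → E d → ℝ) (f : E d → ℝ) (R : ℝ)
    (φ : E d → ℝ) (u₀ u₁ : ℝ → E d → ℝ) : Prop :=
  IsTransportSolution f R (fun _ _ => 0) φ u₀ ∧
    IsTransportSolution f R (fun t x => L2 P F f (u₀ t) x) (fun _ => 0) u₁

/-- The Wasserstein-2 distance: the infimum over all couplings `κ` of `μ` and `ν`. -/
def W2 (μ ν : Measure (E d)) : ENNReal :=
  (⨅ κ ∈ {κ : Measure (E d × E d) | κ.map Prod.fst = μ ∧ κ.map Prod.snd = ν},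
    ∫⁻ p, edist p.1 p.2 ^ 2 ∂κ) ^ (1 / 2 : ℝ)

end SGD

end

/-! Everything takes place in the ball of radius $R$. There each random map $T_\xi(x)=x-\eta\nabla
F_\xi(x)$ has derivative $I-\eta H$ with $H$ symmetric and $\gamma\le H\le L$, so
$\eta(\gamma+L)\le2$ makes it a $(1-\eta\gamma)$-contraction, and $b<\gamma R$ makes it send the
closed ball into the open one. Composing the maps in reverse order therefore converges along every
sample; $\pi$ is the law of the limit. Two copies driven by the same noise give
$W_2(\mu_n,\pi)\le2R(1-\eta\gamma)^n$ (`Contracting.W2_law_statLaw_le`).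

Claim 1. The functional $\|\mathbb E X\|+\kappa\,\mathbb E\|X\|^2$ contracts by $1-\eta\gamma$ per
step up to an error $O(\eta^2)$ (`Model.moment_step_le`): the noise is centred and reaches the mean
only through the quadratic remainder of $\nabla f$. The functional dominates the bias of every
bounded observable that is $C^2$ near $0$, so this bias is at most $C((1-\eta\gamma)^n+\eta)$, and
$K=1/\gamma$ makes the first term at most $\eta$.

Claim 2. Formally $k=\int_0^\infty(u_0(\cdot,t)-\varphi(0))\,dt$ solves the Poisson equation $\nabla
f\cdot\nabla k=\varphi-\varphi(0)$. Only its first two derivatives $\alpha,\beta$ at $0$ are needed.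
With $q(x)=\alpha x+\frac12\beta(x,x)$, the function $\psi=\nabla f\cdot\nabla q$ matches
$\varphi-\varphi(0)$ to second order at $0$ (`LocalFlow.exists_jet`), so the difference is a cubic
form plus $O(\|x\|^4)$. Under $\pi$ fourth moments are $O(\eta^2)$, and so are third moments,
although scaling alone would give only $\eta^{3/2}$ (`Model.exists_cubic_form_le`). Stationarity
tested on $q$ is an exact identity because $q$ is quadratic: with $g=\nabla F_\xi(x)$ it reads
$\int\psi\,d\pi=\frac\eta2\int\mathbb E\,\beta(g,g)\,d\pi$, and replacing $x$ by $0$ in the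
integrand costs a further $O(\eta)$. Since $\nabla f$ and $\nabla\|\nabla f\|^2$ vanish at $0$, the
resulting coefficient $\frac12\mathbb E\,\beta(\nabla F_\xi(0),\nabla F_\xi(0))$ is
$\int_0^\infty\mathcal L_2u_0(0,s)\,ds$ (`Model.integral_L2_zero`).

The functions $u_0,u_1$ come from characteristics and Duhamel's formula. Nothing is known to extend
smoothly past the open ball, so the data are cut off outside each radius $r<R$ and the solutions on
smaller balls are glued by uniqueness. The flow and its first two space derivatives decay like
$e^{-\gamma t}$, or are dominated by it, which yields absolute convergence and the limit of $u_1$.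
Joint smoothness of the flow is proved by the implicit function theorem in $C([0,1],X)$. -/

noncomputable section

set_option linter.unusedSectionVars false

namespace SGD

/-! ### Smoothness of superposition operators on spaces of continuous functions. -/

section Superposition

variable {K : Type*} [TopologicalSpace K] [CompactSpace K]
  {X Y : Type*} [NormedAddCommGroup X] [NormedSpace ℝ X] [NormedAddCommGroup Y] [NormedSpace ℝ Y]

/-- Pointwise application of a continuous family of operators to a continuous function. -/
def pointwiseApply : C(K, X →L[ℝ] Y) →L[ℝ] C(K, X) →L[ℝ] C(K, Y) :=
  LinearMap.mkContinuous₂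
    (LinearMap.mk₂ ℝ (fun (A : C(K, X →L[ℝ] Y)) (h : C(K, X)) =>
        (⟨fun s => A s (h s), by fun_prop⟩ : C(K, Y)))
      (fun _ _ _ => by ext; simp) (fun _ _ _ => by ext; simp)
      (fun _ _ _ => by ext; simp) (fun _ _ _ => by ext; simp)) 1 (by
    intro A h
    rw [ContinuousMap.norm_le _ (by positivity)]
    intro s
    calc ‖A s (h s)‖ ≤ ‖A s‖ * ‖h s‖ := (A s).le_opNorm _
      _ ≤ ‖A‖ * ‖h‖ := by gcongr <;> exact ContinuousMap.norm_coe_le_norm _ _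
      _ = 1 * ‖A‖ * ‖h‖ := by ring)

@[simp] lemma pointwiseApply_apply (A : C(K, X →L[ℝ] Y)) (h : C(K, X)) (s : K) :
    pointwiseApply A h s = A s (h s) := rfl

/-- The superposition operator `y ↦ g ∘ y`. -/
def superpose (g : X → Y) (hg : Continuous g) (y : C(K, X)) : C(K, Y) :=
  (⟨g, hg⟩ : C(X, Y)).comp y

@[simp] lemma superpose_apply (g : X → Y) (hg : Continuous g) (y : C(K, X)) (s : K) :
    superpose g hg y s = g (y s) := rfl

lemma continuous_superpose (g : X → Y) (hg : Continuous g) :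
    Continuous (superpose (K := K) g hg) :=
  ContinuousMap.continuous_postcomp _

/-- Continuity of the superposition operator of the derivative of `g`, in the sup norm, controls
that derivative along all segments from `y s` to `z s` at once; the mean value inequality is then
uniform in `s`. -/
lemma hasFDerivAt_superpose {g : X → Y} (hg : ContDiff ℝ 1 g) (y : C(K, X)) :
    HasFDerivAt (superpose (K := K) g hg.continuous)
      (pointwiseApply (superpose (fderiv ℝ g) (hg.continuous_fderiv one_ne_zero) y)) y := by
  set D := superpose (K := K) (fderiv ℝ g) (hg.continuous_fderiv one_ne_zero) with hD
  have hDc : Continuous D := continuous_superpose _ _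
  rw [hasFDerivAt_iff_isLittleO, Asymptotics.isLittleO_iff]
  intro c hc
  obtain ⟨δ, hδ, H⟩ := Metric.continuousAt_iff.1 (hDc.continuousAt (x := y)) c hc
  filter_upwards [ball_mem_nhds y hδ] with z hz
  rw [ContinuousMap.norm_le _ (by positivity)]
  intro s
  have hseg : ∀ w ∈ segment ℝ (y s) (z s), ‖fderiv ℝ g w - fderiv ℝ g (y s)‖ ≤ c := by
    intro w hw
    rw [segment_eq_image_lineMap] at hw
    obtain ⟨θ, hθ, rfl⟩ := hw
    have h1 : dist (y + θ • (z - y)) y < δ := by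
      rw [dist_eq_norm, add_sub_cancel_left, norm_smul, Real.norm_of_nonneg hθ.1]
      have : ‖z - y‖ < δ := by rwa [← dist_eq_norm]
      nlinarith [norm_nonneg (z - y), hθ.2]
    have h2 := (H h1).le
    rw [dist_eq_norm] at h2
    have h3 := (ContinuousMap.norm_coe_le_norm _ s).trans h2
    simpa [hD, AffineMap.lineMap_apply, add_comm] using h3
  have h4 := (convex_segment (y s) (z s)).norm_image_sub_le_of_norm_hasFDerivWithin_le'
    (f := g) (f' := fderiv ℝ g) (φ := fderiv ℝ g (y s)) (C := c)
    (fun w _ => ((hg.differentiable one_ne_zero) w).hasFDerivAt.hasFDerivWithinAt) hseg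
    (left_mem_segment ℝ _ _) (right_mem_segment ℝ _ _)
  refine (le_of_eq ?_).trans (h4.trans ?_)
  · simp [hD]
  · gcongr
    exact ContinuousMap.norm_coe_le_norm (z - y) s

/-- The derivative is again a superposition operator, composed with a continuous linear map, so
induction applies. It replaces `Y` by `X →L[ℝ] Y`, which is why both spaces live in one universe. -/
theorem contDiff_superpose.{u} {X Y : Type u} [NormedAddCommGroup X] [NormedSpace ℝ X]
    [NormedAddCommGroup Y] [NormedSpace ℝ Y] {n : ℕ} {g : X → Y} (hg : ContDiff ℝ n g) :
    ContDiff ℝ n (superpose (K := K) g hg.continuous) := by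
  induction n generalizing Y with
  | zero =>
    simp only [CharP.cast_eq_zero, contDiff_zero]
    exact continuous_superpose _ _
  | succ n ih =>
    have h1 : ContDiff ℝ 1 g := hg.of_le (by norm_cast; omega)
    have h0 : ((n + 1 : ℕ) : WithTop ℕ∞) = n + 1 := by push_cast; rfl
    suffices ContDiff ℝ (n + 1) (superpose (K := K) g hg.continuous) by
      convert this
    rw [contDiff_succ_iff_fderiv]
    refine ⟨fun y => (hasFDerivAt_superpose h1 y).differentiableAt, by simp, ?_⟩
    have h2 : fderiv ℝ (superpose (K := K) g hg.continuous) = fun y =>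
        pointwiseApply (superpose (fderiv ℝ g) (h1.continuous_fderiv one_ne_zero) y) :=
      funext fun y => (hasFDerivAt_superpose h1 y).fderiv
    rw [h2]
    have h3 : ContDiff ℝ n (fderiv ℝ g) := hg.fderiv_right (by norm_cast)
    exact pointwiseApply.contDiff.comp (ih h3)

end Superposition

/-! ### The integration operator. -/

section Volterra

variable {X : Type*} [NormedAddCommGroup X] [NormedSpace ℝ X] [CompleteSpace X]

/-- The indefinite integral from `0`, as an operator on `C([0, 1], X)`. -/
def primitive : C(unitInterval, X) →L[ℝ] C(unitInterval, X) :=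
  LinearMap.mkContinuous
    { toFun := fun y => ⟨fun s => ∫ r in (0 : ℝ)..s, y (projIcc 0 1 zero_le_one r), by
        have : Continuous fun r : ℝ => y (projIcc 0 1 zero_le_one r) :=
          y.continuous.comp continuous_projIcc
        exact (intervalIntegral.continuous_primitive
          (fun a b => this.intervalIntegrable a b) 0).comp continuous_subtype_val⟩
      map_add' := fun y z => by
        ext s
        exact intervalIntegral.integral_add
          ((y.continuous.comp continuous_projIcc).intervalIntegrable _ _)
          ((z.continuous.comp continuous_projIcc).intervalIntegrable _ _)
      map_smul' := fun c y => by
        ext s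
        exact intervalIntegral.integral_smul _ _ } 1 (by
    intro y
    rw [ContinuousMap.norm_le _ (by positivity)]
    intro s
    have := intervalIntegral.norm_integral_le_of_norm_le_const (a := 0) (b := (s : ℝ))
      (f := fun r : ℝ => y (projIcc 0 1 zero_le_one r)) (C := ‖y‖)
      (fun r _ => ContinuousMap.norm_coe_le_norm _ _)
    refine this.trans ?_
    rw [sub_zero, abs_of_nonneg s.2.1, one_mul]
    exact mul_le_of_le_one_right (norm_nonneg _) s.2.2)

lemma primitive_apply (y : C(unitInterval, X)) (s : unitInterval) :
    primitive y s = ∫ r in (0 : ℝ)..s, y (projIcc 0 1 zero_le_one r) := rfl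

lemma norm_primitive_le : ‖(primitive : C(unitInterval, X) →L[ℝ] _)‖ ≤ 1 :=
  LinearMap.mkContinuous_norm_le _ zero_le_one _

end Volterra

/-! ### Existence and joint smoothness of flows. -/

section Flow

variable {X : Type*} [NormedAddCommGroup X] [NormedSpace ℝ X] [CompleteSpace X]

/-- `Φ` is the global flow of the vector field `V`. -/
structure IsFlow (V : X → X) (Φ : ℝ → X → X) : Prop where
  zero : ∀ x, Φ 0 x = x
  deriv : ∀ x t, HasDerivAt (fun s => Φ s x) (V (Φ t x)) t

variable {V : X → X} {Φ : ℝ → X → X} {C : NNReal}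

theorem exists_isFlow (hV : LipschitzWith C V) {M : ℝ} (hM : ∀ x, ‖V x‖ ≤ M) :
    ∃ Φ : ℝ → X → X, IsFlow V Φ := by
  have key : ∀ (n : ℕ) (x : X), ∃ α : ℝ → X, α 0 = x ∧
      ∀ t ∈ Ioo (-(n + 1 : ℝ)) (n + 1), HasDerivAt α (V (α t)) t := by
    intro n x
    have hn : (0 : ℝ) < n + 1 := by positivity
    have hM0 : 0 ≤ M := (norm_nonneg _).trans (hM x)
    -- A curve of speed at most `M` stays within distance `M * (n + 1)` up to time `n + 1`, so
    -- boundedness allows any time interval.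
    have hpl : IsPicardLindelof (fun _ => V) (tmin := -(n + 1 : ℝ)) (tmax := n + 1)
        ⟨0, by constructor <;> linarith⟩ x (⟨M, hM0⟩ * ⟨n + 1, hn.le⟩) 0 ⟨M, hM0⟩ C :=
      IsPicardLindelof.of_time_independent (fun x _ => hM x) hV.lipschitzOnWith
        (by simp; exact le_rfl)
    obtain ⟨α, h0, hα⟩ := hpl.exists_eq_forall_mem_Icc_hasDerivWithinAt₀
    exact ⟨α, h0, fun t ht => (hα t (Ioo_subset_Icc_self ht)).hasDerivAt (Icc_mem_nhds ht.1 ht.2)⟩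
  choose α h0 hα using key
  have agree : ∀ (n m : ℕ) (x : X) (t : ℝ), |t| < n + 1 → n ≤ m → α n x t = α m x t := by
    intro n m x t ht hnm
    have hnm' : (n : ℝ) ≤ m := by exact_mod_cast hnm
    refine ODE_solution_unique_of_mem_Ioo (v := fun _ => V) (s := fun _ => univ)
      (a := -(n + 1 : ℝ)) (b := n + 1) (t₀ := 0) (K := C) (fun _ _ => hV.lipschitzOnWith)
      ⟨by linarith [Nat.cast_nonneg (α := ℝ) n], by positivity⟩
      (fun s hs => ⟨hα n x s hs, trivial⟩)
      (fun s hs => ⟨hα m x s ⟨by linarith [hs.1], by linarith [hs.2]⟩, trivial⟩)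
      (by rw [h0, h0]) (abs_lt.1 ht)
  refine ⟨fun t x => α ⌊|t|⌋₊ x t, fun x => by simp [h0], fun x t => ?_⟩
  -- The floor index may jump at `t`, but near `t` all the chosen curves coincide with the one of
  -- index `m`, which is a solution on a neighbourhood of `t`.
  set m : ℕ := ⌊|t|⌋₊ + 1 with hm_def
  have hm : ∀ s : ℝ, |s| < m → α ⌊|s|⌋₊ x s = α m x s := by
    intro s hs
    apply agree
    · exact Nat.lt_floor_add_one _
    · exact Nat.floor_le_of_le hs.le
  have htm : |t| < m := by simpa [m] using Nat.lt_floor_add_one |t|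
  have h1 : HasDerivAt (α m x) (V (α m x t)) t := by
    apply hα
    rw [mem_Ioo, ← abs_lt]
    linarith
  rw [← hm t htm] at h1
  refine h1.congr_of_eventuallyEq ?_
  have : ∀ᶠ s : ℝ in 𝓝 t, |s| < m := (continuous_abs.tendsto t).eventually_lt_const htm
  filter_upwards [this] with s hs using hm s hs

namespace IsFlow

lemma continuous_left (h : IsFlow V Φ) (x : X) : Continuous fun t => Φ t x :=
  continuous_iff_continuousAt.2 fun t => (h.deriv x t).continuousAt

lemma eq_of_curve (h : IsFlow V Φ) (hV : LipschitzWith C V) {α : ℝ → X}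
    (hα : ∀ t, HasDerivAt α (V (α t)) t) (t : ℝ) : α t = Φ t (α 0) := by
  have := ODE_solution_unique_univ (v := fun _ => V) (s := fun _ => univ) (K := C) (t₀ := 0)
    (f := α) (g := fun t => Φ t (α 0)) (fun _ => hV.lipschitzOnWith)
    (fun t => ⟨hα t, trivial⟩) (fun t => ⟨h.deriv _ t, trivial⟩) (h.zero _).symm
  exact congrFun this t

lemma add (h : IsFlow V Φ) (hV : LipschitzWith C V) (s t : ℝ) (x : X) :
    Φ (s + t) x = Φ s (Φ t x) := by
  have := h.eq_of_curve hV (α := fun s => Φ (s + t) x)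
    (fun s => (h.deriv x (s + t)).comp_add_const s t) s
  simpa using this

/-- The rescaled orbit `s ↦ Φ (t s) x` on the unit interval. -/
def orbit (h : IsFlow V Φ) (t : ℝ) (x : X) : C(unitInterval, X) :=
  ⟨fun s => Φ (t * s) x, (h.continuous_left x).comp (by fun_prop)⟩

/-- The integral equation for rescaled orbits, as a map whose zeros are sought. -/
def picardMap (hV : Continuous V) (p : (ℝ × X) × C(unitInterval, X)) : C(unitInterval, X) :=
  p.2 - ContinuousMap.const _ p.1.2 - p.1.1 • primitive (superpose V hV p.2)

lemma picardMap_orbit (h : IsFlow V Φ) (hV : Continuous V) (t : ℝ) (x : X) :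
    picardMap hV ((t, x), h.orbit t x) = 0 := by
  ext s
  have h1 : ∫ r in (0 : ℝ)..s, t • V (Φ (t * r) x) = Φ (t * s) x - Φ (t * 0) x := by
    apply intervalIntegral.integral_eq_sub_of_hasDerivAt (f := fun r => Φ (t * r) x)
    · intro r _
      have := (h.deriv x (t * r)).scomp r ((hasDerivAt_id r).const_mul t)
      simpa [Function.comp_def] using this
    · exact (continuous_const.smul (hV.comp ((h.continuous_left x).comp
        (by fun_prop)))).intervalIntegrable _ _
  have h2 : primitive (superpose V hV (h.orbit t x)) s = ∫ r in (0 : ℝ)..s, V (Φ (t * r) x) := by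
    rw [primitive_apply]
    apply intervalIntegral.integral_congr
    intro r hr
    rw [uIcc_of_le s.2.1] at hr
    have : (projIcc 0 1 zero_le_one r : ℝ) = r := by
      rw [projIcc_of_mem zero_le_one ⟨hr.1, hr.2.trans s.2.2⟩]
    simp [orbit, this]
  rw [intervalIntegral.integral_smul] at h1
  simp only [picardMap, ContinuousMap.sub_apply, ContinuousMap.const_apply,
    ContinuousMap.smul_apply, h2, h1, ContinuousMap.zero_apply]
  simp [orbit, h.zero]

/-- The integral term is Lipschitz in the curve with constant `|t| * C < 1`. This identifies the
curve given by the implicit function theorem with the orbit. -/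
lemma picardMap_injective (hV : LipschitzWith C V) {t : ℝ} (ht : |t| * C < 1) {x : X}
    {y z : C(unitInterval, X)} (hyz : picardMap hV.continuous ((t, x), y) =
      picardMap hV.continuous ((t, x), z)) : y = z := by
  have h1 : y - z = t • primitive (superpose V hV.continuous y - superpose V hV.continuous z) := by
    simp only [picardMap] at hyz
    rw [map_sub, smul_sub]
    have := sub_eq_zero.2 hyz
    rw [← sub_eq_zero, ← this]; abel
  have h2 : ‖superpose V hV.continuous y - superpose V hV.continuous z‖ ≤ C * ‖y - z‖ := by
    rw [ContinuousMap.norm_le _ (by positivity)]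
    intro s
    refine (hV.norm_sub_le (y s) (z s)).trans ?_
    gcongr
    exact ContinuousMap.norm_coe_le_norm (y - z) s
  have h3 : ‖y - z‖ ≤ |t| * C * ‖y - z‖ := by
    calc ‖y - z‖ =
        |t| * ‖primitive (superpose V hV.continuous y - superpose V hV.continuous z)‖ := by
          conv_lhs => rw [h1]
          rw [norm_smul, Real.norm_eq_abs]
      _ ≤ |t| * (1 * (C * ‖y - z‖)) := by
          gcongr
          refine ((primitive (X := X)).le_opNorm _).trans ?_
          gcongr
          exact norm_primitive_le
      _ = |t| * C * ‖y - z‖ := by ring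
  have h4 : ‖y - z‖ = 0 := by nlinarith [norm_nonneg (y - z)]
  exact sub_eq_zero.1 (norm_eq_zero.1 h4)

lemma contDiff_picardMap {n : ℕ} (hV : ContDiff ℝ n V) :
    ContDiff ℝ n (picardMap hV.continuous) := by
  have h1 : ContDiff ℝ n fun x : X => ContinuousMap.const unitInterval x :=
    (LinearMap.mkContinuous (⟨⟨fun x : X => ContinuousMap.const unitInterval x,
      fun _ _ => by ext; simp⟩, fun _ _ => by ext; simp⟩) 1 (fun x => by
        rw [ContinuousMap.norm_le _ (by positivity)]; intro s; simp)).contDiff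
  unfold picardMap
  exact ((contDiff_snd.sub (h1.comp (contDiff_snd.comp contDiff_fst))).sub
    ((contDiff_fst.comp contDiff_fst).smul
      (primitive.contDiff.comp ((contDiff_superpose hV).comp contDiff_snd))))

/-- Orbits are the zeros of `picardMap`, whose partial derivative in the curve is the identity minus
an operator of norm below one, hence invertible. The implicit function theorem makes the orbit
depend smoothly on `(t, x)`; evaluation at rescaled time `1` gives the flow. -/
lemma contDiffAt_of_small (h : IsFlow V Φ) {n : ℕ} (hn : n ≠ 0) (hV : ContDiff ℝ n V)
    (hL : LipschitzWith C V) {t : ℝ} (ht : |t| * C < 1) (x : X) :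
    ContDiffAt ℝ n (fun p : ℝ × X => Φ p.1 p.2) (t, x) := by
  set u : (ℝ × X) × C(unitInterval, X) := ((t, x), h.orbit t x) with hu
  have hV1 : ContDiff ℝ 1 V := hV.of_le (by norm_cast; omega)
  have cd : ContDiffAt ℝ n (picardMap hL.continuous) u := (contDiff_picardMap hV).contDiffAt
  have pn : (n : WithTop ℕ∞) ≠ 0 := by exact_mod_cast hn
  have hpart : fderiv ℝ (picardMap hL.continuous) u ∘L .inr ℝ (ℝ × X) C(unitInterval, X) =
      1 - t • (primitive ∘L pointwiseApply
        (superpose (fderiv ℝ V) (hV1.continuous_fderiv one_ne_zero) u.2)) := by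
    have h1 : HasFDerivAt (fun y => picardMap hL.continuous ((t, x), y))
        (fderiv ℝ (picardMap hL.continuous) u ∘L .inr ℝ (ℝ × X) C(unitInterval, X)) u.2 :=
      ((cd.differentiableAt pn).hasFDerivAt).comp u.2 (hasFDerivAt_prodMk_right (t, x) u.2)
    refine h1.unique ?_
    have h2 := (hasFDerivAt_superpose hV1 u.2)
    have h3 := ((hasFDerivAt_id u.2).sub_const (ContinuousMap.const _ x)).sub
      ((primitive.hasFDerivAt.comp u.2 h2).const_smul t)
    exact h3
  have hinv : (fderiv ℝ (picardMap hL.continuous) u ∘L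
      .inr ℝ (ℝ × X) C(unitInterval, X)).IsInvertible := by
    rw [hpart]
    suffices hu : IsUnit (1 - t • (primitive ∘L pointwiseApply
        (superpose (fderiv ℝ V) (hV1.continuous_fderiv one_ne_zero) u.2))) by
      obtain ⟨w, hw⟩ := hu
      exact ⟨ContinuousLinearEquiv.unitsEquiv ℝ _ w, hw⟩
    refine isUnit_one_sub_of_norm_lt_one (R := C(unitInterval, X) →L[ℝ] C(unitInterval, X)) ?_
    refine lt_of_le_of_lt ?_ ht
    refine ContinuousLinearMap.opNorm_le_bound _ (by positivity) fun y => ?_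
    rw [_root_.smul_apply, norm_smul, Real.norm_eq_abs, mul_assoc]
    gcongr
    refine ((primitive (X := X)).le_opNorm _).trans ?_
    refine (mul_le_of_le_one_left (norm_nonneg _) norm_primitive_le).trans ?_
    rw [ContinuousMap.norm_le _ (by have := C.2; positivity)]
    intro s
    refine ((fderiv ℝ V (u.2 s)).le_opNorm (y s)).trans ?_
    gcongr
    · exact norm_fderiv_le_of_lipschitz ℝ hL
    · exact ContinuousMap.norm_coe_le_norm y s
  have hψ := cd.contDiffAt_implicitFunction pn hinv
  have hev := cd.eventually_apply_implicitFunction pn hinv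
  set ψ := cd.implicitFunction pn hinv
  have hsmall : ∀ᶠ p : ℝ × X in 𝓝 (t, x), |p.1| * C < 1 := by
    have : Continuous fun p : ℝ × X => |p.1| * (C : ℝ) := by fun_prop
    exact (this.tendsto (t, x)).eventually_lt_const ht
  have heq : (fun p : ℝ × X => Φ p.1 p.2) =ᶠ[𝓝 (t, x)] fun p => ψ p 1 := by
    filter_upwards [hev, hsmall] with p hp hp'
    have h5 : h.orbit p.1 p.2 = ψ p := by
      apply picardMap_injective hL hp' (x := p.2)
      rw [h.picardMap_orbit]
      rw [hu, h.picardMap_orbit] at hp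
      exact hp.symm
    rw [← h5]
    simp [orbit]
  refine ContDiffAt.congr_of_eventuallyEq ?_ heq
  exact ((ContinuousMap.evalCLM ℝ (1 : unitInterval)).contDiff.contDiffAt).comp (t, x) hψ

/-- The flow of a Lipschitz vector field of class `C^n` is jointly of class `C^n`. -/
theorem contDiff (h : IsFlow V Φ) {n : ℕ} (hn : n ≠ 0) (hV : ContDiff ℝ n V)
    (hL : LipschitzWith C V) : ContDiff ℝ n fun p : ℝ × X => Φ p.1 p.2 := by
  have hsp : ∀ t : ℝ, |t| * C < 1 → ContDiff ℝ n (Φ t) := fun t ht =>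
    contDiff_iff_contDiffAt.2 fun x =>
      (h.contDiffAt_of_small hn hV hL ht x).comp x (contDiffAt_const.prodMk contDiffAt_id)
  -- An arbitrary time is a sum of `m` equal short ones, and the group law composes the short flows.
  have hall : ∀ t, ContDiff ℝ n (Φ t) := by
    intro t
    obtain ⟨m, hm⟩ := exists_nat_gt (|t| * C)
    have hm0 : (0 : ℝ) < m := lt_of_le_of_lt (by positivity) hm
    have h1 : ContDiff ℝ n (Φ (t / m)) := by
      apply hsp
      rw [abs_div, Nat.abs_cast, div_mul_eq_mul_div, div_lt_one hm0]
      exact hm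
    have h2 : ∀ k : ℕ, ContDiff ℝ n (Φ (k * (t / m))) := by
      intro k
      induction k with
      | zero =>
        have : Φ 0 = id := funext h.zero
        simp only [Nat.cast_zero, zero_mul, this]
        exact contDiff_id
      | succ k ih =>
        have : Φ ((k + 1 : ℕ) * (t / m)) = Φ (t / m) ∘ Φ (k * (t / m)) := by
          funext x
          rw [Function.comp_apply, ← h.add hL]
          congr 1
          push_cast
          ring
        rw [this]
        exact h1.comp ih
    have := h2 m
    rwa [mul_div_cancel₀ _ hm0.ne'] at this
  rw [contDiff_iff_contDiffAt]
  rintro ⟨t, x⟩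
  -- Joint smoothness near time `t`: flow for the fixed time `t`, then for the small increment.
  have h3 : (fun p : ℝ × X => Φ p.1 p.2) =
      (fun p : ℝ × X => Φ p.1 p.2) ∘ fun p : ℝ × X => (p.1 - t, Φ t p.2) := by
    funext p
    simp only [Function.comp_apply]
    rw [← h.add hL]
    simp
  rw [h3]
  apply ContDiffAt.comp
  · exact h.contDiffAt_of_small hn hV hL (by simp) _
  · exact (contDiffAt_fst.sub contDiffAt_const).prodMk ((hall t).contDiffAt.comp _ contDiffAt_snd)

end IsFlow

end Flow

/-! ### Differentiation under the integral sign. -/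

section ParametricIntegral

universe u
variable {Ω : Type*} [MeasurableSpace Ω] {μ : Measure Ω} [IsFiniteMeasure μ]
  {X Y : Type u} [NormedAddCommGroup X] [NormedSpace ℝ X] [FiniteDimensional ℝ X]
  [NormedAddCommGroup Y] [NormedSpace ℝ Y] {U : Set X} {g : Ω → X → Y} {M : ℝ}

/-- A directional derivative is a limit of difference quotients; the index is shifted by `N` so that
all base points lie in `U`, where measurability is known. -/
lemma stronglyMeasurable_fderiv_apply (hg : ∀ x, x ∈ U → StronglyMeasurable fun ω => g ω x)
    (hU : IsOpen U) {x : X} (hx : x ∈ U) (hd : ∀ ω, DifferentiableAt ℝ (g ω) x) (v : X) :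
    StronglyMeasurable fun ω => fderiv ℝ (g ω) x v := by
  have hc : Tendsto (fun n : ℕ => x + ((n : ℝ) + 1)⁻¹ • v) atTop (𝓝 x) := by
    have h1 : Tendsto (fun n : ℕ => ((n : ℝ) + 1)⁻¹) atTop (𝓝 0) := by
      simpa using tendsto_one_div_add_atTop_nhds_zero_nat (𝕜 := ℝ)
    simpa using (h1.smul_const v).const_add x
  obtain ⟨N, hN⟩ := eventually_atTop.1 (hc.eventually (hU.mem_nhds hx))
  refine stronglyMeasurable_of_tendsto (u := atTop)
    (f := fun (n : ℕ) ω => ((n + N : ℕ) + 1 : ℝ) •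
      (g ω (x + (((n + N : ℕ) : ℝ) + 1)⁻¹ • v) - g ω x)) (fun n => ?_) ?_
  · exact ((hg _ (hN _ (by omega))).sub (hg x hx)).const_smul _
  · rw [tendsto_pi_nhds]
    intro ω
    have h2 := (hd ω).hasFDerivAt.lim v (α := ℕ) (l := atTop)
      (c := fun n => ((n + N : ℕ) + 1 : ℝ))
      (by
        refine tendsto_norm_atTop_atTop.comp ?_
        exact tendsto_atTop_add_const_right _ _
          (tendsto_natCast_atTop_atTop.comp (tendsto_add_atTop_nat N)))
    exact h2

lemma stronglyMeasurable_fderiv (hg : ∀ x, x ∈ U → StronglyMeasurable fun ω => g ω x)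
    (hU : IsOpen U) {x : X} (hx : x ∈ U) (hd : ∀ ω, DifferentiableAt ℝ (g ω) x) :
    StronglyMeasurable fun ω => fderiv ℝ (g ω) x := by
  let b := Module.finBasis ℝ X
  have h1 : ∀ A : X →L[ℝ] Y,
      A = ∑ i, (LinearMap.toContinuousLinearMap (b.coord i)).smulRight (A (b i)) := by
    intro A
    ext v
    conv_lhs => rw [← b.sum_repr v, map_sum]
    simp
  have h2 : (fun ω => fderiv ℝ (g ω) x) = fun ω => ∑ i,
      (LinearMap.toContinuousLinearMap (b.coord i)).smulRight (fderiv ℝ (g ω) x (b i)) :=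
    funext fun ω => h1 _
  rw [h2]
  refine Finset.stronglyMeasurable_fun_sum _ fun i _ => ?_
  have h3 : Continuous fun y : Y => (LinearMap.toContinuousLinearMap (b.coord i)).smulRight y :=
    (ContinuousLinearMap.smulRightL ℝ X Y (LinearMap.toContinuousLinearMap (b.coord i))).continuous
  exact h3.comp_stronglyMeasurable (stronglyMeasurable_fderiv_apply hg hU hx hd _)

lemma hasFDerivAt_integral_of_bounded (hU : IsOpen U)
    (hg : ∀ x, x ∈ U → StronglyMeasurable fun ω => g ω x)
    (hd : ∀ ω, ∀ x ∈ U, DifferentiableAt ℝ (g ω) x)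
    (hb : ∀ ω, ∀ x ∈ U, ‖fderiv ℝ (g ω) x‖ ≤ M) {x : X} (hx : x ∈ U)
    (hi : Integrable (fun ω => g ω x) μ) :
    HasFDerivAt (fun y => ∫ ω, g ω y ∂μ) (∫ ω, fderiv ℝ (g ω) x ∂μ) x :=
  hasFDerivAt_integral_of_dominated_of_fderiv_le (F' := fun y ω => fderiv ℝ (g ω) y)
    (bound := fun _ => M) (hU.mem_nhds hx)
    (by filter_upwards [hU.mem_nhds hx] with y hy using (hg y hy).aestronglyMeasurable) hi
    (stronglyMeasurable_fderiv hg hU hx fun ω => hd ω x hx).aestronglyMeasurable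
    (Eventually.of_forall fun ω y hy => hb ω y hy) (integrable_const _)
    (Eventually.of_forall fun ω y hy => (hd ω y hy).hasFDerivAt)

/-- Induction on `n`: the constant `M` is integrable because `μ` is finite, so it dominates each
derivative. As `Y` is replaced by `X →L[ℝ] Y`, both spaces share a universe. -/
theorem contDiffOn_integral {n : ℕ} (hU : IsOpen U)
    (hg : ∀ x, x ∈ U → StronglyMeasurable fun ω => g ω x)
    (hc : ∀ ω, ContDiffOn ℝ n (g ω) U)
    (hb : ∀ ω, ∀ j ≤ n, ∀ x ∈ U, ‖iteratedFDeriv ℝ j (g ω) x‖ ≤ M) :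
    ContDiffOn ℝ n (fun y => ∫ ω, g ω y ∂μ) U := by
  induction n generalizing Y with
  | zero =>
    simp only [CharP.cast_eq_zero, contDiffOn_zero] at hc ⊢
    intro x hx
    refine ContinuousAt.continuousWithinAt ?_
    refine continuousAt_of_dominated (bound := fun _ => M) ?_ ?_ (integrable_const _) ?_
    · filter_upwards [hU.mem_nhds hx] with y hy using (hg y hy).aestronglyMeasurable
    · filter_upwards [hU.mem_nhds hx] with y hy
      exact Eventually.of_forall fun ω => by simpa using hb ω 0 le_rfl y hy
    · exact Eventually.of_forall fun ω => (hc ω).continuousAt (hU.mem_nhds hx)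
  | succ n ih =>
    have h0 : ((n + 1 : ℕ) : WithTop ℕ∞) = n + 1 := by push_cast; rfl
    rw [h0] at hc ⊢
    simp only [contDiffOn_succ_iff_fderiv_of_isOpen hU] at hc ⊢
    have hd : ∀ ω, ∀ x ∈ U, DifferentiableAt ℝ (g ω) x := fun ω x hx =>
      ((hc ω).1 x hx).differentiableAt (hU.mem_nhds hx)
    have hD : ∀ x ∈ U, HasFDerivAt (fun y => ∫ ω, g ω y ∂μ) (∫ ω, fderiv ℝ (g ω) x ∂μ) x := by
      intro x hx
      refine hasFDerivAt_integral_of_bounded hU hg hd (M := M) (fun ω x hx => ?_) hx ?_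
      · have := hb ω 1 (by omega) x hx
        rwa [← norm_iteratedFDeriv_fderiv, norm_iteratedFDeriv_zero] at this
      · exact Integrable.of_bound (hg x hx).aestronglyMeasurable M
          (Eventually.of_forall fun ω => by simpa using hb ω 0 (by omega) x hx)
    refine ⟨fun x hx => (hD x hx).differentiableAt.differentiableWithinAt, by simp, ?_⟩
    refine (ih (g := fun ω => fderiv ℝ (g ω)) (fun x hx => ?_) (fun ω => (hc ω).2.2) ?_).congr
      fun x hx => (hD x hx).fderiv
    · exact stronglyMeasurable_fderiv hg hU hx fun ω => hd ω x hx
    · intro ω j hj x hx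
      rw [norm_iteratedFDeriv_fderiv]
      exact hb ω (j + 1) (by omega) x hx

/-- Integration over `[0, 1]` of a jointly `C^n` function preserves `C^n`. -/
theorem contDiff_integral_unitInterval {n : ℕ} {Y : Type} {X : Type} [NormedAddCommGroup X]
    [NormedSpace ℝ X] [FiniteDimensional ℝ X] [NormedAddCommGroup Y] [NormedSpace ℝ Y]
    {H : ℝ → X → Y} (hH : ContDiff ℝ n fun p : ℝ × X => H p.1 p.2) :
    ContDiff ℝ n fun x => ∫ σ in (0 : ℝ)..1, H σ x := by
  rw [contDiff_iff_contDiffAt]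
  intro x₀
  -- Clamping `σ` to the unit interval makes the bounds from compactness hold for every `σ`, not
  -- merely almost every one.
  set π := projIcc (0 : ℝ) 1 zero_le_one
  have hsl : ∀ σ, ContDiff ℝ n (H σ) := fun σ => hH.comp (contDiff_const.prodMk contDiff_id)
  have hcont : ∀ j : ℕ, j ≤ n → Continuous fun p : ℝ × X => iteratedFDeriv ℝ j (H p.1) p.2 := by
    intro j hj
    have h1 : (fun p : ℝ × X => iteratedFDeriv ℝ j (H p.1) p.2) = fun p =>
        (iteratedFDeriv ℝ j (fun p : ℝ × X => H p.1 p.2) p).compContinuousLinearMap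
          fun _ => ContinuousLinearMap.inr ℝ ℝ X := by
      funext p
      -- A slice is a translate of the joint map composed with a linear inclusion, so its
      -- derivatives are restrictions of the joint ones and inherit their continuity in both
      -- variables.
      have h2 : H p.1 = (fun q : ℝ × X => H (q.1 + p.1) q.2) ∘ ContinuousLinearMap.inr ℝ ℝ X := by
        funext y; simp
      have h3 : ContDiff ℝ n (fun q : ℝ × X => H (q.1 + p.1) q.2) :=
        hH.comp ((contDiff_fst.add contDiff_const).prodMk contDiff_snd)
      conv_lhs => rw [h2]
      rw [ContinuousLinearMap.iteratedFDeriv_comp_right _ h3 _ (by exact_mod_cast hj)]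
      have h4 : (fun q : ℝ × X => H (q.1 + p.1) q.2) =
          fun q => (fun p : ℝ × X => H p.1 p.2) (q + (p.1, 0)) := by
        funext q; simp
      rw [h4, iteratedFDeriv_comp_add_right (f := fun p : ℝ × X => H p.1 p.2)]
      simp
    rw [h1]
    have h5 := hH.continuous_iteratedFDeriv (m := j) (by exact_mod_cast hj)
    exact (ContinuousMultilinearMap.compContinuousLinearMapL
      (fun _ : Fin j => ContinuousLinearMap.inr ℝ ℝ X)).continuous.comp h5
  have hbd : ∀ j : ℕ, j ≤ n → ∃ M, ∀ σ ∈ Icc (0 : ℝ) 1, ∀ x ∈ ball x₀ 1,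
      ‖iteratedFDeriv ℝ j (H σ) x‖ ≤ M := by
    intro j hj
    obtain ⟨M, hM⟩ := (isCompact_Icc.prod (isCompact_closedBall x₀ 1)).exists_bound_of_continuousOn
      (s := Icc (0 : ℝ) 1 ×ˢ closedBall x₀ 1) (hcont j hj).continuousOn
    exact ⟨M, fun σ hσ x hx => hM (σ, x) ⟨hσ, ball_subset_closedBall hx⟩⟩
  choose! M hM using hbd
  have key : ContDiffOn ℝ n (fun x => ∫ σ, H (π σ) x ∂(volume.restrict (Ioc (0 : ℝ) 1)))
      (ball x₀ 1) := by
    refine contDiffOn_integral (M := ∑ j ∈ Finset.range (n + 1), |M j|) isOpen_ball ?_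
      (fun ω => (hsl _).contDiffOn) ?_
    · intro x _
      have : Continuous fun σ => H (π σ) x :=
        hH.continuous.comp (f := fun σ : ℝ => ((π σ : ℝ), x)) (by fun_prop)
      exact this.stronglyMeasurable
    · intro σ j hj x hx
      refine (hM j hj _ (π σ).2 x hx).trans ((le_abs_self _).trans ?_)
      exact Finset.single_le_sum (f := fun j => |M j|) (fun _ _ => abs_nonneg _)
        (Finset.mem_range.2 (by omega))
  refine (key.contDiffAt (ball_mem_nhds _ one_pos)).congr_of_eventuallyEq
    (Eventually.of_forall fun x => ?_)
  beta_reduce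
  rw [intervalIntegral.integral_of_le zero_le_one]
  refine setIntegral_congr_fun measurableSet_Ioc fun σ hσ => ?_
  simp [π, projIcc_of_mem zero_le_one (Ioc_subset_Icc_self hσ)]

end ParametricIntegral

/-! ### Strong convexity and contraction of a gradient step. -/

section Geometry

variable {d : ℕ} {g : E d → ℝ} {γ L r : ℝ}

/-- Along the segment from `y` to `x` the convex function has a slope between its derivatives at the
two ends. -/
lemma gradient_strongly_monotone (hg : Differentiable ℝ g)
    (hc : ConvexOn ℝ (ball (0 : E d) r) fun x => g x - γ / 2 * ‖x‖ ^ 2) {x y : E d}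
    (hx : x ∈ ball 0 r) (hy : y ∈ ball 0 r) :
    γ * ‖x - y‖ ^ 2 ≤ inner ℝ (gradient g x - gradient g y) (x - y) := by
  set l : ℝ →ᵃ[ℝ] E d := AffineMap.lineMap y x
  have h1 : ConvexOn ℝ (l ⁻¹' ball 0 r) ((fun x => g x - γ / 2 * ‖x‖ ^ 2) ∘ l) :=
    hc.comp_affineMap l
  have hl : ∀ t, HasDerivAt l (x - y) t := fun t => AffineMap.hasDerivAt_lineMap
  have h2 : ∀ t, HasDerivAt ((fun x => g x - γ / 2 * ‖x‖ ^ 2) ∘ l)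
      (inner ℝ (gradient g (l t)) (x - y) - γ * inner ℝ (l t) (x - y)) t := by
    intro t
    have h3 := ((hg (l t)).hasFDerivAt.comp_hasDerivAt t (hl t)).sub
      (((hl t).norm_sq).const_mul (γ / 2))
    rw [inner_gradient_left]
    exact h3.congr_deriv (by ring)
  have m0 : (0 : ℝ) ∈ l ⁻¹' ball 0 r := by simpa [l] using hy
  have m1 : (1 : ℝ) ∈ l ⁻¹' ball 0 r := by simpa [l] using hx
  have h4 := (h1.le_slope_of_hasDerivAt m0 m1 one_pos (h2 0)).trans
    (h1.slope_le_of_hasDerivAt m0 m1 one_pos (h2 1))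
  simp only [l, AffineMap.lineMap_apply_zero, AffineMap.lineMap_apply_one] at h4
  rw [inner_sub_left, ← real_inner_self_eq_norm_sq]
  have h5 : inner ℝ (x - y) (x - y) = inner ℝ x (x - y) - inner ℝ y (x - y) := inner_sub_left _ _ _
  rw [h5]
  linarith

/-- The gradient as the composition of the derivative with the Riesz isomorphism. -/
lemma gradient_eq_comp (g : E d → ℝ) :
    gradient g = fun x => (InnerProductSpace.toDual ℝ (E d)).symm (fderiv ℝ g x) := rfl

lemma hasFDerivAt_gradient {x : E d} (hg : DifferentiableAt ℝ (fderiv ℝ g) x) :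
    HasFDerivAt (gradient g)
      ((InnerProductSpace.toDual ℝ (E d)).symm.toContinuousLinearEquiv.toContinuousLinearMap ∘L
      fderiv ℝ (fderiv ℝ g) x) x :=
  (InnerProductSpace.toDual ℝ (E d)).symm.toContinuousLinearEquiv.hasFDerivAt.comp x hg.hasFDerivAt

lemma inner_fderiv_gradient {x : E d} (hg : DifferentiableAt ℝ (fderiv ℝ g) x) (v w : E d) :
    inner ℝ (fderiv ℝ (gradient g) x v) w = fderiv ℝ (fderiv ℝ g) x v w := by
  rw [(hasFDerivAt_gradient hg).fderiv]
  exact InnerProductSpace.toDual_symm_apply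

lemma inner_fderiv_ge {V : E d → E d} {x : E d} (hV : DifferentiableAt ℝ V x)
    (hm : ∀ᶠ y in 𝓝 x, γ * ‖y - x‖ ^ 2 ≤ inner ℝ (V y - V x) (y - x)) (v : E d) :
    γ * ‖v‖ ^ 2 ≤ inner ℝ (fderiv ℝ V x v) v := by
  have h1 : HasDerivAt (fun t : ℝ => V (x + t • v)) (fderiv ℝ V x v) 0 := by
    have hl : HasDerivAt (fun t : ℝ => x + t • v) v 0 := by
      simpa using ((hasDerivAt_id (0 : ℝ)).smul_const v).const_add x
    have h2 : HasFDerivAt V (fderiv ℝ V x) (x + (0 : ℝ) • v) := by simpa using hV.hasFDerivAt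
    exact h2.comp_hasDerivAt 0 hl
  have h2 := h1.tendsto_slope_zero_right
  have h3 : Tendsto (fun t : ℝ => inner ℝ (t⁻¹ • (V (x + (0 + t) • v) - V (x + (0 : ℝ) • v))) v)
      (𝓝[>] 0) (𝓝 (inner ℝ (fderiv ℝ V x v) v)) := h2.inner tendsto_const_nhds
  refine ge_of_tendsto h3 ?_
  have h4 : Tendsto (fun t : ℝ => x + t • v) (𝓝[>] 0) (𝓝 x) := by
    have : Continuous fun t : ℝ => x + t • v := by fun_prop
    exact (this.tendsto' 0 x (by simp)).mono_left nhdsWithin_le_nhds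
  filter_upwards [h4.eventually hm, self_mem_nhdsWithin] with t ht (ht0 : 0 < t)
  rw [inner_smul_left]
  simp only [add_sub_cancel_left, inner_smul_right, norm_smul, zero_add, zero_smul, add_zero,
    Real.norm_eq_abs, mul_pow, sq_abs] at ht ⊢
  have h5 : γ * t * ‖v‖ ^ 2 ≤ inner ℝ (V (x + t • v) - V x) v := by
    have : t * (γ * t * ‖v‖ ^ 2) ≤ t * inner ℝ (V (x + t • v) - V x) v := by linarith
    exact le_of_mul_le_mul_left this ht0
  have h6 : (starRingEnd ℝ) t⁻¹ = t⁻¹ := rfl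
  rw [h6, ← div_eq_inv_mul, le_div_iff₀ ht0]
  linarith

/-- For a symmetric operator the quadratic form controls the norm: polarize between `t • v + S v`
and `t • v - S v`. The choice `t = ‖S v‖ / ‖v‖` gives both summands equal length, so the
parallelogram law is sharp. -/
lemma norm_le_of_abs_inner_le {S : E d →L[ℝ] E d} {ρ : ℝ}
    (hs : ∀ v w, inner ℝ (S v) w = inner ℝ v (S w))
    (hb : ∀ v, |inner ℝ (S v) v| ≤ ρ * ‖v‖ ^ 2) (v : E d) : ‖S v‖ ≤ ρ * ‖v‖ := by
  rcases eq_or_ne v 0 with rfl | hv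
  · simp
  have ha : 0 < ‖v‖ := norm_pos_iff.2 hv
  have hρ : 0 ≤ ρ := by
    have := (abs_nonneg _).trans (hb v)
    exact nonneg_of_mul_nonneg_left this (by positivity)
  rcases eq_or_ne (S v) 0 with h0 | h0
  · rw [h0, norm_zero]; positivity
  have hc : 0 < ‖S v‖ := norm_pos_iff.2 h0
  set t := ‖S v‖ / ‖v‖ with ht
  have ht0 : 0 < t := div_pos hc ha
  have h1 := (abs_le.1 (hb (t • v + S v))).2
  have h2 := (abs_le.1 (hb (t • v - S v))).1
  have h3 : inner ℝ (S (t • v + S v)) (t • v + S v) - inner ℝ (S (t • v - S v)) (t • v - S v)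
      = 4 * t * ‖S v‖ ^ 2 := by
    rw [← real_inner_self_eq_norm_sq]
    simp only [map_add, map_sub, map_smul, inner_add_left, inner_add_right, inner_sub_left,
      inner_sub_right, inner_smul_left, inner_smul_right, hs (S v) v]
    simp
    ring
  have h4 : ‖t • v + S v‖ ^ 2 + ‖t • v - S v‖ ^ 2 = 4 * ‖S v‖ ^ 2 := by
    have h5 := parallelogram_law_with_norm ℝ (t • v) (S v)
    have h6 : ‖t • v‖ = ‖S v‖ := by
      rw [norm_smul, Real.norm_of_nonneg ht0.le, ht, div_mul_cancel₀ _ ha.ne']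
    rw [h6] at h5
    nlinarith
  have h7 : 4 * t * ‖S v‖ ^ 2 ≤ 4 * ρ * ‖S v‖ ^ 2 := by
    rw [← h3]; nlinarith
  have h8 : t ≤ ρ := by
    have : 0 < 4 * ‖S v‖ ^ 2 := by positivity
    nlinarith
  rwa [ht, div_le_iff₀ ha] at h8

/-- The derivative of the step is symmetric with quadratic form between `1 - η * L` and `1 - η * γ`;
`η * (γ + L) ≤ 2` says that the lower end is at least `-(1 - η * γ)`. Continuity carries the bound
to the closed ball. -/
lemma lipschitzOnWith_gradientStep {η : ℝ} (hg : ContDiff ℝ 3 g) (hη : 0 ≤ η) (hηγ : η * γ ≤ 1)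
    (hηL : η * (γ + L) ≤ 2)
    (hm : ∀ x ∈ ball (0 : E d) r, ∀ y ∈ ball (0 : E d) r,
      γ * ‖x - y‖ ^ 2 ≤ inner ℝ (gradient g x - gradient g y) (x - y))
    (hL : ∀ x ∈ ball (0 : E d) r, ‖iteratedFDeriv ℝ 2 g x‖ ≤ L) (hr : r ≠ 0) :
    ∀ x ∈ closedBall (0 : E d) r, ∀ y ∈ closedBall (0 : E d) r,
      ‖(x - η • gradient g x) - (y - η • gradient g y)‖ ≤ (1 - η * γ) * ‖x - y‖ := by
  have hg2 : ContDiff ℝ 2 (fderiv ℝ g) := hg.fderiv_right (by norm_num)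
  have hgd : Differentiable ℝ (fderiv ℝ g) := hg2.differentiable (by norm_num)
  have hG : ∀ x, HasFDerivAt (gradient g) (fderiv ℝ (gradient g) x) x := fun x =>
    (hasFDerivAt_gradient (hgd x)).differentiableAt.hasFDerivAt
  have hT : ∀ x, HasFDerivAt (fun x => x - η • gradient g x)
      (ContinuousLinearMap.id ℝ (E d) - η • fderiv ℝ (gradient g) x) x := fun x =>
    (hasFDerivAt_id x).sub ((hG x).const_smul η)
  have hnn : 0 ≤ 1 - η * γ := by linarith
  have hn : ∀ x ∈ ball (0 : E d) r,
      ‖ContinuousLinearMap.id ℝ (E d) - η • fderiv ℝ (gradient g) x‖ ≤ 1 - η * γ := by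
    intro x hx
    refine ContinuousLinearMap.opNorm_le_bound _ hnn (norm_le_of_abs_inner_le ?_ ?_)
    · intro v w
      have hsym : fderiv ℝ (fderiv ℝ g) x v w = fderiv ℝ (fderiv ℝ g) x w v :=
        (hg.contDiffAt.isSymmSndFDerivAt (by simp; norm_num)) v w
      have e2 := inner_fderiv_gradient (hgd x) w v
      rw [real_inner_comm] at e2
      simp only [_root_.sub_apply, ContinuousLinearMap.id_apply, _root_.smul_apply,
        inner_sub_left, inner_sub_right, inner_smul_left, inner_smul_right,
        inner_fderiv_gradient (hgd x), e2, hsym]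
      rfl
    · intro v
      have h1 := inner_fderiv_ge (γ := γ) (hG x).differentiableAt
        (by filter_upwards [isOpen_ball.mem_nhds hx] with y hy using hm y hy x hx) v
      have h2 : inner ℝ (fderiv ℝ (gradient g) x v) v ≤ L * ‖v‖ ^ 2 := by
        rw [inner_fderiv_gradient (hgd x)]
        have h3 := (iteratedFDeriv ℝ 2 g x).le_opNorm ![v, v]
        rw [iteratedFDeriv_two_apply] at h3
        simp only [Matrix.cons_val_zero, Matrix.cons_val_one, Fin.prod_univ_two] at h3
        refine (le_abs_self _).trans (h3.trans ?_)
        rw [pow_two]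
        exact mul_le_mul_of_nonneg_right (hL x hx) (by positivity)
      have h4 : inner ℝ ((ContinuousLinearMap.id ℝ (E d) - η • fderiv ℝ (gradient g) x) v) v
          = ‖v‖ ^ 2 - η * inner ℝ (fderiv ℝ (gradient g) x v) v := by
        rw [← real_inner_self_eq_norm_sq]
        simp [inner_sub_left, inner_smul_left]
      rw [h4, abs_le]
      constructor
      · nlinarith [sq_nonneg ‖v‖, mul_le_mul_of_nonneg_left h2 hη]
      · nlinarith [mul_le_mul_of_nonneg_left h1 hη]
  have hlip : LipschitzOnWith (Real.toNNReal (1 - η * γ)) (fun x => x - η • gradient g x)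
      (ball (0 : E d) r) := by
    refine (convex_ball (0 : E d) r).lipschitzOnWith_of_nnnorm_hasFDerivWithin_le
      (fun x _ => (hT x).hasFDerivWithinAt) fun x hx => ?_
    rw [← NNReal.coe_le_coe, coe_nnnorm, Real.coe_toNNReal _ hnn]
    exact hn x hx
  have hcont : Continuous fun x => x - η • gradient g x :=
    continuous_iff_continuousAt.2 fun x => (hT x).continuousAt
  have hlip' := hlip.closure hcont.continuousOn
  rw [closure_ball _ hr] at hlip'
  intro x hx y hy
  have := hlip'.dist_le_mul x hx y hy
  rwa [Real.coe_toNNReal _ hnn, dist_eq_norm, dist_eq_norm] at this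

end Geometry

/-! ### The Markov chain, its stationary law and convergence in Wasserstein distance. -/

section Dynamics

variable {d : ℕ} {Ξ : Type*} [MeasurableSpace Ξ]

/-- One step of SGD. -/
def sgdStep (F : Ξ → E d → ℝ) (η : ℝ) (ξ : Ξ) (x : E d) : E d := x - η • gradient (F ξ) x

/-- The law of the next iterate when the current one has law `μ`. -/
def stepMeasure (P : Measure Ξ) (F : Ξ → E d → ℝ) (η : ℝ) (μ : Measure (E d)) : Measure (E d) :=
  (μ.prod P).map fun p => sgdStep F η p.2 p.1

/-- Prepending an element to a sequence. -/
def consSeq (p : Ξ × (ℕ → Ξ)) : ℕ → Ξ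
  | 0 => p.1
  | n + 1 => p.2 n

lemma measurable_consSeq : Measurable (consSeq (Ξ := Ξ)) := by
  rw [measurable_pi_iff]
  rintro (_ | n)
  · exact measurable_fst
  · exact (measurable_pi_apply n).comp measurable_snd

variable (P : Measure Ξ) [IsProbabilityMeasure P]

instance : IsProbabilityMeasure (iidLaw P) := by unfold iidLaw; infer_instance

/-- It suffices to compare the measures on cylinders, where the constraint on coordinate `0` splits
off as one factor. -/
lemma map_consSeq : (P.prod (iidLaw P)).map consSeq = iidLaw P := by
  refine Measure.eq_infinitePi _ fun s t ht => ?_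
  rw [Measure.map_apply measurable_consSeq (MeasurableSet.pi s.countable_toSet fun i _ => ht i)]
  classical
  set s' : Finset ℕ := s.preimage Nat.succ Nat.succ_injective.injOn with hs'
  have h1 : consSeq ⁻¹' (Set.pi s t) =
      (if 0 ∈ s then t 0 else univ) ×ˢ Set.pi s' (fun n => t (n + 1)) := by
    ext ⟨ξ, ω⟩
    simp only [mem_preimage, Set.mem_pi, Finset.mem_coe, mem_prod, hs', Finset.mem_preimage]
    constructor
    · intro h
      refine ⟨?_, fun n hn => h (n + 1) hn⟩
      split_ifs with h0
      · exact h 0 h0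
      · trivial
    · rintro ⟨h0, h⟩ (_ | n) hn
      · rw [if_pos hn] at h0; exact h0
      · exact h n hn
  rw [h1, Measure.prod_prod, iidLaw, Measure.infinitePi_pi _ (fun i _ => ht (i + 1))]
  have h2 : s.erase 0 = s'.map ⟨Nat.succ, Nat.succ_injective⟩ := by
    ext n
    simp only [Finset.mem_erase, Finset.mem_map, hs', Finset.mem_preimage,
      Function.Embedding.coeFn_mk]
    constructor
    · rintro ⟨h0, hn⟩
      obtain ⟨m, rfl⟩ := Nat.exists_eq_succ_of_ne_zero h0
      exact ⟨m, hn, rfl⟩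
    · rintro ⟨m, hm, rfl⟩
      exact ⟨Nat.succ_ne_zero m, hm⟩
  have h3 : ∏ i ∈ s', P (t (i + 1)) = ∏ i ∈ s.erase 0, P (t i) := by
    rw [h2, Finset.prod_map]; rfl
  rw [h3]
  split_ifs with h0
  · exact Finset.mul_prod_erase s (fun i => P (t i)) h0
  · rw [measure_univ, one_mul, Finset.erase_eq_of_notMem h0]

variable {P} {F : Ξ → E d → ℝ} {η γ b R : ℝ}

lemma measurable_gradient (hm : ∀ x, Measurable fun ξ => F ξ x) (hF : ∀ ξ, ContDiff ℝ 1 (F ξ)) :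
    Measurable fun p : E d × Ξ => gradient (F p.2) p.1 := by
  have h1 : ∀ x, Measurable fun ξ => gradient (F ξ) x := by
    intro x
    have := stronglyMeasurable_fderiv (g := F) (U := univ) (fun x _ => (hm x).stronglyMeasurable)
      isOpen_univ (mem_univ x) (fun ξ => (hF ξ).differentiable one_ne_zero x)
    exact ((InnerProductSpace.toDual ℝ (E d)).symm.continuous.comp_stronglyMeasurable
      this).measurable
  have h2 : ∀ ξ, Continuous fun x => gradient (F ξ) x := fun ξ =>
    (InnerProductSpace.toDual ℝ (E d)).symm.continuous.comp ((hF ξ).continuous_fderiv one_ne_zero)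
  exact measurable_uncurry_of_continuous_of_measurable (u := fun x ξ => gradient (F ξ) x) h2 h1

lemma iter_consSeq (x : E d) (ξ : Ξ) (ω : ℕ → Ξ) (n : ℕ) :
    iter F η x (consSeq (ξ, ω)) (n + 1) = iter F η (sgdStep F η ξ x) ω n := by
  induction n with
  | zero => rfl
  | succ n ih => rw [iter, ih]; rfl

variable (F η γ b R) in
/-- The random maps of SGD are uniform contractions of a ball which they map into its interior. -/
structure Contracting : Prop where
  measurable : Measurable fun p : E d × Ξ => gradient (F p.2) p.1
  eta_pos : 0 < η
  gamma_pos : 0 < γ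
  eta_gamma : η * γ ≤ 1 / 2
  lt_radius : b < γ * R
  gradient_zero_le : ∀ ξ, ‖gradient (F ξ) 0‖ ≤ b
  lip : ∀ ξ, ∀ x ∈ closedBall (0 : E d) R, ∀ y ∈ closedBall (0 : E d) R,
    ‖sgdStep F η ξ x - sgdStep F η ξ y‖ ≤ (1 - η * γ) * ‖x - y‖

namespace Contracting

variable (h : Contracting F η γ b R)
include h

lemma measurable_step : Measurable fun p : E d × Ξ => sgdStep F η p.2 p.1 :=
  measurable_fst.sub (h.measurable.const_smul η)

lemma measurable_iter (n : ℕ) : Measurable fun p : E d × (ℕ → Ξ) => iter F η p.1 p.2 n := by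
  induction n with
  | zero => exact measurable_fst
  | succ n ih =>
    exact h.measurable_step.comp
      (ih.prodMk ((measurable_pi_apply n).comp measurable_snd))

lemma isProbabilityMeasure_step {μ : Measure (E d)} [IsProbabilityMeasure μ] :
    IsProbabilityMeasure (stepMeasure P F η μ) :=
  Measure.isProbabilityMeasure_map h.measurable_step.aemeasurable

lemma law_zero (μ : Measure (E d)) [IsProbabilityMeasure μ] : law P F η μ 0 = μ := by
  have : (fun p : E d × (ℕ → Ξ) => iter F η p.1 p.2 0) = Prod.fst := rfl
  rw [law, this, Measure.map_fst_prod, measure_univ, one_smul]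

/-- Decomposition at the first step: `ξ₀` is absorbed into the initial law and the shifted noise is
again i.i.d. This turns the pathwise definition of `law` into iteration of `stepMeasure`. -/
lemma law_succ (μ : Measure (E d)) [IsProbabilityMeasure μ] (n : ℕ) :
    law P F η μ (n + 1) = law P F η (stepMeasure P F η μ) n := by
  have h1 : (stepMeasure P F η μ).prod (iidLaw P) =
      ((μ.prod P).prod (iidLaw P)).map
        (Prod.map (fun p => sgdStep F η p.2 p.1) id) := by
    rw [← Measure.map_prod_map _ _ h.measurable_step measurable_id, Measure.map_id]; rfl
  have h2 : μ.prod (iidLaw P) = ((μ.prod P).prod (iidLaw P)).map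
      (fun p => (p.1.1, consSeq (p.1.2, p.2))) := by
    conv_lhs => rw [← map_consSeq P]
    have h3 : μ.prod ((P.prod (iidLaw P)).map consSeq) =
        (μ.prod (P.prod (iidLaw P))).map (Prod.map id consSeq) := by
      rw [← Measure.map_prod_map _ _ measurable_id measurable_consSeq, Measure.map_id]
    rw [h3, ← Measure.prodAssoc_prod, Measure.map_map (measurable_id.prodMap measurable_consSeq)
      (MeasurableEquiv.measurable _)]
    rfl
  rw [law, law, h1, h2, Measure.map_map (h.measurable_iter _) (by
      exact (measurable_fst.comp measurable_fst).prodMk (measurable_consSeq.comp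
        ((measurable_snd.comp measurable_fst).prodMk measurable_snd))),
    Measure.map_map (h.measurable_iter _) (h.measurable_step.prodMap measurable_id)]
  congr 1
  funext p
  exact iter_consSeq _ _ _ _

lemma law_eq_iterate (μ : Measure (E d)) [IsProbabilityMeasure μ] (n : ℕ) :
    law P F η μ n = (stepMeasure P F η)^[n] μ := by
  induction n generalizing μ with
  | zero => exact h.law_zero μ
  | succ n ih =>
    have := h.isProbabilityMeasure_step (P := P) (μ := μ)
    rw [h.law_succ, ih]; rfl


/-- The image has norm at most `(1 - η * γ) * R + η * b`, which is below `R` because `b < γ * R`. -/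
lemma step_mem_ball (hR : 0 < R) (ξ : Ξ) {x : E d} (hx : x ∈ closedBall (0 : E d) R) :
    sgdStep F η ξ x ∈ ball (0 : E d) R := by
  have h1 := h.lip ξ x hx 0 (by simp [hR.le])
  have h2 : ‖sgdStep F η ξ (0 : E d)‖ ≤ η * b := by
    simp only [sgdStep, zero_sub, norm_neg, norm_smul, Real.norm_of_nonneg h.eta_pos.le]
    exact mul_le_mul_of_nonneg_left (h.gradient_zero_le ξ) h.eta_pos.le
  rw [mem_ball_zero_iff]
  rw [mem_closedBall_zero_iff] at hx
  rw [sub_zero] at h1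
  have h3 : ‖sgdStep F η ξ x‖ ≤
      ‖sgdStep F η ξ x - sgdStep F η ξ 0‖ + ‖sgdStep F η ξ (0 : E d)‖ := by
    simpa using norm_add_le (sgdStep F η ξ x - sgdStep F η ξ 0) (sgdStep F η ξ (0 : E d))
  have h4 : 0 ≤ 1 - η * γ := by have := h.eta_gamma; linarith
  have h5 : (1 - η * γ) * ‖x‖ ≤ (1 - η * γ) * R := mul_le_mul_of_nonneg_left hx h4
  have h6 : η * b < η * (γ * R) := mul_lt_mul_of_pos_left h.lt_radius h.eta_pos
  nlinarith

lemma iter_mem_closedBall (hR : 0 < R) {x : E d} (hx : x ∈ closedBall (0 : E d) R) (ω : ℕ → Ξ)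
    (n : ℕ) :
    iter F η x ω n ∈ closedBall (0 : E d) R := by
  induction n with
  | zero => exact hx
  | succ n ih => exact ball_subset_closedBall (h.step_mem_ball hR _ ih)

lemma iter_mem_ball (hR : 0 < R) {x : E d} (hx : x ∈ ball (0 : E d) R) (ω : ℕ → Ξ) (n : ℕ) :
    iter F η x ω n ∈ ball (0 : E d) R := by
  cases n with
  | zero => exact hx
  | succ n =>
    exact h.step_mem_ball hR _ (h.iter_mem_closedBall hR (ball_subset_closedBall hx) ω n)

lemma norm_iter_sub_iter_le (hR : 0 < R) {x y : E d} (hx : x ∈ closedBall (0 : E d) R)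
    (hy : y ∈ closedBall (0 : E d) R) (ω : ℕ → Ξ) (n : ℕ) :
    ‖iter F η x ω n - iter F η y ω n‖ ≤ (1 - η * γ) ^ n * ‖x - y‖ := by
  induction n with
  | zero => simp [iter]
  | succ n ih =>
    refine (h.lip (ω n) _ (h.iter_mem_closedBall hR hx ω n) _
      (h.iter_mem_closedBall hR hy ω n)).trans ?_
    rw [pow_succ', mul_assoc]
    exact mul_le_mul_of_nonneg_left ih (by have := h.eta_gamma; linarith)

omit h in
variable (F η) in
/-- The iterates composed in reverse order, started at the origin. -/
def backIter : ℕ → (ℕ → Ξ) → E d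
  | 0, _ => 0
  | n + 1, ω => sgdStep F η (ω 0) (backIter n fun k => ω (k + 1))

lemma backIter_mem (hR : 0 < R) (n : ℕ) (ω : ℕ → Ξ) :
    backIter F η n ω ∈ closedBall (0 : E d) R := by
  induction n generalizing ω with
  | zero => simp [backIter, hR.le]
  | succ n ih => exact ball_subset_closedBall (h.step_mem_ball hR _ (ih _))

lemma measurable_shift : Measurable fun (ω : ℕ → Ξ) (k : ℕ) => ω (k + 1) :=
  measurable_pi_iff.2 fun k => measurable_pi_apply (k + 1)

lemma measurable_backIter (n : ℕ) : Measurable (backIter F η n : (ℕ → Ξ) → E d) := by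
  induction n with
  | zero => exact measurable_const
  | succ n ih =>
    exact h.measurable_step.comp ((ih.comp h.measurable_shift).prodMk (measurable_pi_apply 0))

/-- In reverse order consecutive iterates differ only in the innermost point, and `n` contractions
act on that difference. Forward iterates would not converge along a sample. -/
lemma dist_backIter_le (hR : 0 < R) (n : ℕ) (ω : ℕ → Ξ) :
    dist (backIter F η n ω) (backIter F η (n + 1) ω) ≤ R * (1 - η * γ) ^ n := by
  induction n generalizing ω with
  | zero =>
    have := h.backIter_mem hR 1 ω
    rw [mem_closedBall, dist_comm] at this
    simpa [backIter] using this
  | succ n ih =>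
    rw [dist_eq_norm]
    refine (h.lip (ω 0) _ (h.backIter_mem hR _ _) _ (h.backIter_mem hR _ _)).trans ?_
    rw [← dist_eq_norm, pow_succ', mul_left_comm]
    exact mul_le_mul_of_nonneg_left (ih _) (by have := h.eta_gamma; linarith)

lemma ratio_lt_one : 1 - η * γ < 1 := by
  have := mul_pos h.eta_pos h.gamma_pos
  linarith

lemma ratio_pos : 0 < 1 - η * γ := by
  have := h.eta_gamma
  linarith

omit h in
variable (P F η) in
/-- The stationary law of SGD. -/
def statLaw : Measure (E d) := (iidLaw P).map fun ω => limUnder atTop fun n => backIter F η n ω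

lemma tendsto_backIter (hR : 0 < R) (ω : ℕ → Ξ) :
    Tendsto (fun n => backIter F η n ω) atTop (𝓝 (limUnder atTop fun n => backIter F η n ω)) :=
  (cauchySeq_of_le_geometric _ _ h.ratio_lt_one fun n => h.dist_backIter_le hR n ω).tendsto_limUnder

lemma limUnder_mem (hR : 0 < R) (ω : ℕ → Ξ) :
    (limUnder atTop fun n => backIter F η n ω) ∈ closedBall (0 : E d) R :=
  isClosed_closedBall.mem_of_tendsto (h.tendsto_backIter hR ω)
    (Eventually.of_forall fun n => h.backIter_mem hR n ω)

lemma measurable_limUnder (hR : 0 < R) :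
    Measurable fun ω : ℕ → Ξ => limUnder atTop fun n => backIter F η n ω :=
  measurable_of_tendsto_metrizable (h.measurable_backIter)
    (tendsto_pi_nhds.2 fun ω => h.tendsto_backIter hR ω)

/-- The limit `Z` satisfies $Z(\xi,\omega)=T_\xi(Z(\omega))$; with invariance of the product measure
under prepending, this is stationarity of its law. -/
lemma limUnder_consSeq (hR : 0 < R) (ξ : Ξ) (ω : ℕ → Ξ) :
    (limUnder atTop fun n => backIter F η n (consSeq (ξ, ω))) =
      sgdStep F η ξ (limUnder atTop fun n => backIter F η n ω) := by
  have h1 := (tendsto_add_atTop_iff_nat 1).2 (h.tendsto_backIter hR (consSeq (ξ, ω)))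
  refine tendsto_nhds_unique h1 ?_
  have h2 := h.tendsto_backIter hR ω
  rw [tendsto_iff_norm_sub_tendsto_zero] at h2 ⊢
  refine squeeze_zero (fun _ => norm_nonneg _) (fun n => ?_) h2
  refine (h.lip ξ _ (h.backIter_mem hR n ω) _ (h.limUnder_mem hR ω)).trans ?_
  exact mul_le_of_le_one_left (norm_nonneg _) h.ratio_lt_one.le

lemma isProbabilityMeasure_statLaw (hR : 0 < R) : IsProbabilityMeasure (statLaw P F η) :=
  Measure.isProbabilityMeasure_map (h.measurable_limUnder hR).aemeasurable

lemma stepMeasure_statLaw (hR : 0 < R) :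
    stepMeasure P F η (statLaw P F η) = statLaw P F η := by
  have h1 : (statLaw P F η).prod P = ((P.prod (iidLaw P)).map Prod.swap).map
      (Prod.map (fun ω => limUnder atTop fun n => backIter F η n ω) id) := by
    rw [Measure.prod_swap, ← Measure.map_prod_map _ _ (h.measurable_limUnder hR) measurable_id,
      Measure.map_id]; rfl
  rw [stepMeasure, h1, Measure.map_map ((h.measurable_limUnder hR).prodMap measurable_id)
    measurable_swap, Measure.map_map h.measurable_step
      (((h.measurable_limUnder hR).prodMap measurable_id).comp measurable_swap), statLaw]
  conv_rhs => rw [← map_consSeq P, Measure.map_map (h.measurable_limUnder hR) measurable_consSeq]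
  congr 1
  funext p
  exact (h.limUnder_consSeq hR p.1 p.2).symm

/-- The limit is known to lie only in the closed ball; by stationarity one more step moves it into
the open ball, where the smoothness hypotheses hold. -/
lemma statLaw_compl_ball (hR : 0 < R) : statLaw P F η (ball (0 : E d) R)ᶜ = 0 := by
  rw [← h.stepMeasure_statLaw hR, stepMeasure,
    Measure.map_apply h.measurable_step isOpen_ball.measurableSet.compl]
  have h1 : ∀ᵐ x ∂(statLaw P F η), x ∈ closedBall (0 : E d) R := by
    refine (ae_map_iff (h.measurable_limUnder hR).aemeasurable
      (isClosed_closedBall (x := (0 : E d)) (ε := R)).measurableSet).2 ?_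
    exact Eventually.of_forall fun ω => h.limUnder_mem hR ω
  have := h.isProbabilityMeasure_statLaw (P := P) hR
  have h2 : ∀ᵐ p ∂((statLaw P F η).prod P), p.1 ∈ closedBall (0 : E d) R :=
    Measure.quasiMeasurePreserving_fst.ae h1
  have h3 : ∀ᵐ p ∂((statLaw P F η).prod P), p ∉
      (fun p : E d × Ξ => sgdStep F η p.2 p.1) ⁻¹' (ball (0 : E d) R)ᶜ := by
    filter_upwards [h2] with p hp
    exact fun h4 => h4 (h.step_mem_ball hR p.2 hp)
  rw [ae_iff] at h3
  simp only [not_not] at h3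
  exact h3

lemma law_statLaw (hR : 0 < R) (n : ℕ) : law P F η (statLaw P F η) n = statLaw P F η := by
  have := h.isProbabilityMeasure_statLaw (P := P) hR
  rw [h.law_eq_iterate]
  exact Function.iterate_fixed (h.stepMeasure_statLaw hR) n

/-- Synchronous coupling: start from `μ₀` and from the stationary law independently and use the same
noise. The second copy stays stationary, and the initial distance is at most `2 * R`. -/
lemma W2_law_statLaw_le (hR : 0 < R) (μ₀ : Measure (E d)) [IsProbabilityMeasure μ₀]
    (hμ : μ₀ (closedBall 0 R)ᶜ = 0) (n : ℕ) :
    W2 (law P F η μ₀ n) (statLaw P F η) ≤ ENNReal.ofReal ((1 - η * γ) ^ n * (2 * R)) := by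
  have := h.isProbabilityMeasure_statLaw (P := P) hR
  set π := statLaw P F η
  set Q := (μ₀.prod π).prod (iidLaw P)
  have hm1 : Measurable fun p : (E d × E d) × (ℕ → Ξ) => iter F η p.1.1 p.2 n :=
    (h.measurable_iter n).comp ((measurable_fst.comp measurable_fst).prodMk measurable_snd)
  have hm2 : Measurable fun p : (E d × E d) × (ℕ → Ξ) => iter F η p.1.2 p.2 n :=
    (h.measurable_iter n).comp ((measurable_snd.comp measurable_fst).prodMk measurable_snd)
  have hm := hm1.prodMk hm2
  set κ := Q.map fun p => (iter F η p.1.1 p.2 n, iter F η p.1.2 p.2 n) with hκ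
  have h1 : κ.map Prod.fst = law P F η μ₀ n := by
    have e : μ₀.prod (iidLaw P) = Q.map (Prod.map Prod.fst id) := by
      rw [← Measure.map_prod_map _ _ measurable_fst measurable_id, Measure.map_fst_prod,
        Measure.map_id, measure_univ, one_smul]
    rw [hκ, Measure.map_map measurable_fst hm, law, e,
      Measure.map_map (h.measurable_iter n) (measurable_fst.prodMap measurable_id)]
    rfl
  have h2 : κ.map Prod.snd = π := by
    have e : π.prod (iidLaw P) = Q.map (Prod.map Prod.snd id) := by
      rw [← Measure.map_prod_map _ _ measurable_snd measurable_id, Measure.map_snd_prod,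
        Measure.map_id, measure_univ, one_smul]
    rw [show π = law P F η π n from (h.law_statLaw (P := P) hR n).symm, hκ,
      Measure.map_map measurable_snd hm, law, e,
      Measure.map_map (h.measurable_iter n) (measurable_snd.prodMap measurable_id)]
    rfl
  have hμ' : ∀ᵐ x ∂μ₀, x ∈ closedBall (0 : E d) R := by rwa [ae_iff]
  have hπ' : ∀ᵐ x ∂π, x ∈ closedBall (0 : E d) R := by
    rw [ae_iff]
    exact measure_mono_null (fun x hx hx' => hx (ball_subset_closedBall hx'))
      (h.statLaw_compl_ball (P := P) hR)
  have hQ : ∀ᵐ p ∂Q, p.1.1 ∈ closedBall (0 : E d) R ∧ p.1.2 ∈ closedBall (0 : E d) R := by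
    have e1 : ∀ᵐ q ∂(μ₀.prod π), q.1 ∈ closedBall (0 : E d) R ∧ q.2 ∈ closedBall (0 : E d) R :=
      (Measure.quasiMeasurePreserving_fst.ae hμ').and (Measure.quasiMeasurePreserving_snd.ae hπ')
    exact Measure.quasiMeasurePreserving_fst.ae e1
  have h3 : ∫⁻ p, edist p.1 p.2 ^ 2 ∂κ ≤ ENNReal.ofReal ((1 - η * γ) ^ n * (2 * R)) ^ 2 := by
    rw [hκ, lintegral_map (by fun_prop) hm]
    have e2 : ∀ᵐ p ∂Q, edist (iter F η p.1.1 p.2 n) (iter F η p.1.2 p.2 n) ^ 2 ≤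
        ENNReal.ofReal ((1 - η * γ) ^ n * (2 * R)) ^ 2 := by
      filter_upwards [hQ] with p hp
      gcongr
      rw [edist_dist, dist_eq_norm]
      apply ENNReal.ofReal_le_ofReal
      refine (h.norm_iter_sub_iter_le hR hp.1 hp.2 p.2 n).trans ?_
      have e3 := norm_sub_le p.1.1 p.1.2
      have e4 := mem_closedBall_zero_iff.1 hp.1
      have e5 := mem_closedBall_zero_iff.1 hp.2
      have := h.ratio_pos
      gcongr
      linarith
    refine (lintegral_mono_ae e2).trans ?_
    simp
  calc W2 (law P F η μ₀ n) π ≤ (∫⁻ p, edist p.1 p.2 ^ 2 ∂κ) ^ (1 / 2 : ℝ) := by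
        unfold W2
        gcongr
        exact iInf₂_le κ ⟨h1, h2⟩
    _ ≤ (ENNReal.ofReal ((1 - η * γ) ^ n * (2 * R)) ^ 2) ^ (1 / 2 : ℝ) := by gcongr
    _ = ENNReal.ofReal ((1 - η * γ) ^ n * (2 * R)) := by
        rw [← ENNReal.rpow_natCast, ← ENNReal.rpow_mul]; norm_num

lemma tendsto_W2 (hR : 0 < R) (μ₀ : Measure (E d)) [IsProbabilityMeasure μ₀]
    (hμ : μ₀ (closedBall 0 R)ᶜ = 0) :
    Tendsto (fun n => W2 (law P F η μ₀ n) (statLaw P F η)) atTop (𝓝 0) := by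
  refine tendsto_of_tendsto_of_tendsto_of_le_of_le tendsto_const_nhds ?_ (fun _ => zero_le)
    (fun n => h.W2_law_statLaw_le hR μ₀ hμ n)
  have h1 := (tendsto_pow_atTop_nhds_zero_of_lt_one h.ratio_pos.le h.ratio_lt_one).mul_const (2 * R)
  simpa using ENNReal.tendsto_ofReal h1

end Contracting

end Dynamics

/-! ### Taylor remainders that are local at the origin but valid on the whole ball. -/

section Taylor

set_option maxSynthPendingDepth 5

variable {X Y : Type*} [NormedAddCommGroup X] [NormedSpace ℝ X]
  [NormedAddCommGroup Y] [NormedSpace ℝ Y]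

/-- Near `0` the derivative is Lipschitz; at distance at least `r` from `0` boundedness suffices,
since `‖x‖ ^ 2 ≥ r ^ 2`. -/
lemma exists_quadratic_remainder_bound {q : X → Y} {R B : ℝ} (hq : ContDiffAt ℝ 2 q 0)
    (hB : ∀ x ∈ ball (0 : X) R, ‖q x‖ ≤ B) :
    ∃ C, 0 ≤ C ∧ ∀ x ∈ ball (0 : X) R, ‖q x - q 0 - fderiv ℝ q 0 x‖ ≤ C * ‖x‖ ^ 2 := by
  rcases le_or_gt R 0 with hR | hR
  · refine ⟨0, le_rfl, fun x hx => ?_⟩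
    rw [ball_eq_empty.2 hR] at hx
    exact absurd hx (notMem_empty x)
  have h1 : ContDiffAt ℝ 1 (fderiv ℝ q) 0 := hq.fderiv_right (by norm_num)
  obtain ⟨K, t, ht, hK⟩ := h1.exists_lipschitzOnWith
  have h2 : ∀ᶠ x in 𝓝 (0 : X), x ∈ t ∧ DifferentiableAt ℝ q x := by
    refine (eventually_mem_set.2 ht).and ?_
    filter_upwards [hq.eventually (by simp)] with x hx using hx.differentiableAt (by norm_num)
  obtain ⟨r, hr, h3⟩ := Metric.eventually_nhds_iff_ball.1 h2
  have hB0 : 0 ≤ B := (norm_nonneg _).trans (hB 0 (mem_ball_self hR))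
  set D := (2 * B + ‖fderiv ℝ q 0‖ * R) / r ^ 2
  have hD : 0 ≤ D := by positivity
  refine ⟨K + D, by positivity, fun x hx => ?_⟩
  have hx' : ‖x‖ < R := by simpa using hx
  rcases lt_or_ge ‖x‖ r with hxr | hxr
  · have h4 := (convex_segment (0 : X) x).norm_image_sub_le_of_norm_hasFDerivWithin_le'
      (f := q) (f' := fderiv ℝ q) (φ := fderiv ℝ q 0) (C := K * ‖x‖)
      (x := 0) (y := x) ?_ ?_ (left_mem_segment ℝ _ _) (right_mem_segment ℝ _ _)
    · rw [sub_zero] at h4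
      nlinarith [sq_nonneg ‖x‖]
    all_goals
      intro y hy
      have hy' : ‖y‖ ≤ ‖x‖ := by
        have := (convex_closedBall (0 : X) ‖x‖).segment_subset (by simp) (by simp) hy
        simpa using this
      have hyr : y ∈ ball (0 : X) r := by simpa using hy'.trans_lt hxr
    · exact (h3 y hyr).2.hasFDerivAt.hasFDerivWithinAt
    · have := hK.dist_le_mul y (h3 y hyr).1 0 (h3 0 (mem_ball_self hr)).1
      rw [dist_eq_norm, dist_zero_right] at this
      exact this.trans (by gcongr)
  · have h5 : ‖q x - q 0 - fderiv ℝ q 0 x‖ ≤ 2 * B + ‖fderiv ℝ q 0‖ * R := by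
      have e1 := norm_sub_le (q x - q 0) (fderiv ℝ q 0 x)
      have e2 := norm_sub_le (q x) (q 0)
      have e3 := hB x hx
      have e4 := hB 0 (mem_ball_self hR)
      have e5 : ‖fderiv ℝ q 0 x‖ ≤ ‖fderiv ℝ q 0‖ * R :=
        ((fderiv ℝ q 0).le_opNorm x).trans (by gcongr)
      linarith
    have h6 : 2 * B + ‖fderiv ℝ q 0‖ * R = D * r ^ 2 := by
      simp only [D]; field_simp
    calc _ ≤ D * r ^ 2 := h5.trans_eq h6
      _ ≤ D * ‖x‖ ^ 2 := by gcongr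
      _ ≤ (K + D) * ‖x‖ ^ 2 := by nlinarith [sq_nonneg ‖x‖, K.2, mul_nonneg K.2 (sq_nonneg ‖x‖)]

lemma abs_le_of_abs_deriv_le {e e' : ℝ → ℝ} {B : ℝ} (h0 : e 0 = 0)
    (he : ∀ t ∈ Icc (0 : ℝ) 1, HasDerivAt e (e' t) t) (hB : ∀ t ∈ Icc (0 : ℝ) 1, |e' t| ≤ B) :
    ∀ t ∈ Icc (0 : ℝ) 1, |e t| ≤ B := by
  intro t ht
  have h1 := (convex_Icc (0 : ℝ) 1).norm_image_sub_le_of_norm_hasDerivWithin_le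
    (fun s hs => (he s hs).hasDerivWithinAt) hB (left_mem_Icc.2 zero_le_one) ht
  rw [h0, sub_zero, sub_zero, Real.norm_eq_abs, Real.norm_of_nonneg ht.1] at h1
  have hB0 : 0 ≤ B := (abs_nonneg _).trans (hB t ht)
  exact h1.trans (mul_le_of_le_one_right hB0 ht.2)

lemma hasDerivAt_comp_ray {f : X → Y} {x : X} {t : ℝ} (hf : DifferentiableAt ℝ f (t • x)) :
    HasDerivAt (fun s : ℝ => f (s • x)) (fderiv ℝ f (t • x) x) t := by
  have h1 : HasDerivAt (fun s : ℝ => s • x) x t := by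
    simpa using (hasDerivAt_id t).smul_const x
  exact hf.hasFDerivAt.comp_hasDerivAt t h1

lemma hasDerivAt_clm_apply_const {A : ℝ → X →L[ℝ] Y} {A' : X →L[ℝ] Y} {t : ℝ}
    (hA : HasDerivAt A A' t) (x : X) : HasDerivAt (fun s => A s x) (A' x) t :=
  (hA.clm_apply (hasDerivAt_const t x)).congr_deriv (by simp)

set_option maxHeartbeats 1000000 in
/-- A function of class `C^4` whose jet of order two at `0` vanishes is its cubic Taylor polynomial
up to a quartic error. -/
lemma exists_quartic_remainder_bound {h : X → ℝ} {R B : ℝ} (hh : ContDiffAt ℝ 4 h 0)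
    (hB : ∀ x ∈ ball (0 : X) R, |h x| ≤ B) (h0 : h 0 = 0) (h1 : fderiv ℝ h 0 = 0)
    (h2 : ∀ x, fderiv ℝ (fderiv ℝ h) 0 x x = 0) :
    ∃ C, 0 ≤ C ∧ ∀ x ∈ ball (0 : X) R,
      |h x - fderiv ℝ (fderiv ℝ (fderiv ℝ h)) 0 x x x / 6| ≤ C * ‖x‖ ^ 4 := by
  rcases le_or_gt R 0 with hR | hR
  · refine ⟨0, le_rfl, fun x hx => ?_⟩
    rw [ball_eq_empty.2 hR] at hx
    exact absurd hx (notMem_empty x)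
  set D1 := fderiv ℝ h
  set D2 := fderiv ℝ D1
  set D3 := fderiv ℝ D2
  set D4 := fderiv ℝ D3
  have hD1 : ContDiffAt ℝ 3 D1 0 := hh.fderiv_right (by norm_num)
  have hD2 : ContDiffAt ℝ 2 D2 0 := hD1.fderiv_right (by norm_num)
  have hD3 : ContDiffAt ℝ 1 D3 0 := hD2.fderiv_right (by norm_num)
  have hD4 : ContDiffAt ℝ 0 D4 0 := hD3.fderiv_right (by norm_num)
  have ev : ∀ᶠ x in 𝓝 (0 : X), DifferentiableAt ℝ h x ∧ DifferentiableAt ℝ D1 x ∧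
      DifferentiableAt ℝ D2 x ∧ DifferentiableAt ℝ D3 x ∧ ‖D4 x‖ < ‖D4 0‖ + 1 := by
    filter_upwards [hh.eventually (by simp), hD1.eventually (by simp), hD2.eventually (by simp),
      hD3.eventually (by simp),
      hD4.continuousAt.norm.eventually_lt_const (lt_add_one ‖D4 0‖)] with x e0 e1 e2 e3 e4
    exact ⟨e0.differentiableAt (by norm_num), e1.differentiableAt (by norm_num),
      e2.differentiableAt (by norm_num), e3.differentiableAt (by norm_num), e4⟩
  obtain ⟨r, hr, hball⟩ := Metric.eventually_nhds_iff_ball.1 ev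
  have hB0 : 0 ≤ B := (abs_nonneg _).trans (hB 0 (mem_ball_self hR))
  set K := ‖D4 0‖ + 1
  set A := (B + ‖D3 0‖ * R ^ 3) / r ^ 4
  have hA : 0 ≤ A := by positivity
  refine ⟨K + A, by positivity, fun x hx => ?_⟩
  have hx' : ‖x‖ < R := by simpa using hx
  have hx4 : 0 ≤ ‖x‖ ^ 4 := by positivity
  have hop : ∀ (T : X →L[ℝ] X →L[ℝ] X →L[ℝ] ℝ), |T x x x| ≤ ‖T‖ * ‖x‖ ^ 3 := by
    intro T
    calc |T x x x| ≤ ‖T x x‖ * ‖x‖ := (T x x).le_opNorm x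
      _ ≤ ‖T x‖ * ‖x‖ * ‖x‖ := by gcongr; exact (T x).le_opNorm x
      _ ≤ ‖T‖ * ‖x‖ * ‖x‖ * ‖x‖ := by gcongr; exact T.le_opNorm x
      _ = ‖T‖ * ‖x‖ ^ 3 := by ring
  rcases lt_or_ge ‖x‖ r with hxr | hxr
  · have hmem : ∀ t ∈ Icc (0 : ℝ) 1, t • x ∈ ball (0 : X) r := by
      intro t ht
      rw [mem_ball_zero_iff, norm_smul, Real.norm_of_nonneg ht.1]
      exact (mul_le_of_le_one_left (norm_nonneg _) ht.2).trans_lt hxr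
    have d0 : ∀ t ∈ Icc (0 : ℝ) 1, HasDerivAt (fun s : ℝ => h (s • x)) (D1 (t • x) x) t :=
      fun t ht => hasDerivAt_comp_ray (hball _ (hmem t ht)).1
    have d1 : ∀ t ∈ Icc (0 : ℝ) 1, HasDerivAt (fun s : ℝ => D1 (s • x) x) (D2 (t • x) x x) t :=
      fun t ht => hasDerivAt_clm_apply_const (hasDerivAt_comp_ray (hball _ (hmem t ht)).2.1) x
    have d2 : ∀ t ∈ Icc (0 : ℝ) 1,
        HasDerivAt (fun s : ℝ => D2 (s • x) x x) (D3 (t • x) x x x) t := by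
      intro t ht
      have a1 : HasDerivAt (fun s : ℝ => D2 (s • x)) (D3 (t • x) x) t :=
        hasDerivAt_comp_ray (hball _ (hmem t ht)).2.2.1
      have a2 : HasDerivAt (fun s : ℝ => D2 (s • x) x) (D3 (t • x) x x) t :=
        hasDerivAt_clm_apply_const a1 x
      exact hasDerivAt_clm_apply_const a2 x
    have d3 : ∀ t ∈ Icc (0 : ℝ) 1,
        HasDerivAt (fun s : ℝ => D3 (s • x) x x x) (D4 (t • x) x x x x) t := by
      intro t ht
      have a1 : HasDerivAt (fun s : ℝ => D3 (s • x)) (D4 (t • x) x) t :=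
        hasDerivAt_comp_ray (hball _ (hmem t ht)).2.2.2.1
      have a2 : HasDerivAt (fun s : ℝ => D3 (s • x) x) (D4 (t • x) x x) t :=
        hasDerivAt_clm_apply_const a1 x
      have a3 : HasDerivAt (fun s : ℝ => D3 (s • x) x x) (D4 (t • x) x x x) t :=
        hasDerivAt_clm_apply_const a2 x
      exact hasDerivAt_clm_apply_const a3 x
    have b4 : ∀ t ∈ Icc (0 : ℝ) 1, |D4 (t • x) x x x x| ≤ K * ‖x‖ ^ 4 := by
      intro t ht
      refine (hop (D4 (t • x) x)).trans ?_
      calc ‖D4 (t • x) x‖ * ‖x‖ ^ 3 ≤ (K * ‖x‖) * ‖x‖ ^ 3 := by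
            gcongr
            refine ((D4 (t • x)).le_opNorm x).trans ?_
            gcongr
            exact (hball _ (hmem t ht)).2.2.2.2.le
        _ = K * ‖x‖ ^ 4 := by ring
    -- Integrate the bound on the fourth derivative along the ray, four times. Each time the
    -- matching multiple of the cubic term is subtracted, so that the remainder vanishes at `s = 0`.
    have e3 := abs_le_of_abs_deriv_le (e := fun s => D3 (s • x) x x x - D3 0 x x x)
      (by simp) (fun t ht => (d3 t ht).sub_const _) b4
    have e2 := abs_le_of_abs_deriv_le (e := fun s => D2 (s • x) x x - s * D3 0 x x x)
      (by simpa using h2 x)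
      (fun t ht => ((d2 t ht).sub ((hasDerivAt_id t).mul_const _)).congr_deriv (by simp)) e3
    have e1 := abs_le_of_abs_deriv_le (e := fun s => D1 (s • x) x - s ^ 2 / 2 * D3 0 x x x)
      (by simp [h1])
      (fun t ht => ((d1 t ht).sub ((((hasDerivAt_id t).pow 2).div_const 2).mul_const _)).congr_deriv
        (by simp)) e2
    have e0 := abs_le_of_abs_deriv_le (e := fun s => h (s • x) - s ^ 3 / 6 * D3 0 x x x)
      (by simp [h0])
      (fun t ht => ((d0 t ht).sub ((((hasDerivAt_id t).pow 3).div_const 6).mul_const _)).congr_deriv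
        (by simp; left; ring)) e1
    have := e0 1 (right_mem_Icc.2 zero_le_one)
    simp only [one_smul, one_pow] at this
    calc _ = |h x - 1 / 6 * D3 0 x x x| := by ring_nf
      _ ≤ K * ‖x‖ ^ 4 := this
      _ ≤ _ := by nlinarith
  · have h5 : |h x - D3 0 x x x / 6| ≤ B + ‖D3 0‖ * R ^ 3 := by
      have e1 := abs_sub (h x) (D3 0 x x x / 6)
      have e2 := hB x hx
      have e3 : |D3 0 x x x / 6| ≤ ‖D3 0‖ * R ^ 3 := by
        rw [abs_div, abs_of_pos (by norm_num : (0 : ℝ) < 6)]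
        have e4 := hop (D3 0)
        have e5 : ‖D3 0‖ * ‖x‖ ^ 3 ≤ ‖D3 0‖ * R ^ 3 := by gcongr
        have e6 : 0 ≤ ‖D3 0‖ * R ^ 3 := by positivity
        linarith
      linarith
    have h6 : B + ‖D3 0‖ * R ^ 3 = A * r ^ 4 := by
      simp only [A]; field_simp
    calc _ ≤ A * r ^ 4 := h5.trans_eq h6
      _ ≤ A * ‖x‖ ^ 4 := by gcongr
      _ ≤ (K + A) * ‖x‖ ^ 4 := by
        have : 0 ≤ K := by positivity
        nlinarith

end Taylor

/-! ### First and second moments of the iterates: bias of order `η`. -/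

section Moments

variable {d : ℕ} {Ξ : Type*} [MeasurableSpace Ξ]

/-- The properties of the random gradients on the ball of radius `R` which the moment estimates
use. -/
structure Model (P : Measure Ξ) (F : Ξ → E d → ℝ) (f : E d → ℝ) (γ R M : ℝ) : Prop where
  measurable : Measurable fun p : E d × Ξ => gradient (F p.2) p.1
  gamma_pos : 0 < γ
  radius_pos : 0 < R
  bound_nonneg : 0 ≤ M
  bound : ∀ ξ, ∀ x ∈ ball (0 : E d) R, ‖gradient (F ξ) x‖ ≤ M
  mean : ∀ x ∈ ball (0 : E d) R, gradient f x = ∫ ξ, gradient (F ξ) x ∂P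
  mono : ∀ x ∈ ball (0 : E d) R, ∀ y ∈ ball (0 : E d) R,
    γ * ‖x - y‖ ^ 2 ≤ inner ℝ (gradient f x - gradient f y) (x - y)
  gradient_zero : gradient f 0 = 0
  contDiffOn : ContDiffOn ℝ 6 (gradient f) (ball 0 R)
  contDiffOn_cross : ∀ v w : E d, ContDiffOn ℝ 2
    (fun x => ∫ ξ, inner ℝ (gradient (F ξ) x) v * inner ℝ (gradient (F ξ) x) w ∂P) (ball 0 R)
  symm : ∀ v w : E d, inner ℝ (fderiv ℝ (gradient f) 0 v) w = inner ℝ v (fderiv ℝ (gradient f) 0 w)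

variable {P : Measure Ξ} [IsProbabilityMeasure P] {F : Ξ → E d → ℝ} {f : E d → ℝ} {γ b R M η : ℝ}

lemma aestronglyMeasurable_of_continuousOn {Y : Type*} [NormedAddCommGroup Y] [NormedSpace ℝ Y]
    {ν : Measure (E d)} {q : E d → Y} (hν : ∀ᵐ x ∂ν, x ∈ ball (0 : E d) R)
    (hq : ContinuousOn q (ball 0 R)) : AEStronglyMeasurable q ν := by
  rw [← Measure.restrict_eq_self_of_ae_mem hν]
  exact hq.aestronglyMeasurable isOpen_ball.measurableSet

lemma integrable_of_continuousOn {Y : Type*} [NormedAddCommGroup Y] [NormedSpace ℝ Y]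
    {ν : Measure (E d)} [IsFiniteMeasure ν] {q : E d → Y} {B : ℝ}
    (hν : ∀ᵐ x ∂ν, x ∈ ball (0 : E d) R)
    (hq : ContinuousOn q (ball 0 R)) (hB : ∀ x ∈ ball (0 : E d) R, ‖q x‖ ≤ B) : Integrable q ν :=
  Integrable.of_bound (aestronglyMeasurable_of_continuousOn hν hq) B (hν.mono hB)

lemma exists_bound_of_continuous {X Y : Type*} [NormedAddCommGroup X] [NormedSpace ℝ X]
    [ProperSpace X] [NormedAddCommGroup Y] {k : X → Y} (hk : Continuous k) (R : ℝ) :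
    ∃ B, ∀ x ∈ ball (0 : X) R, ‖k x‖ ≤ B := by
  obtain ⟨B, hB⟩ := (isCompact_closedBall (0 : X) R).exists_bound_of_continuousOn hk.continuousOn
  exact ⟨B, fun x hx => hB x (ball_subset_closedBall hx)⟩

namespace Model

variable (h : Model P F f γ R M)
include h

lemma measurable_left (x : E d) : Measurable fun ξ => gradient (F ξ) x :=
  h.measurable.comp (measurable_const.prodMk measurable_id)

/-- Continuous functions of the random gradient are integrable. -/
lemma integrable_comp {Y : Type*} [NormedAddCommGroup Y] [NormedSpace ℝ Y] {k : E d → Y}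
    (hk : Continuous k) {x : E d} (hx : x ∈ ball (0 : E d) R) :
    Integrable (fun ξ => k (gradient (F ξ) x)) P := by
  obtain ⟨B, hB⟩ := (isCompact_closedBall (0 : E d) M).exists_bound_of_continuousOn hk.continuousOn
  refine Integrable.of_bound (hk.comp_aestronglyMeasurable
    (h.measurable_left x).aestronglyMeasurable) B (Eventually.of_forall fun ξ => hB _ ?_)
  simpa using h.bound ξ x hx

lemma integrable_gradient {x : E d} (hx : x ∈ ball (0 : E d) R) :
    Integrable (fun ξ => gradient (F ξ) x) P := h.integrable_comp continuous_id hx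

lemma integrable_step {x : E d} (hx : x ∈ ball (0 : E d) R) :
    Integrable (fun ξ => x - η • gradient (F ξ) x) P :=
  (integrable_const _).sub ((h.integrable_gradient hx).smul η)

lemma integral_step_eq {x : E d} (hx : x ∈ ball (0 : E d) R) :
    ∫ ξ, (x - η • gradient (F ξ) x) ∂P = x - η • gradient f x := by
  have h1 : Integrable (fun ξ => η • gradient (F ξ) x) P := (h.integrable_gradient hx).smul η
  rw [integral_sub (integrable_const _) h1, integral_smul, ← h.mean x hx]
  simp

lemma integral_clm {Y : Type*} [NormedAddCommGroup Y] [NormedSpace ℝ Y] [CompleteSpace Y]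
    (A : E d →L[ℝ] Y) {x : E d} (hx : x ∈ ball (0 : E d) R) :
    ∫ ξ, A (gradient (F ξ) x) ∂P = A (gradient f x) := by
  rw [h.mean x hx]
  exact A.integral_comp_comm (h.integrable_comp continuous_id hx)

lemma norm_gradient_le {x : E d} (hx : x ∈ ball (0 : E d) R) : ‖gradient f x‖ ≤ M := by
  rw [h.mean x hx]
  simpa using norm_integral_le_of_norm_le_const (μ := P)
    (Eventually.of_forall fun ξ => h.bound ξ x hx)

lemma zero_mem : (0 : E d) ∈ ball (0 : E d) R := mem_ball_self h.radius_pos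

lemma contDiffAt_zero : ContDiffAt ℝ 6 (gradient f) 0 :=
  h.contDiffOn.contDiffAt (isOpen_ball.mem_nhds h.zero_mem)

lemma inner_ge {x : E d} (hx : x ∈ ball (0 : E d) R) :
    γ * ‖x‖ ^ 2 ≤ inner ℝ (gradient f x) x := by
  simpa [h.gradient_zero] using h.mono x hx 0 h.zero_mem

/-- Integrals against the law of the next iterate. -/
lemma integral_step (hc : Contracting F η γ b R) {Y : Type*} [NormedAddCommGroup Y]
    [NormedSpace ℝ Y] {ν : Measure (E d)} [IsProbabilityMeasure ν]
    (hν : ∀ᵐ x ∂ν, x ∈ ball (0 : E d) R) {k : E d → Y} (hk : Continuous k) :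
    ∫ x, k x ∂(stepMeasure P F η ν) = ∫ x, ∫ ξ, k (x - η • gradient (F ξ) x) ∂P ∂ν := by
  obtain ⟨B, hB⟩ := exists_bound_of_continuous hk R
  rw [stepMeasure, integral_map hc.measurable_step.aemeasurable hk.aestronglyMeasurable,
    integral_prod]
  · rfl
  · refine Integrable.of_bound (hk.comp_aestronglyMeasurable
      hc.measurable_step.aestronglyMeasurable) B ?_
    filter_upwards [Measure.quasiMeasurePreserving_fst.ae hν] with p hp
    exact hB _ (hc.step_mem_ball h.radius_pos _ (ball_subset_closedBall hp))

lemma step_mem (hc : Contracting F η γ b R) {ν : Measure (E d)} [IsProbabilityMeasure ν]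
    (hν : ∀ᵐ x ∂ν, x ∈ ball (0 : E d) R) :
    ∀ᵐ x ∂(stepMeasure P F η ν), x ∈ ball (0 : E d) R := by
  refine (ae_map_iff hc.measurable_step.aemeasurable
    (isOpen_ball (x := (0 : E d)) (ε := R)).measurableSet).2 ?_
  filter_upwards [Measure.quasiMeasurePreserving_fst.ae hν] with p hp
  exact hc.step_mem_ball h.radius_pos _ (ball_subset_closedBall hp)

lemma hasFDerivAt_gradient_zero :
    HasFDerivAt (gradient f) (fderiv ℝ (gradient f) 0) 0 :=
  (h.contDiffAt_zero.differentiableAt (by norm_num)).hasFDerivAt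

lemma hessian_ge (v : E d) : γ * ‖v‖ ^ 2 ≤ inner ℝ (fderiv ℝ (gradient f) 0 v) v :=
  inner_fderiv_ge h.hasFDerivAt_gradient_zero.differentiableAt
    (by filter_upwards [isOpen_ball.mem_nhds h.zero_mem] with y hy
        using h.mono y hy 0 h.zero_mem) v

/-- The averaged linearized step contracts. -/
lemma norm_linearStep_le (hc : Contracting F η γ b R) (v : E d) :
    ‖v - η • fderiv ℝ (gradient f) 0 v‖ ≤ (1 - η * γ) * ‖v‖ := by
  have h1 : HasFDerivAt (fun x => x - η • gradient f x)
      (ContinuousLinearMap.id ℝ (E d) - η • fderiv ℝ (gradient f) 0) 0 :=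
    (hasFDerivAt_id 0).sub (h.hasFDerivAt_gradient_zero.const_smul η)
  have h2 : ‖ContinuousLinearMap.id ℝ (E d) - η • fderiv ℝ (gradient f) 0‖ ≤ 1 - η * γ := by
    -- The map `x ↦ x - η • gradient f x` is an average of contractions, so its derivative at `0`
    -- has norm at most their common constant.
    refine h1.le_of_lip' hc.ratio_pos.le ?_
    filter_upwards [isOpen_ball.mem_nhds h.zero_mem] with x hx
    have h3 : ∀ y ∈ ball (0 : E d) R, y - η • gradient f y = ∫ ξ, sgdStep F η ξ y ∂P := by
      intro y hy
      exact (h.integral_step_eq hy).symm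
    have hi : ∀ y ∈ ball (0 : E d) R, Integrable (fun ξ => sgdStep F η ξ y) P := fun y hy =>
      h.integrable_step hy
    rw [h3 x hx, h3 0 h.zero_mem, ← integral_sub (hi x hx) (hi 0 h.zero_mem)]
    simpa using norm_integral_le_of_norm_le_const (μ := P) (Eventually.of_forall fun ξ =>
      hc.lip ξ x (ball_subset_closedBall hx) 0 (ball_subset_closedBall h.zero_mem))
  simpa using ContinuousLinearMap.le_of_opNorm_le _ h2 v

lemma exists_gradient_remainder : ∃ C, 0 < C ∧ ∀ x ∈ ball (0 : E d) R,
    ‖gradient f x - fderiv ℝ (gradient f) 0 x‖ ≤ C * ‖x‖ ^ 2 := by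
  obtain ⟨C, hC, hx⟩ := exists_quadratic_remainder_bound
    (h.contDiffAt_zero.of_le (by norm_num)) (fun x hx => h.norm_gradient_le hx)
  -- Enlarged to be strictly positive, because later bounds divide by this constant.
  refine ⟨C + 1, by positivity, fun x hxR => ?_⟩
  have := hx x hxR
  rw [h.gradient_zero, sub_zero] at this
  nlinarith [sq_nonneg ‖x‖]

/-- Expand the square: the cross term averages to `-2 * η * inner ℝ x (gradient f x)`, which strong
monotonicity bounds, and the last term is at most `η ^ 2 * M ^ 2`. -/
lemma second_moment_step (hc : Contracting F η γ b R) {ν : Measure (E d)} [IsProbabilityMeasure ν]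
    (hν : ∀ᵐ x ∂ν, x ∈ ball (0 : E d) R) :
    ∫ x, ‖x‖ ^ 2 ∂(stepMeasure P F η ν) ≤ (1 - 2 * (η * γ)) * ∫ x, ‖x‖ ^ 2 ∂ν + η ^ 2 * M ^ 2 := by
  rw [h.integral_step hc hν (by fun_prop)]
  have hi : Integrable (fun x : E d => ‖x‖ ^ 2) ν := by
    obtain ⟨B, hB⟩ := exists_bound_of_continuous (k := fun x : E d => ‖x‖ ^ 2) (by fun_prop) R
    exact integrable_of_continuousOn hν (by fun_prop) hB
  have h1 : ∀ x ∈ ball (0 : E d) R, ∫ ξ, ‖x - η • gradient (F ξ) x‖ ^ 2 ∂P ≤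
      (1 - 2 * (η * γ)) * ‖x‖ ^ 2 + η ^ 2 * M ^ 2 := by
    intro x hx
    have e1 : ∀ ξ, ‖x - η • gradient (F ξ) x‖ ^ 2 ≤
        ‖x‖ ^ 2 - 2 * η * (innerSL ℝ x (gradient (F ξ) x)) + η ^ 2 * M ^ 2 := by
      intro ξ
      rw [norm_sub_sq_real, inner_smul_right, norm_smul, mul_pow, Real.norm_eq_abs, sq_abs]
      have e2 : ‖gradient (F ξ) x‖ ^ 2 ≤ M ^ 2 :=
        pow_le_pow_left₀ (norm_nonneg _) (h.bound ξ x hx) 2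
      have e3 := mul_le_mul_of_nonneg_left e2 (sq_nonneg η)
      simp only [innerSL_apply_apply]
      linarith
    have i1 : Integrable (fun ξ => innerSL ℝ x (gradient (F ξ) x)) P :=
      h.integrable_comp (innerSL ℝ x).continuous hx
    have i2 : Integrable (fun ξ => ‖x‖ ^ 2 - 2 * η * (innerSL ℝ x (gradient (F ξ) x))) P :=
      (integrable_const _).sub (i1.const_mul _)
    refine (integral_mono (h.integrable_comp (k := fun g => ‖x - η • g‖ ^ 2) (by fun_prop) hx)
      (i2.add (integrable_const _)) e1).trans ?_
    change ∫ ξ, (‖x‖ ^ 2 - 2 * η * (innerSL ℝ x (gradient (F ξ) x)) + η ^ 2 * M ^ 2) ∂P ≤ _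
    rw [integral_add i2 (integrable_const _),
      integral_sub (integrable_const _) (i1.const_mul _), integral_const_mul,
      h.integral_clm (innerSL ℝ x) hx]
    have e4 := h.inner_ge hx
    rw [real_inner_comm] at e4
    have e5 := mul_le_mul_of_nonneg_left e4 hc.eta_pos.le
    simp only [integral_const, probReal_univ, smul_eq_mul, one_mul, innerSL_apply_apply]
    linarith
  calc _ ≤ ∫ x, ((1 - 2 * (η * γ)) * ‖x‖ ^ 2 + η ^ 2 * M ^ 2) ∂ν := by
        refine integral_mono_of_nonneg (Eventually.of_forall fun x =>
          integral_nonneg fun ξ => by positivity) ((hi.const_mul _).add (integrable_const _)) ?_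
        filter_upwards [hν] with x hx using h1 x hx
    _ = _ := by
        rw [integral_add (hi.const_mul _) (integrable_const _), integral_const_mul]
        simp

omit h in
/-- A functional of the law which controls the bias of smooth observables. -/
def moment (κ : ℝ) (ν : Measure (E d)) : ℝ := ‖∫ x, x ∂ν‖ + κ * ∫ x, ‖x‖ ^ 2 ∂ν

/-- The mean contracts up to `η * C` times the second moment, while the second moment contracts at
twice the rate. The weight `κ = C / γ` satisfies `κ * (η * γ) = η * C`, so the spare contraction
absorbs exactly that error. -/
lemma moment_step_le {C : ℝ} (hC0 : 0 < C) (hC : ∀ x ∈ ball (0 : E d) R,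
    ‖gradient f x - fderiv ℝ (gradient f) 0 x‖ ≤ C * ‖x‖ ^ 2) (hc : Contracting F η γ b R)
    {ν : Measure (E d)} [IsProbabilityMeasure ν] (hν : ∀ᵐ x ∂ν, x ∈ ball (0 : E d) R) :
    moment (C / γ) (stepMeasure P F η ν) ≤
      (1 - η * γ) * moment (C / γ) ν + C / γ * M ^ 2 * η ^ 2 := by
  set H := fderiv ℝ (gradient f) 0
  have hi : Integrable (fun x : E d => ‖x‖ ^ 2) ν := by
    obtain ⟨B, hB⟩ := exists_bound_of_continuous (k := fun x : E d => ‖x‖ ^ 2) (by fun_prop) R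
    exact integrable_of_continuousOn hν (by fun_prop) hB
  have hx : Integrable (fun x : E d => x) ν := by
    obtain ⟨B, hB⟩ := exists_bound_of_continuous (k := fun x : E d => x) (by fun_prop) R
    exact integrable_of_continuousOn hν (by fun_prop) hB
  have hg : Integrable (gradient f) ν :=
    integrable_of_continuousOn hν h.contDiffOn.continuousOn fun x hx => h.norm_gradient_le hx
  have h1 : ∫ x, x ∂(stepMeasure P F η ν) = ∫ x, (x - η • gradient f x) ∂ν := by
    rw [h.integral_step hc hν (k := fun x => x) continuous_id]
    refine integral_congr_ae ?_
    filter_upwards [hν] with x hx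
    exact h.integral_step_eq hx
  have h2 : ∫ x, (x - η • gradient f x) ∂ν = (∫ x, x ∂ν - η • H (∫ x, x ∂ν)) -
      η • ∫ x, (gradient f x - H x) ∂ν := by
    have hg' : Integrable (fun x => η • gradient f x) ν := hg.smul η
    rw [integral_sub hx hg', integral_smul, integral_sub hg (H.integrable_comp hx),
      H.integral_comp_comm hx, smul_sub]
    abel
  have h3 : ‖∫ x, (gradient f x - H x) ∂ν‖ ≤ C * ∫ x, ‖x‖ ^ 2 ∂ν := by
    rw [← integral_const_mul]
    refine norm_integral_le_of_norm_le (hi.const_mul C) ?_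
    filter_upwards [hν] with x hx using hC x hx
  have h4 : ‖∫ x, x ∂(stepMeasure P F η ν)‖ ≤
      (1 - η * γ) * ‖∫ x, x ∂ν‖ + η * (C * ∫ x, ‖x‖ ^ 2 ∂ν) := by
    rw [h1, h2]
    refine (norm_sub_le _ _).trans ?_
    rw [norm_smul, Real.norm_of_nonneg hc.eta_pos.le]
    exact add_le_add (h.norm_linearStep_le hc _) (mul_le_mul_of_nonneg_left h3 hc.eta_pos.le)
  have h5 := h.second_moment_step hc hν
  have h6 := mul_le_mul_of_nonneg_left h5 (div_pos hC0 h.gamma_pos).le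
  have h7 : C / γ * (η * γ) = η * C := by
    have := h.gamma_pos
    field_simp
  simp only [moment]
  calc _ ≤ (1 - η * γ) * ‖∫ x, x ∂ν‖ + η * (C * ∫ x, ‖x‖ ^ 2 ∂ν) +
        C / γ * ((1 - 2 * (η * γ)) * ∫ x, ‖x‖ ^ 2 ∂ν + η ^ 2 * M ^ 2) := add_le_add h4 h6
    _ = (1 - η * γ) * ‖∫ x, x ∂ν‖ + (η * C) * (∫ x, ‖x‖ ^ 2 ∂ν) +
        C / γ * (∫ x, ‖x‖ ^ 2 ∂ν) - 2 * (C / γ * (η * γ)) * (∫ x, ‖x‖ ^ 2 ∂ν) +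
        C / γ * (η ^ 2 * M ^ 2) := by ring
    _ = _ := by rw [← h7]; ring
    _ ≤ _ := le_rfl

lemma moment_iterate_le {C : ℝ} (hC0 : 0 < C) (hC : ∀ x ∈ ball (0 : E d) R,
    ‖gradient f x - fderiv ℝ (gradient f) 0 x‖ ≤ C * ‖x‖ ^ 2) (hc : Contracting F η γ b R)
    {ν : Measure (E d)} [IsProbabilityMeasure ν] (hν : ∀ᵐ x ∂ν, x ∈ ball (0 : E d) R) (n : ℕ) :
    (IsProbabilityMeasure ((stepMeasure P F η)^[n] ν) ∧
      ∀ᵐ x ∂((stepMeasure P F η)^[n] ν), x ∈ ball (0 : E d) R) ∧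
    moment (C / γ) ((stepMeasure P F η)^[n] ν) ≤
      (1 - η * γ) ^ n * moment (C / γ) ν + C / γ * M ^ 2 * η / γ := by
  have hγ := h.gamma_pos
  induction n with
  | zero =>
    refine ⟨⟨‹_›, hν⟩, ?_⟩
    have : 0 ≤ C / γ * M ^ 2 * η / γ := by have := hc.eta_pos; positivity
    simpa using this
  | succ n ih =>
    obtain ⟨⟨ih1, ih2⟩, ih3⟩ := ih
    rw [Function.iterate_succ_apply']
    refine ⟨⟨hc.isProbabilityMeasure_step, h.step_mem hc ih2⟩, ?_⟩
    refine (h.moment_step_le hC0 hC hc ih2).trans ?_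
    have h1 := mul_le_mul_of_nonneg_left ih3 hc.ratio_pos.le
    refine (add_le_add_left h1 _).trans (le_of_eq ?_)
    -- The additive constant is the fixed point of the one-step recursion.
    have h2 : (1 - η * γ) * (C / γ * M ^ 2 * η / γ) + C / γ * M ^ 2 * η ^ 2 =
        C / γ * M ^ 2 * η / γ := by field_simp; ring
    rw [mul_add, add_assoc, h2, pow_succ']
    ring

/-- The linear part of `q` sees only the mean and the remainder only the second moment; both are
dominated by `moment`. -/
lemma abs_integral_sub_le {q : E d → ℝ} {D : E d →L[ℝ] ℝ} {K C B : ℝ} (hC : 0 < C)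
    (hK : ∀ x ∈ ball (0 : E d) R, ‖q x - q 0 - D x‖ ≤ K * ‖x‖ ^ 2) (hK0 : 0 ≤ K)
    (hq : ContinuousOn q (ball 0 R)) (hB : ∀ x ∈ ball (0 : E d) R, ‖q x‖ ≤ B)
    {ν : Measure (E d)} [IsProbabilityMeasure ν] (hν : ∀ᵐ x ∂ν, x ∈ ball (0 : E d) R) :
    |∫ x, q x ∂ν - q 0| ≤ (‖D‖ + K * γ / C) * moment (C / γ) ν := by
  have hγ := h.gamma_pos
  have hi : Integrable (fun x : E d => ‖x‖ ^ 2) ν := by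
    obtain ⟨B, hB⟩ := exists_bound_of_continuous (k := fun x : E d => ‖x‖ ^ 2) (by fun_prop) R
    exact integrable_of_continuousOn hν (by fun_prop) hB
  have hx : Integrable (fun x : E d => x) ν := by
    obtain ⟨B, hB⟩ := exists_bound_of_continuous (k := fun x : E d => x) (by fun_prop) R
    exact integrable_of_continuousOn hν (by fun_prop) hB
  have hqi : Integrable q ν := integrable_of_continuousOn hν hq hB
  have h1 : ∫ x, q x ∂ν - q 0 = D (∫ x, x ∂ν) + ∫ x, (q x - q 0 - D x) ∂ν := by
    have e1 : Integrable (fun x => q x - q 0) ν := hqi.sub (integrable_const _)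
    rw [integral_sub e1 (D.integrable_comp hx), D.integral_comp_comm hx,
      integral_sub hqi (integrable_const _)]
    simp
  have h3 : ‖∫ x, (q x - q 0 - D x) ∂ν‖ ≤ K * ∫ x, ‖x‖ ^ 2 ∂ν := by
    rw [← integral_const_mul]
    refine norm_integral_le_of_norm_le (hi.const_mul K) ?_
    filter_upwards [hν] with x hx using hK x hx
  have hm0 : 0 ≤ ∫ x, ‖x‖ ^ 2 ∂ν := integral_nonneg fun x => by positivity
  rw [h1]
  refine (abs_add_le _ _).trans ((add_le_add (D.le_opNorm _) h3).trans ?_)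
  simp only [moment]
  have e2 : (‖D‖ + K * γ / C) * (‖∫ x, x ∂ν‖ + C / γ * ∫ x, ‖x‖ ^ 2 ∂ν) =
      ‖D‖ * ‖∫ x, x ∂ν‖ + K * ∫ x, ‖x‖ ^ 2 ∂ν + (K * γ / C * ‖∫ x, x ∂ν‖ +
        ‖D‖ * (C / γ) * ∫ x, ‖x‖ ^ 2 ∂ν) := by field_simp; ring
  rw [e2]
  have : 0 ≤ K * γ / C * ‖∫ x, x ∂ν‖ + ‖D‖ * (C / γ) * ∫ x, ‖x‖ ^ 2 ∂ν := by positivity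
  linarith

/-- The bias of smooth observables after `n` steps. -/
theorem exists_bias_bound {q : E d → ℝ} {B : ℝ} (hq2 : ContDiffAt ℝ 2 q 0)
    (hq : ContinuousOn q (ball 0 R)) (hB : ∀ x ∈ ball (0 : E d) R, ‖q x‖ ≤ B) :
    ∃ C, 0 < C ∧ ∀ η b, Contracting F η γ b R → ∀ n : ℕ, ∀ x ∈ ball (0 : E d) R,
      |∫ y, q y ∂(law P F η (Measure.dirac x) n) - q 0| ≤ C * ((1 - η * γ) ^ n + η) := by
  obtain ⟨C, hC0, hC⟩ := h.exists_gradient_remainder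
  obtain ⟨K, hK0, hK⟩ := exists_quadratic_remainder_bound hq2 hB
  have hγ := h.gamma_pos
  have hR := h.radius_pos
  set A := R + C / γ * R ^ 2
  set A' := C / γ * M ^ 2 / γ
  set Q := ‖fderiv ℝ q 0‖ + K * γ / C
  have hA : 0 ≤ A := by positivity
  have hA' : 0 ≤ A' := by positivity
  have hQ : 0 ≤ Q := by positivity
  refine ⟨Q * (A + A') + 1, by positivity, fun η b hc n x hx => ?_⟩
  have hν : ∀ᵐ y ∂(Measure.dirac x), y ∈ ball (0 : E d) R := by
    exact (ae_dirac_iff (p := fun y => y ∈ ball (0 : E d) R) isOpen_ball.measurableSet).2 hx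
  obtain ⟨⟨h1, h2⟩, h3⟩ := h.moment_iterate_le hC0 hC hc hν n
  rw [hc.law_eq_iterate]
  refine (h.abs_integral_sub_le hC0 hK hK0 hq hB h2).trans ?_
  have hη := hc.eta_pos
  have hρ := hc.ratio_pos
  have hx' : ‖x‖ < R := by simpa using hx
  have h4 : moment (C / γ) (Measure.dirac x) ≤ A := by
    simp only [moment, integral_dirac]
    simp only [A]
    gcongr
  have h5 : moment (C / γ) ((stepMeasure P F η)^[n] (Measure.dirac x)) ≤
      (A + A') * ((1 - η * γ) ^ n + η) := by
    refine h3.trans ?_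
    have e1 : C / γ * M ^ 2 * η / γ = A' * η := by simp only [A']; ring
    rw [e1]
    have e2 : (1 - η * γ) ^ n * moment (C / γ) (Measure.dirac x) ≤ (1 - η * γ) ^ n * A := by gcongr
    have e3 : 0 ≤ A' * (1 - η * γ) ^ n + A * η := by positivity
    nlinarith
  have e4 : 0 ≤ (1 - η * γ) ^ n + η := by positivity
  calc _ ≤ Q * ((A + A') * ((1 - η * γ) ^ n + η)) := by gcongr
    _ ≤ _ := by nlinarith

lemma ae_mem_statLaw (hc : Contracting F η γ b R) :
    ∀ᵐ x ∂(Contracting.statLaw P F η), x ∈ ball (0 : E d) R := by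
  rw [ae_iff]
  exact hc.statLaw_compl_ball h.radius_pos

/-- The bias of smooth observables under the stationary law. -/
theorem exists_stationary_bias_bound {q : E d → ℝ} {B : ℝ} (hq2 : ContDiffAt ℝ 2 q 0)
    (hq : ContinuousOn q (ball 0 R)) (hB : ∀ x ∈ ball (0 : E d) R, ‖q x‖ ≤ B) :
    ∃ C, 0 ≤ C ∧ ∀ η b, Contracting F η γ b R →
      |∫ y, q y ∂(Contracting.statLaw P F η) - q 0| ≤ C * η := by
  obtain ⟨C, hC0, hC⟩ := h.exists_gradient_remainder
  obtain ⟨K, hK0, hK⟩ := exists_quadratic_remainder_bound hq2 hB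
  have hγ := h.gamma_pos
  refine ⟨(‖fderiv ℝ q 0‖ + K * γ / C) * (C / γ * M ^ 2 / γ), by positivity, fun η b hc => ?_⟩
  have := hc.isProbabilityMeasure_statLaw (P := P) h.radius_pos
  have hν := h.ae_mem_statLaw hc
  -- At the stationary law the one-step inequality bounds `η * γ` times the functional by its error
  -- term of order `η ^ 2`.
  have h1 := h.moment_step_le hC0 hC hc hν
  rw [hc.stepMeasure_statLaw h.radius_pos] at h1
  refine (h.abs_integral_sub_le hC0 hK hK0 hq hB hν).trans ?_
  rw [mul_assoc]
  gcongr
  have hη := hc.eta_pos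
  have h2 : η * γ * moment (C / γ) (Contracting.statLaw P F η) ≤
      η * γ * (C / γ * M ^ 2 / γ * η) := by
    have e : η * γ * (C / γ * M ^ 2 / γ * η) = C / γ * M ^ 2 * η ^ 2 := by field_simp
    rw [e]; linarith
  exact le_of_mul_le_mul_left h2 (by positivity)

end Model

end Moments

/-! ### Third and fourth moments of the stationary law, and its expansion to first order. -/

section StationaryExpansion

variable {d : ℕ} {Ξ : Type*} [MeasurableSpace Ξ]
  {P : Measure Ξ} [IsProbabilityMeasure P] {F : Ξ → E d → ℝ} {f : E d → ℝ} {γ b R M η : ℝ}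

namespace Model

variable (h : Model P F f γ R M)
include h

lemma integrable_of_continuous (hc : Contracting F η γ b R) {k : E d → ℝ} (hk : Continuous k) :
    Integrable k (Contracting.statLaw P F η) := by
  have := hc.isProbabilityMeasure_statLaw (P := P) h.radius_pos
  obtain ⟨B, hB⟩ := exists_bound_of_continuous hk R
  exact integrable_of_continuousOn (h.ae_mem_statLaw hc) hk.continuousOn hB

lemma integrable_integral_step (hc : Contracting F η γ b R) {k : E d → ℝ} (hk : Continuous k) :
    Integrable (fun x => ∫ ξ, k (x - η • gradient (F ξ) x) ∂P) (Contracting.statLaw P F η) := by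
  have := hc.isProbabilityMeasure_statLaw (P := P) h.radius_pos
  obtain ⟨B, hB⟩ := exists_bound_of_continuous hk R
  refine Integrable.integral_prod_left (f := fun p : E d × Ξ => k (p.1 - η • gradient (F p.2) p.1))
    (ν := P) (Integrable.of_bound (hk.comp_aestronglyMeasurable
      hc.measurable_step.aestronglyMeasurable) B ?_)
  filter_upwards [Measure.quasiMeasurePreserving_fst.ae (h.ae_mem_statLaw hc)] with p hp
  exact hB _ (hc.step_mem_ball h.radius_pos _ (ball_subset_closedBall hp))

lemma integral_step_statLaw (hc : Contracting F η γ b R) {k : E d → ℝ} (hk : Continuous k) :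
    ∫ x, ∫ ξ, k (x - η • gradient (F ξ) x) ∂P ∂(Contracting.statLaw P F η) =
      ∫ x, k x ∂(Contracting.statLaw P F η) := by
  have := hc.isProbabilityMeasure_statLaw (P := P) h.radius_pos
  rw [← h.integral_step hc (h.ae_mem_statLaw hc) hk, hc.stepMeasure_statLaw h.radius_pos]

lemma second_moment_le (hc : Contracting F η γ b R) :
    ∫ x, ‖x‖ ^ 2 ∂(Contracting.statLaw P F η) ≤ M ^ 2 / (2 * γ) * η := by
  have := hc.isProbabilityMeasure_statLaw (P := P) h.radius_pos
  have h1 := h.second_moment_step hc (h.ae_mem_statLaw hc)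
  rw [hc.stepMeasure_statLaw h.radius_pos] at h1
  have hγ := h.gamma_pos
  have hη := hc.eta_pos
  have h2 : 2 * (η * γ) * ∫ x, ‖x‖ ^ 2 ∂(Contracting.statLaw P F η) ≤
      2 * (η * γ) * (M ^ 2 / (2 * γ) * η) := by
    have e : 2 * (η * γ) * (M ^ 2 / (2 * γ) * η) = η ^ 2 * M ^ 2 := by field_simp
    rw [e]; linarith
  exact le_of_mul_le_mul_left h2 (by positivity)

omit h in
lemma norm_sub_pow_four_le {x g : E d} (hg : ‖g‖ ≤ M) (hη : 0 ≤ η) :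
    ‖x - η • g‖ ^ 4 ≤ ‖x‖ ^ 4 - 4 * η * ‖x‖ ^ 2 * inner ℝ x g +
      (6 * η ^ 2 * M ^ 2 * ‖x‖ ^ 2 + 4 * η ^ 3 * M ^ 3 * ‖x‖ + η ^ 4 * M ^ 4) := by
  have e1 : ‖x - η • g‖ ^ 4 = (‖x‖ ^ 2 - 2 * η * inner ℝ x g + η ^ 2 * ‖g‖ ^ 2) ^ 2 := by
    have : ‖x - η • g‖ ^ 2 = ‖x‖ ^ 2 - 2 * η * inner ℝ x g + η ^ 2 * ‖g‖ ^ 2 := by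
      rw [norm_sub_sq_real, inner_smul_right, norm_smul, mul_pow, Real.norm_eq_abs, sq_abs]; ring
    rw [← this]; ring
  rw [e1]
  have hs := abs_real_inner_le_norm x g
  set s : ℝ := inner ℝ x g
  have hx0 := norm_nonneg x
  have hg0 := norm_nonneg g
  have hs2 : s ^ 2 ≤ (‖x‖ * M) ^ 2 := by
    rw [← sq_abs]
    exact pow_le_pow_left₀ (abs_nonneg s) (hs.trans (by gcongr)) 2
  have hg2 : ‖g‖ ^ 2 ≤ M ^ 2 := pow_le_pow_left₀ hg0 hg 2
  have hg4 : ‖g‖ ^ 4 ≤ M ^ 4 := pow_le_pow_left₀ hg0 hg 4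
  have hsg : -(s * ‖g‖ ^ 2) ≤ ‖x‖ * M ^ 3 := by
    calc -(s * ‖g‖ ^ 2) = (-s) * ‖g‖ ^ 2 := by ring
      _ ≤ (‖x‖ * ‖g‖) * ‖g‖ ^ 2 := by
          gcongr
          exact (neg_le_abs s).trans hs
      _ = ‖x‖ * ‖g‖ ^ 3 := by ring
      _ ≤ ‖x‖ * M ^ 3 := by gcongr
  have t1 := mul_le_mul_of_nonneg_left hs2 (by positivity : 0 ≤ 4 * η ^ 2)
  have t2 := mul_le_mul_of_nonneg_left hg2 (by positivity : 0 ≤ 2 * η ^ 2 * ‖x‖ ^ 2)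
  have t3 := mul_le_mul_of_nonneg_left hsg (by positivity : 0 ≤ 4 * η ^ 3)
  have t4 := mul_le_mul_of_nonneg_left hg4 (by positivity : 0 ≤ η ^ 4)
  nlinarith

/-- Stationarity of the mean of `‖x‖ ^ 4` leaves `4 * (η * γ)` times it bounded by `6 * η ^ 2 * M ^
2` times the second moment plus terms of third and fourth order. The second moment is of order `η`,
so the right side is of order `η ^ 3`. -/
lemma exists_fourth_moment_le :
    ∃ C, 0 ≤ C ∧ ∀ η b, Contracting F η γ b R →
      ∫ x, ‖x‖ ^ 4 ∂(Contracting.statLaw P F η) ≤ C * η ^ 2 := by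
  have hγ := h.gamma_pos
  have hM := h.bound_nonneg
  have hR := h.radius_pos
  set A := 6 * M ^ 2 * (M ^ 2 / (2 * γ)) + 4 * M ^ 3 * R + M ^ 4 / (2 * γ)
  refine ⟨A / (4 * γ), by positivity, fun η b hc => ?_⟩
  have hη := hc.eta_pos
  have := hc.isProbabilityMeasure_statLaw (P := P) h.radius_pos
  set π := Contracting.statLaw P F η
  have i4 : Integrable (fun x : E d => ‖x‖ ^ 4) π := h.integrable_of_continuous hc (by fun_prop)
  have i2 : Integrable (fun x : E d => ‖x‖ ^ 2) π := h.integrable_of_continuous hc (by fun_prop)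
  have hst := h.integral_step_statLaw hc (k := fun x => ‖x‖ ^ 4) (by fun_prop)
  have h1 : ∀ x ∈ ball (0 : E d) R, ∫ ξ, ‖x - η • gradient (F ξ) x‖ ^ 4 ∂P ≤
      (1 - 4 * (η * γ)) * ‖x‖ ^ 4 + 6 * η ^ 2 * M ^ 2 * ‖x‖ ^ 2 +
        (4 * η ^ 3 * M ^ 3 * R + η ^ 4 * M ^ 4) := by
    intro x hx
    have hx' : ‖x‖ ≤ R := by simpa using (mem_ball_zero_iff.1 hx).le
    have i1 : Integrable (fun ξ => innerSL ℝ x (gradient (F ξ) x)) P :=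
      h.integrable_comp (innerSL ℝ x).continuous hx
    have i3 : Integrable (fun ξ => ‖x‖ ^ 4 -
        4 * η * ‖x‖ ^ 2 * (innerSL ℝ x (gradient (F ξ) x))) P :=
      (integrable_const _).sub (i1.const_mul _)
    have e1 := integral_mono (h.integrable_comp (k := fun g => ‖x - η • g‖ ^ 4) (by fun_prop) hx)
      (i3.add (integrable_const (6 * η ^ 2 * M ^ 2 * ‖x‖ ^ 2 + 4 * η ^ 3 * M ^ 3 * ‖x‖ +
        η ^ 4 * M ^ 4))) (fun ξ => norm_sub_pow_four_le (h.bound ξ x hx) hη.le)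
    refine e1.trans ?_
    change ∫ ξ, (‖x‖ ^ 4 - 4 * η * ‖x‖ ^ 2 * (innerSL ℝ x (gradient (F ξ) x)) +
      (6 * η ^ 2 * M ^ 2 * ‖x‖ ^ 2 + 4 * η ^ 3 * M ^ 3 * ‖x‖ + η ^ 4 * M ^ 4)) ∂P ≤ _
    rw [integral_add i3 (integrable_const _), integral_sub (integrable_const _) (i1.const_mul _),
      integral_const_mul, h.integral_clm (innerSL ℝ x) hx]
    simp only [integral_const, probReal_univ, smul_eq_mul, one_mul, innerSL_apply_apply]
    have e2 := h.inner_ge hx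
    rw [real_inner_comm] at e2
    have e3 := mul_le_mul_of_nonneg_left e2 (by positivity : 0 ≤ 4 * η * ‖x‖ ^ 2)
    have e4 := mul_le_mul_of_nonneg_left hx' (by positivity : 0 ≤ 4 * η ^ 3 * M ^ 3)
    nlinarith
  have h2 : ∫ x, ‖x‖ ^ 4 ∂π ≤ (1 - 4 * (η * γ)) * ∫ x, ‖x‖ ^ 4 ∂π +
      6 * η ^ 2 * M ^ 2 * ∫ x, ‖x‖ ^ 2 ∂π + (4 * η ^ 3 * M ^ 3 * R + η ^ 4 * M ^ 4) := by
    have i5 : Integrable (fun x : E d => (1 - 4 * (η * γ)) * ‖x‖ ^ 4 +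
        6 * η ^ 2 * M ^ 2 * ‖x‖ ^ 2) π := (i4.const_mul _).add (i2.const_mul _)
    conv_lhs => rw [← hst]
    calc _ ≤ ∫ x, ((1 - 4 * (η * γ)) * ‖x‖ ^ 4 + 6 * η ^ 2 * M ^ 2 * ‖x‖ ^ 2 +
        (4 * η ^ 3 * M ^ 3 * R + η ^ 4 * M ^ 4)) ∂π := by
          refine integral_mono_of_nonneg (Eventually.of_forall fun x =>
            integral_nonneg fun ξ => by positivity) (i5.add (integrable_const _)) ?_
          filter_upwards [h.ae_mem_statLaw hc] with x hx using h1 x hx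
      _ = _ := by
        rw [integral_add i5 (integrable_const _), integral_add (i4.const_mul _) (i2.const_mul _),
          integral_const_mul, integral_const_mul]
        simp
  have h3 := h.second_moment_le hc
  have h4 := mul_le_mul_of_nonneg_left h3 (by positivity : 0 ≤ 6 * η ^ 2 * M ^ 2)
  have h5 : η ≤ 1 / (2 * γ) := by
    rw [le_div_iff₀ (by positivity)]
    have := hc.eta_gamma
    linarith
  have h6 := mul_le_mul_of_nonneg_left h5 (by positivity : 0 ≤ η ^ 3 * M ^ 4)
  have h7 : 4 * (η * γ) * ∫ x, ‖x‖ ^ 4 ∂π ≤ 4 * (η * γ) * (A / (4 * γ) * η ^ 2) := by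
    have e : 4 * (η * γ) * (A / (4 * γ) * η ^ 2) = 6 * η ^ 2 * M ^ 2 * (M ^ 2 / (2 * γ) * η) +
        (4 * η ^ 3 * M ^ 3 * R + η ^ 3 * M ^ 4 * (1 / (2 * γ))) := by
      simp only [A]; field_simp; ring
    rw [e]
    nlinarith
  exact le_of_mul_le_mul_left h7 (by positivity)

lemma continuousOn_cross (v w : E d) : ContinuousOn
    (fun x => ∫ ξ, inner ℝ (gradient (F ξ) x) v * inner ℝ (gradient (F ξ) x) w ∂P) (ball 0 R) :=
  (h.contDiffOn_cross v w).continuousOn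

lemma abs_cross_le (v w : E d) {x : E d} (hx : x ∈ ball (0 : E d) R) :
    ‖∫ ξ, inner ℝ (gradient (F ξ) x) v * inner ℝ (gradient (F ξ) x) w ∂P‖ ≤
      (M * ‖v‖) * (M * ‖w‖) := by
  have := norm_integral_le_of_norm_le_const (μ := P) (C := (M * ‖v‖) * (M * ‖w‖))
    (f := fun ξ => inner ℝ (gradient (F ξ) x) v * inner ℝ (gradient (F ξ) x) w)
    (Eventually.of_forall fun ξ => by
      rw [norm_mul]
      have hb := h.bound ξ x hx
      have hM := h.bound_nonneg
      gcongr
      · exact (norm_inner_le_norm _ _).trans (by gcongr)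
      · exact (norm_inner_le_norm _ _).trans (by gcongr))
  simpa using this

/-- Weighted second moments of the random gradients, with a weight vanishing at the origin. -/
lemma exists_cross_weight_le (v w u : E d) :
    ∃ C, 0 ≤ C ∧ ∀ η b, Contracting F η γ b R →
      |∫ x, (∫ ξ, inner ℝ (gradient (F ξ) x) v * inner ℝ (gradient (F ξ) x) w ∂P) * inner ℝ x u
        ∂(Contracting.statLaw P F η)| ≤ C * η := by
  have hc1 : ContDiffOn ℝ 2 (fun x : E d => inner ℝ x u) (ball (0 : E d) R) :=
    (contDiff_id.inner ℝ contDiff_const).contDiffOn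
  have hc2 := (h.contDiffOn_cross v w).mul hc1
  obtain ⟨C, hC0, hC⟩ := h.exists_stationary_bias_bound
    (B := (M * ‖v‖) * (M * ‖w‖) * (R * ‖u‖))
    (hc2.contDiffAt (isOpen_ball.mem_nhds h.zero_mem)) hc2.continuousOn (fun x hx => by
      rw [norm_mul]
      have hM := h.bound_nonneg
      have hx' := (mem_ball_zero_iff.1 hx).le
      gcongr
      · exact h.abs_cross_le v w hx
      · exact (norm_inner_le_norm _ _).trans (by gcongr))
  refine ⟨C, hC0, fun η b hc => ?_⟩
  simpa using hC η b hc

/-- A product of three eigencoordinates of the Hessian at `0` is an eigenfunction of the linearized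
drift, with eigenvalue `l₁ + l₂ + l₃ ≥ γ`. In the stationarity identity this drift term has weight
`η`. The nonlinear drift is bounded by fourth moments; the noise term of weight `η ^ 2` is the mean
of smooth functions vanishing at `0`, hence of order `η`; the last term has weight `η ^ 3`. Dividing
by `η` leaves `η ^ 2`. -/
lemma exists_cubic_eigen_le {e₁ e₂ e₃ : E d} {l₁ l₂ l₃ : ℝ} (n₁ : ‖e₁‖ = 1) (n₂ : ‖e₂‖ = 1)
    (n₃ : ‖e₃‖ = 1) (h₁ : fderiv ℝ (gradient f) 0 e₁ = l₁ • e₁)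
    (h₂ : fderiv ℝ (gradient f) 0 e₂ = l₂ • e₂) (h₃ : fderiv ℝ (gradient f) 0 e₃ = l₃ • e₃) :
    ∃ C, 0 ≤ C ∧ ∀ η b, Contracting F η γ b R →
      |∫ x, inner ℝ x e₁ * inner ℝ x e₂ * inner ℝ x e₃ ∂(Contracting.statLaw P F η)|
        ≤ C * η ^ 2 := by
  have hγ := h.gamma_pos
  have hM := h.bound_nonneg
  obtain ⟨C0, hC0, hC⟩ := h.exists_gradient_remainder
  obtain ⟨C4, hC4, h4⟩ := h.exists_fourth_moment_le
  obtain ⟨A, hA0, hA⟩ := h.exists_cross_weight_le e₁ e₂ e₃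
  obtain ⟨B, hB0, hB⟩ := h.exists_cross_weight_le e₁ e₃ e₂
  obtain ⟨D, hD0, hD⟩ := h.exists_cross_weight_le e₂ e₃ e₁
  have lge : ∀ {e : E d} {l : ℝ}, ‖e‖ = 1 → fderiv ℝ (gradient f) 0 e = l • e → γ ≤ l := by
    intro e l he hl
    have := h.hessian_ge e
    rw [hl, inner_smul_left, real_inner_self_eq_norm_sq, he] at this
    simpa using this
  have hl : γ ≤ l₁ + l₂ + l₃ := by
    have := lge n₁ h₁
    have := lge n₂ h₂
    have := lge n₃ h₃
    linarith
  refine ⟨(3 * C0 * C4 + (A + B + D) + M ^ 3) / γ, by positivity, fun η b hc => ?_⟩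
  have hη := hc.eta_pos
  have := hc.isProbabilityMeasure_statLaw (P := P) h.radius_pos
  have hν := h.ae_mem_statLaw hc
  set π := Contracting.statLaw P F η
  set k : E d → ℝ := fun x => inner ℝ x e₁ * inner ℝ x e₂ * inner ℝ x e₃ with hk
  have hkc : Continuous k := by fun_prop
  -- The gradient of `k`.
  set u : E d → E d := fun x => (inner ℝ x e₂ * inner ℝ x e₃) • e₁ +
    (inner ℝ x e₁ * inner ℝ x e₃) • e₂ + (inner ℝ x e₁ * inner ℝ x e₂) • e₃ with hu
  have huc : Continuous u := by fun_prop
  set q : E d → E d → E d → ℝ := fun v w x =>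
    ∫ ξ, inner ℝ (gradient (F ξ) x) v * inner ℝ (gradient (F ξ) x) w ∂P with hq
  have iq : ∀ v w z : E d, Integrable (fun x => q v w x * inner ℝ x z) π := by
    intro v w z
    refine integrable_of_continuousOn (B := (M * ‖v‖) * (M * ‖w‖) * (R * ‖z‖)) hν
      ((h.continuousOn_cross v w).mul (by fun_prop)) fun x hx => ?_
    rw [norm_mul]
    have hx' := (mem_ball_zero_iff.1 hx).le
    gcongr
    · exact h.abs_cross_le v w hx
    · exact (norm_inner_le_norm _ _).trans (by gcongr)
  have iug : Integrable (fun x => inner ℝ (u x) (gradient f x)) π := by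
    obtain ⟨B', hB'⟩ := exists_bound_of_continuous huc R
    refine integrable_of_continuousOn (B := B' * M) hν
      (huc.continuousOn.inner h.contDiffOn.continuousOn) fun x hx => ?_
    refine (norm_inner_le_norm _ _).trans ?_
    have := (norm_nonneg _).trans (hB' x hx)
    exact mul_le_mul (hB' x hx) (h.norm_gradient_le hx) (norm_nonneg _) this
  -- one-step expansion
  have hstep : ∀ x ∈ ball (0 : E d) R,
      ‖(∫ ξ, k (x - η • gradient (F ξ) x) ∂P) - k x + η * inner ℝ (u x) (gradient f x) -
        η ^ 2 * (q e₁ e₂ x * inner ℝ x e₃ + q e₁ e₃ x * inner ℝ x e₂ + q e₂ e₃ x * inner ℝ x e₁)‖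
        ≤ η ^ 3 * M ^ 3 := by
    intro x hx
    have c1 : Integrable (fun ξ => innerSL ℝ (u x) (gradient (F ξ) x)) P :=
      h.integrable_comp (innerSL ℝ (u x)).continuous hx
    have c2 : ∀ v w : E d, Integrable (fun ξ =>
        inner ℝ (gradient (F ξ) x) v * inner ℝ (gradient (F ξ) x) w) P := fun v w =>
      h.integrable_comp (k := fun g => inner ℝ g v * inner ℝ g w) (by fun_prop) hx
    have c3 : Integrable (fun ξ => inner ℝ (gradient (F ξ) x) e₁ * inner ℝ (gradient (F ξ) x) e₂ *
        inner ℝ (gradient (F ξ) x) e₃) P :=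
      h.integrable_comp (k := fun g => inner ℝ g e₁ * inner ℝ g e₂ * inner ℝ g e₃) (by fun_prop) hx
    have e1 : ∀ ξ, k (x - η • gradient (F ξ) x) = k x - η * innerSL ℝ (u x) (gradient (F ξ) x) +
        (η ^ 2 * inner ℝ x e₃ * (inner ℝ (gradient (F ξ) x) e₁ * inner ℝ (gradient (F ξ) x) e₂) +
          η ^ 2 * inner ℝ x e₂ * (inner ℝ (gradient (F ξ) x) e₁ * inner ℝ (gradient (F ξ) x) e₃) +
          η ^ 2 * inner ℝ x e₁ * (inner ℝ (gradient (F ξ) x) e₂ * inner ℝ (gradient (F ξ) x) e₃)) -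
        η ^ 3 * (inner ℝ (gradient (F ξ) x) e₁ * inner ℝ (gradient (F ξ) x) e₂ *
          inner ℝ (gradient (F ξ) x) e₃) := by
      intro ξ
      simp only [hk, hu, innerSL_apply_apply, inner_sub_left, inner_smul_left,
        real_inner_comm (gradient (F ξ) x)]
      simp
      ring
    have e2 : ∫ ξ, k (x - η • gradient (F ξ) x) ∂P = k x - η * inner ℝ (u x) (gradient f x) +
        (η ^ 2 * inner ℝ x e₃ * q e₁ e₂ x + η ^ 2 * inner ℝ x e₂ * q e₁ e₃ x +
          η ^ 2 * inner ℝ x e₁ * q e₂ e₃ x) -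
        η ^ 3 * ∫ ξ, (inner ℝ (gradient (F ξ) x) e₁ * inner ℝ (gradient (F ξ) x) e₂ *
          inner ℝ (gradient (F ξ) x) e₃) ∂P := by
      simp_rw [e1]
      have j1 : Integrable (fun ξ => k x - η * innerSL ℝ (u x) (gradient (F ξ) x)) P :=
        (integrable_const _).sub (c1.const_mul _)
      have j2 := (c2 e₁ e₂).const_mul (η ^ 2 * inner ℝ x e₃)
      have j3 := (c2 e₁ e₃).const_mul (η ^ 2 * inner ℝ x e₂)
      have j4 := (c2 e₂ e₃).const_mul (η ^ 2 * inner ℝ x e₁)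
      have j23 : Integrable (fun ξ =>
          η ^ 2 * inner ℝ x e₃ *
            (inner ℝ (gradient (F ξ) x) e₁ * inner ℝ (gradient (F ξ) x) e₂) +
          η ^ 2 * inner ℝ x e₂ *
            (inner ℝ (gradient (F ξ) x) e₁ * inner ℝ (gradient (F ξ) x) e₃)) P := j2.add j3
      have j234 : Integrable (fun ξ =>
          η ^ 2 * inner ℝ x e₃ *
            (inner ℝ (gradient (F ξ) x) e₁ * inner ℝ (gradient (F ξ) x) e₂) +
          η ^ 2 * inner ℝ x e₂ *
            (inner ℝ (gradient (F ξ) x) e₁ * inner ℝ (gradient (F ξ) x) e₃) +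
          η ^ 2 * inner ℝ x e₁ *
            (inner ℝ (gradient (F ξ) x) e₂ * inner ℝ (gradient (F ξ) x) e₃)) P := j23.add j4
      have j : Integrable (fun ξ => k x - η * innerSL ℝ (u x) (gradient (F ξ) x) +
          (η ^ 2 * inner ℝ x e₃ *
            (inner ℝ (gradient (F ξ) x) e₁ * inner ℝ (gradient (F ξ) x) e₂) +
          η ^ 2 * inner ℝ x e₂ *
            (inner ℝ (gradient (F ξ) x) e₁ * inner ℝ (gradient (F ξ) x) e₃) +
          η ^ 2 * inner ℝ x e₁ *
            (inner ℝ (gradient (F ξ) x) e₂ * inner ℝ (gradient (F ξ) x) e₃))) P :=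
        j1.add j234
      rw [integral_sub j (c3.const_mul _), integral_add j1 j234, integral_add j23 j4,
        integral_add j2 j3,
        integral_sub (integrable_const _) (c1.const_mul _)]
      simp only [integral_const_mul, h.integral_clm (innerSL ℝ (u x)) hx, integral_const,
        probReal_univ, smul_eq_mul, one_mul, hq]
      rfl
    have e3 : ‖∫ ξ, (inner ℝ (gradient (F ξ) x) e₁ * inner ℝ (gradient (F ξ) x) e₂ *
          inner ℝ (gradient (F ξ) x) e₃) ∂P‖ ≤ M ^ 3 := by
      have := norm_integral_le_of_norm_le_const (μ := P) (C := M ^ 3)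
        (f := fun ξ => inner ℝ (gradient (F ξ) x) e₁ * inner ℝ (gradient (F ξ) x) e₂ *
          inner ℝ (gradient (F ξ) x) e₃)
        (Eventually.of_forall fun ξ => by
          have b1 : ∀ e : E d, ‖e‖ = 1 → ‖inner ℝ (gradient (F ξ) x) e‖ ≤ M := fun e he => by
            refine (norm_inner_le_norm _ _).trans ?_
            rw [he, mul_one]
            exact h.bound ξ x hx
          rw [norm_mul, norm_mul, pow_succ, pow_two]
          exact mul_le_mul (mul_le_mul (b1 _ n₁) (b1 _ n₂) (norm_nonneg _) hM) (b1 _ n₃)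
            (norm_nonneg _) (by positivity))
      simpa using this
    rw [e2]
    calc _ = ‖-(η ^ 3 * ∫ ξ, (inner ℝ (gradient (F ξ) x) e₁ * inner ℝ (gradient (F ξ) x) e₂ *
          inner ℝ (gradient (F ξ) x) e₃) ∂P)‖ := by congr 1; ring
      _ ≤ η ^ 3 * M ^ 3 := by
        rw [norm_neg, norm_mul, Real.norm_of_nonneg (by positivity)]
        gcongr
  have hint := norm_integral_le_of_norm_le_const (μ := π) (hν.mono hstep)
  have ik := h.integrable_of_continuous hc hkc
  have iks := h.integrable_integral_step hc hkc
  have hsum : Integrable (fun x => q e₁ e₂ x * inner ℝ x e₃ + q e₁ e₃ x * inner ℝ x e₂ +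
      q e₂ e₃ x * inner ℝ x e₁) π := ((iq _ _ _).add (iq _ _ _)).add (iq _ _ _)
  have i1 : Integrable (fun x => (∫ ξ, k (x - η • gradient (F ξ) x) ∂P) - k x) π := iks.sub ik
  have i2 : Integrable (fun x => (∫ ξ, k (x - η • gradient (F ξ) x) ∂P) - k x +
      η * inner ℝ (u x) (gradient f x)) π := i1.add (iug.const_mul η)
  have i3 : Integrable (fun x => q e₁ e₂ x * inner ℝ x e₃ + q e₁ e₃ x * inner ℝ x e₂) π :=
    (iq _ _ _).add (iq _ _ _)
  rw [integral_sub i2 (hsum.const_mul _), integral_add i1 (iug.const_mul η),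
    integral_sub iks ik, h.integral_step_statLaw hc hkc, sub_self, zero_add, integral_const_mul,
    integral_const_mul, integral_add i3 (iq _ _ _), integral_add (iq _ _ _) (iq _ _ _),
    probReal_univ, mul_one, Real.norm_eq_abs] at hint
  have hu2 : ∫ x, inner ℝ (u x) (gradient f x) ∂π = (l₁ + l₂ + l₃) * ∫ x, k x ∂π +
      ∫ x, inner ℝ (u x) (gradient f x - fderiv ℝ (gradient f) 0 x) ∂π := by
    rw [← integral_const_mul, ← sub_eq_iff_eq_add', ← integral_sub iug (ik.const_mul _)]
    refine integral_congr_ae (Eventually.of_forall fun x => ?_)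
    have g1 : ∀ (e : E d) (l : ℝ), fderiv ℝ (gradient f) 0 e = l • e →
        inner ℝ e (fderiv ℝ (gradient f) 0 x) = l * inner ℝ x e := by
      intro e l he
      rw [← h.symm, he, inner_smul_left, real_inner_comm]; rfl
    simp only [hu, inner_sub_right, inner_add_left, inner_smul_left, g1 _ _ h₁, g1 _ _ h₂,
      g1 _ _ h₃, hk]
    simp
    ring
  have i4 : Integrable (fun x : E d => ‖x‖ ^ 4) π := h.integrable_of_continuous hc (by fun_prop)
  have hrem : ‖∫ x, inner ℝ (u x) (gradient f x - fderiv ℝ (gradient f) 0 x) ∂π‖ ≤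
      3 * C0 * (C4 * η ^ 2) := by
    have g2 : ‖∫ x, inner ℝ (u x) (gradient f x - fderiv ℝ (gradient f) 0 x) ∂π‖ ≤
        ∫ x, 3 * C0 * ‖x‖ ^ 4 ∂π := by
      refine norm_integral_le_of_norm_le (i4.const_mul _) ?_
      filter_upwards [hν] with x hx
      have a : ∀ e : E d, ‖e‖ = 1 → ‖inner ℝ x e‖ ≤ ‖x‖ := fun e he => by
        simpa [he] using norm_inner_le_norm (𝕜 := ℝ) x e
      have hun : ‖u x‖ ≤ 3 * ‖x‖ ^ 2 := by
        have a2 : ∀ e e' e'' : E d, ‖e‖ = 1 → ‖e'‖ = 1 → ‖e''‖ = 1 →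
            ‖(inner ℝ x e * inner ℝ x e') • e''‖ ≤ ‖x‖ ^ 2 := by
          intro e e' e'' he he' he''
          rw [norm_smul, he'', mul_one, norm_mul, pow_two]
          exact mul_le_mul (a e he) (a e' he') (norm_nonneg _) (norm_nonneg _)
        have a3 := norm_add₃_le (a := (inner ℝ x e₂ * inner ℝ x e₃) • e₁)
          (b := (inner ℝ x e₁ * inner ℝ x e₃) • e₂) (c := (inner ℝ x e₁ * inner ℝ x e₂) • e₃)
        have := a2 _ _ _ n₂ n₃ n₁
        have := a2 _ _ _ n₁ n₃ n₂
        have := a2 _ _ _ n₁ n₂ n₃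
        simp only [hu]
        linarith
      refine (norm_inner_le_norm _ _).trans ?_
      calc ‖u x‖ * ‖gradient f x - fderiv ℝ (gradient f) 0 x‖ ≤ (3 * ‖x‖ ^ 2) * (C0 * ‖x‖ ^ 2) :=
            mul_le_mul hun (hC x hx) (norm_nonneg _) (by positivity)
        _ = 3 * C0 * ‖x‖ ^ 4 := by ring
    refine g2.trans ?_
    rw [integral_const_mul]
    exact mul_le_mul_of_nonneg_left (h4 η b hc) (by positivity)
  rw [hu2] at hint
  have hA' := hA η b hc
  have hB' := hB η b hc
  have hD' := hD η b hc
  rw [Real.norm_eq_abs] at hrem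
  change |∫ x, q e₁ e₂ x * inner ℝ x e₃ ∂π| ≤ _ at hA'
  change |∫ x, q e₁ e₃ x * inner ℝ x e₂ ∂π| ≤ _ at hB'
  change |∫ x, q e₂ e₃ x * inner ℝ x e₁ ∂π| ≤ _ at hD'
  set K := ∫ x, k x ∂π
  set Q := ∫ x, inner ℝ (u x) (gradient f x - fderiv ℝ (gradient f) 0 x) ∂π
  set a1 := ∫ x, q e₁ e₂ x * inner ℝ x e₃ ∂π
  set a2 := ∫ x, q e₁ e₃ x * inner ℝ x e₂ ∂π
  set a3 := ∫ x, q e₂ e₃ x * inner ℝ x e₁ ∂π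
  have hfin : η * ((l₁ + l₂ + l₃) * |K|) ≤ η * ((3 * C0 * C4 + (A + B + D) + M ^ 3) * η ^ 2) := by
    have s1 : η * ((l₁ + l₂ + l₃) * |K|) = |η * ((l₁ + l₂ + l₃) * K)| := by
      rw [abs_mul, abs_mul, abs_of_pos hη, abs_of_pos (hγ.trans_le hl)]
    have s2 : η * ((l₁ + l₂ + l₃) * K) = (η * ((l₁ + l₂ + l₃) * K + Q) - η ^ 2 * (a1 + a2 + a3)) -
        η * Q + η ^ 2 * (a1 + a2 + a3) := by ring
    have s3 : |a1 + a2 + a3| ≤ (A + B + D) * η := by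
      have := abs_add_three a1 a2 a3
      linarith
    rw [s1, s2]
    refine (abs_add_le _ _).trans ((add_le_add_left (abs_sub _ _) _).trans ?_)
    rw [abs_mul, abs_mul, abs_of_pos hη, abs_of_pos (by positivity : 0 < η ^ 2)]
    have s4 := mul_le_mul_of_nonneg_left hrem hη.le
    have s5 := mul_le_mul_of_nonneg_left s3 (by positivity : 0 ≤ η ^ 2)
    nlinarith
  have hfin2 := le_of_mul_le_mul_left hfin hη
  have hfin3 : γ * |K| ≤ (3 * C0 * C4 + (A + B + D) + M ^ 3) * η ^ 2 :=
    (mul_le_mul_of_nonneg_right hl (abs_nonneg K)).trans hfin2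
  rw [div_mul_eq_mul_div, le_div_iff₀ hγ]
  linarith

/-- Third moments of the stationary law are of second order in the step size. -/
lemma exists_cubic_form_le (T : E d →L[ℝ] E d →L[ℝ] E d →L[ℝ] ℝ) :
    ∃ C, 0 ≤ C ∧ ∀ η b, Contracting F η γ b R →
      |∫ x, T x x x ∂(Contracting.statLaw P F η)| ≤ C * η ^ 2 := by
  -- Diagonalize the Hessian at the minimum and expand the form in an orthonormal eigenbasis.
  have hs : LinearMap.IsSymmetric (fderiv ℝ (gradient f) 0 : E d →ₗ[ℝ] E d) := fun v w => h.symm v w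
  set e := hs.eigenvectorBasis (finrank_euclideanSpace_fin (𝕜 := ℝ) (n := d)) with he
  have hn : ∀ i, ‖e i‖ = 1 := fun i => e.orthonormal.1 i
  have hl : ∀ i, ∃ l : ℝ, fderiv ℝ (gradient f) 0 (e i) = l • e i := fun i =>
    ⟨_, hs.apply_eigenvectorBasis (finrank_euclideanSpace_fin (𝕜 := ℝ) (n := d)) i⟩
  choose l hl using hl
  choose C hC0 hC using fun i j k =>
    h.exists_cubic_eigen_le (hn i) (hn j) (hn k) (hl i) (hl j) (hl k)
  refine ⟨∑ i, ∑ j, ∑ k, |T (e i) (e j) (e k)| * C i j k, Finset.sum_nonneg fun i _ =>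
    Finset.sum_nonneg fun j _ => Finset.sum_nonneg fun k _ =>
      mul_nonneg (abs_nonneg _) (hC0 i j k), fun η b hc => ?_⟩
  have hx : ∀ x : E d, T x x x = ∑ i, ∑ j, ∑ k, T (e i) (e j) (e k) *
      (inner ℝ x (e i) * inner ℝ x (e j) * inner ℝ x (e k)) := by
    intro x
    have h0 : x = ∑ i, inner ℝ x (e i) • e i := by
      conv_lhs => rw [← e.sum_repr x]
      simp_rw [e.repr_apply_apply, real_inner_comm]
    conv_lhs => rw [h0]
    simp only [map_sum, map_smul, _root_.sum_apply, _root_.smul_apply, smul_eq_mul,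
      Finset.mul_sum]
    rw [Finset.sum_comm]
    refine (Finset.sum_congr rfl fun _ _ => Finset.sum_comm).trans ?_
    rw [Finset.sum_comm]
    refine Finset.sum_congr rfl fun i _ => Finset.sum_congr rfl fun j _ =>
      Finset.sum_congr rfl fun k _ => ?_
    ring
  have hi : ∀ i j k, Integrable (fun x : E d => T (e i) (e j) (e k) *
      (inner ℝ x (e i) * inner ℝ x (e j) * inner ℝ x (e k))) (Contracting.statLaw P F η) :=
    fun i j k => h.integrable_of_continuous hc (by fun_prop)
  simp_rw [hx]
  rw [integral_finsetSum _ fun i _ => integrable_finsetSum _ fun j _ =>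
    integrable_finsetSum _ fun k _ => hi i j k, Finset.sum_mul]
  refine (Finset.abs_sum_le_sum_abs _ _).trans (Finset.sum_le_sum fun i _ => ?_)
  rw [integral_finsetSum _ fun j _ => integrable_finsetSum _ fun k _ => hi i j k, Finset.sum_mul]
  refine (Finset.abs_sum_le_sum_abs _ _).trans (Finset.sum_le_sum fun j _ => ?_)
  rw [integral_finsetSum _ fun k _ => hi i j k, Finset.sum_mul]
  refine (Finset.abs_sum_le_sum_abs _ _).trans (Finset.sum_le_sum fun k _ => ?_)
  rw [integral_const_mul, abs_mul, mul_assoc]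
  exact mul_le_mul_of_nonneg_left (hC i j k η b hc) (abs_nonneg _)

/-- Reduces smoothness in `x` of averaged bilinear forms to that of the cross moments assumed in
`Model`. -/
lemma integral_bilin_eq (β : E d →L[ℝ] E d →L[ℝ] ℝ) {x : E d} (hx : x ∈ ball (0 : E d) R) :
    ∫ ξ, β (gradient (F ξ) x) (gradient (F ξ) x) ∂P =
      ∑ i, ∑ j, β (EuclideanSpace.basisFun (Fin d) ℝ i) (EuclideanSpace.basisFun (Fin d) ℝ j) *
        ∫ ξ, inner ℝ (gradient (F ξ) x) (EuclideanSpace.basisFun (Fin d) ℝ i) *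
          inner ℝ (gradient (F ξ) x) (EuclideanSpace.basisFun (Fin d) ℝ j) ∂P := by
  set e := EuclideanSpace.basisFun (Fin d) ℝ
  have hg : ∀ g : E d, β g g = ∑ i, ∑ j, β (e i) (e j) * (inner ℝ g (e i) * inner ℝ g (e j)) := by
    intro g
    have h0 : g = ∑ i, inner ℝ g (e i) • e i := by
      conv_lhs => rw [← e.sum_repr g]
      simp_rw [e.repr_apply_apply, real_inner_comm]
    conv_lhs => rw [h0]
    simp only [map_sum, map_smul, _root_.sum_apply, _root_.smul_apply, smul_eq_mul,
      Finset.mul_sum]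
    rw [Finset.sum_comm]
    refine Finset.sum_congr rfl fun i _ => Finset.sum_congr rfl fun j _ => ?_
    ring
  have hi : ∀ i j, Integrable (fun ξ => β (e i) (e j) *
      (inner ℝ (gradient (F ξ) x) (e i) * inner ℝ (gradient (F ξ) x) (e j))) P := fun i j =>
    h.integrable_comp (k := fun g => β (e i) (e j) * (inner ℝ g (e i) * inner ℝ g (e j)))
      (by fun_prop) hx
  simp_rw [hg]
  rw [integral_finsetSum _ fun i _ => integrable_finsetSum _ fun j _ => hi i j]
  refine Finset.sum_congr rfl fun i _ => ?_
  rw [integral_finsetSum _ fun j _ => hi i j]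
  exact Finset.sum_congr rfl fun j _ => integral_const_mul _ _

lemma contDiffOn_bilin (β : E d →L[ℝ] E d →L[ℝ] ℝ) : ContDiffOn ℝ 2
    (fun x => ∫ ξ, β (gradient (F ξ) x) (gradient (F ξ) x) ∂P) (ball 0 R) :=
  ContDiffOn.congr (ContDiffOn.sum fun _ _ => ContDiffOn.sum fun _ _ =>
    contDiffOn_const.mul (h.contDiffOn_cross _ _)) fun _ hx => h.integral_bilin_eq β hx

lemma norm_bilin_le (β : E d →L[ℝ] E d →L[ℝ] ℝ) {x : E d} (hx : x ∈ ball (0 : E d) R) :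
    ‖∫ ξ, β (gradient (F ξ) x) (gradient (F ξ) x) ∂P‖ ≤ ‖β‖ * M * M := by
  have := norm_integral_le_of_norm_le_const (μ := P) (C := ‖β‖ * M * M)
    (f := fun ξ => β (gradient (F ξ) x) (gradient (F ξ) x))
    (Eventually.of_forall fun ξ => (β.le_opNorm₂ _ _).trans (by
      have := h.bound ξ x hx
      have := h.bound_nonneg
      gcongr))
  simpa using this

/-- Stationarity tested on the quadratic function `α x + β x x / 2`. -/
lemma integral_generator_quadratic (hc : Contracting F η γ b R) (α : E d →L[ℝ] ℝ)
    (β : E d →L[ℝ] E d →L[ℝ] ℝ) :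
    ∫ x, (α (gradient f x) + (β x (gradient f x) + β (gradient f x) x) / 2)
        ∂(Contracting.statLaw P F η) =
      η / 2 * ∫ x, ∫ ξ, β (gradient (F ξ) x) (gradient (F ξ) x) ∂P
        ∂(Contracting.statLaw P F η) := by
  have := hc.isProbabilityMeasure_statLaw (P := P) h.radius_pos
  have hν := h.ae_mem_statLaw hc
  have hη := hc.eta_pos
  set π := Contracting.statLaw P F η
  set k : E d → ℝ := fun x => α x + β x x / 2 with hk
  have hkc : Continuous k := by fun_prop
  set ψ : E d → ℝ := fun x => α (gradient f x) + (β x (gradient f x) + β (gradient f x) x) / 2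
    with hψ
  have hG := h.contDiffOn.continuousOn
  have hψc : ContinuousOn ψ (ball 0 R) := by fun_prop
  have iψ : Integrable ψ π := by
    refine integrable_of_continuousOn (B := ‖α‖ * M + (‖β‖ * R * M + ‖β‖ * M * R) / 2) hν hψc
      fun x hx => ?_
    have hx' := (mem_ball_zero_iff.1 hx).le
    have hg := h.norm_gradient_le hx
    have hM := h.bound_nonneg
    have hR := h.radius_pos.le
    have a1 : |α (gradient f x)| ≤ ‖α‖ * M := (α.le_opNorm _).trans (by gcongr)
    have a2 : |β x (gradient f x)| ≤ ‖β‖ * R * M := (β.le_opNorm₂ _ _).trans (by gcongr)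
    have a3 : |β (gradient f x) x| ≤ ‖β‖ * M * R := (β.le_opNorm₂ _ _).trans (by gcongr)
    rw [Real.norm_eq_abs]
    rw [abs_le] at *
    simp only [hψ]
    constructor <;> linarith
  have iQ : Integrable (fun x => ∫ ξ, β (gradient (F ξ) x) (gradient (F ξ) x) ∂P) π :=
    integrable_of_continuousOn hν (h.contDiffOn_bilin β).continuousOn
      fun x hx => h.norm_bilin_le β hx
  have hstep : ∀ x ∈ ball (0 : E d) R, ∫ ξ, k (x - η • gradient (F ξ) x) ∂P =
      k x - (η * ψ x - η ^ 2 / 2 * ∫ ξ, β (gradient (F ξ) x) (gradient (F ξ) x) ∂P) := by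
    intro x hx
    set A : E d →L[ℝ] ℝ := α + (2⁻¹ : ℝ) • (β x + β.flip x) with hAd
    have hA : A (gradient f x) = ψ x := by
      simp [hAd, hψ]; ring
    -- No remainder occurs because `k` is quadratic; `A` is its derivative at `x`.
    have e1 : ∀ g : E d, k (x - η • g) = (k x - η * A g) + η ^ 2 / 2 * β g g := by
      intro g
      simp [hk, hAd]; ring
    have c1 : Integrable (fun ξ => k x - η * A (gradient (F ξ) x)) P :=
      h.integrable_comp (k := fun g => k x - η * A g) (by fun_prop) hx
    have c2 : Integrable (fun ξ => η ^ 2 / 2 * β (gradient (F ξ) x) (gradient (F ξ) x)) P :=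
      h.integrable_comp (k := fun g => η ^ 2 / 2 * β g g) (by fun_prop) hx
    have c3 : Integrable (fun ξ => η * A (gradient (F ξ) x)) P :=
      h.integrable_comp (k := fun g => η * A g) (by fun_prop) hx
    simp_rw [e1]
    rw [integral_add c1 c2, integral_sub (integrable_const _) c3, integral_const_mul,
      integral_const_mul, h.integral_clm A hx, hA]
    simp
    ring
  have i1 : Integrable (fun x => η * ψ x -
      η ^ 2 / 2 * ∫ ξ, β (gradient (F ξ) x) (gradient (F ξ) x) ∂P) π :=
    (iψ.const_mul _).sub (iQ.const_mul _)
  have h1 := h.integral_step_statLaw hc hkc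
  rw [integral_congr_ae (hν.mono hstep), integral_sub (h.integrable_of_continuous hc hkc) i1,
    integral_sub (iψ.const_mul _) (iQ.const_mul _), integral_const_mul, integral_const_mul] at h1
  have h2 : η * ∫ x, ψ x ∂π =
      η * (η / 2 * ∫ x, ∫ ξ, β (gradient (F ξ) x) (gradient (F ξ) x) ∂P ∂π) := by
    linarith
  exact mul_left_cancel₀ hη.ne' h2

/-- The first order expansion of stationary averages of `φ`, if the two-jet of `φ` at `0` is that
of the generator of the gradient flow applied to the quadratic function `-(α x + β x x / 2)`. -/
theorem exists_second_order_bound {φ : E d → ℝ} {B : ℝ} (hφ4 : ContDiffAt ℝ 4 φ 0)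
    (hφ : ContinuousOn φ (ball 0 R)) (hB : ∀ x ∈ ball (0 : E d) R, ‖φ x‖ ≤ B)
    (α : E d →L[ℝ] ℝ) (β : E d →L[ℝ] E d →L[ℝ] ℝ) {ψ : E d → ℝ}
    (hψ : ψ = fun x => α (gradient f x) + (β x (gradient f x) + β (gradient f x) x) / 2)
    (h1 : fderiv ℝ (fun x => φ x - ψ x) 0 = 0)
    (h2 : ∀ v, fderiv ℝ (fderiv ℝ (fun x => φ x - ψ x)) 0 v v = 0) :
    ∃ C, 0 ≤ C ∧ ∀ η b, Contracting F η γ b R →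
      |(∫ x, φ x ∂(Contracting.statLaw P F η)) - φ 0 -
        η * ((∫ ξ, β (gradient (F ξ) 0) (gradient (F ξ) 0) ∂P) / 2)| ≤ C * η ^ 2 := by
  have hG := h.contDiffOn.continuousOn
  have hψc : ContinuousOn ψ (ball 0 R) := by rw [hψ]; fun_prop
  have hψ0 : ψ 0 = 0 := by simp [hψ, h.gradient_zero]
  have hψ4 : ContDiffAt ℝ 4 ψ 0 := by
    have hg : ContDiffAt ℝ 4 (gradient f) 0 := h.contDiffAt_zero.of_le (by norm_num)
    rw [hψ]
    refine (contDiffAt_const.clm_apply hg).add (ContDiffAt.div_const (ContDiffAt.add ?_ ?_) _)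
    · exact (β.contDiff.contDiffAt).clm_apply hg
    · exact (β.contDiff.contDiffAt.comp 0 hg).clm_apply contDiffAt_id
  have hψB : ∀ x ∈ ball (0 : E d) R, |ψ x| ≤ ‖α‖ * M + (‖β‖ * R * M + ‖β‖ * M * R) / 2 := by
    intro x hx
    have hx' := (mem_ball_zero_iff.1 hx).le
    have hg := h.norm_gradient_le hx
    have hM := h.bound_nonneg
    have hR := h.radius_pos.le
    have a1 : |α (gradient f x)| ≤ ‖α‖ * M := (α.le_opNorm _).trans (by gcongr)
    have a2 : |β x (gradient f x)| ≤ ‖β‖ * R * M := (β.le_opNorm₂ _ _).trans (by gcongr)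
    have a3 : |β (gradient f x) x| ≤ ‖β‖ * M * R := (β.le_opNorm₂ _ _).trans (by gcongr)
    rw [abs_le] at *
    simp only [hψ]
    constructor <;> linarith
  set k : E d → ℝ := fun x => (φ x - ψ x) - φ 0 with hk
  have hd : fderiv ℝ k = fderiv ℝ (fun x => φ x - ψ x) := by
    funext x; exact fderiv_sub_const _
  set B' := ‖α‖ * M + (‖β‖ * R * M + ‖β‖ * M * R) / 2
  obtain ⟨C₄, hC₄, h4⟩ := exists_quartic_remainder_bound (h := k) (R := R) (B := B + B' + |φ 0|)
    ((hφ4.sub hψ4).sub contDiffAt_const) (fun x hx => by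
      have a1 := hB x hx
      have a2 := hψB x hx
      rw [Real.norm_eq_abs] at a1
      have := abs_sub (φ x - ψ x) (φ 0)
      have := abs_sub (φ x) (ψ x)
      linarith) (by simp [hk, hψ0]) (by rw [hd, h1]) (by rw [hd]; exact h2)
  set T := fderiv ℝ (fderiv ℝ (fderiv ℝ k)) 0
  obtain ⟨C₃, hC₃, h3⟩ := h.exists_cubic_form_le T
  obtain ⟨Cm, hCm, hm⟩ := h.exists_fourth_moment_le
  obtain ⟨Cq, hCq, hq⟩ := h.exists_stationary_bias_bound
    ((h.contDiffOn_bilin β).contDiffAt (isOpen_ball.mem_nhds h.zero_mem))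
    (h.contDiffOn_bilin β).continuousOn (fun x hx => h.norm_bilin_le β hx)
  refine ⟨C₄ * Cm + C₃ / 6 + Cq / 2, by positivity, fun η b hc => ?_⟩
  have := hc.isProbabilityMeasure_statLaw (P := P) h.radius_pos
  have hν := h.ae_mem_statLaw hc
  have hη := hc.eta_pos
  have hQ := h.integral_generator_quadratic hc α β
  specialize hq η b hc
  specialize hm η b hc
  specialize h3 η b hc
  set π := Contracting.statLaw P F η
  have iφ : Integrable φ π := integrable_of_continuousOn hν hφ hB
  have iψ : Integrable ψ π := integrable_of_continuousOn hν hψc hψB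
  have ik : Integrable k π := (iφ.sub iψ).sub (integrable_const _)
  have iT : Integrable (fun x : E d => T x x x / 6) π :=
    h.integrable_of_continuous hc (by fun_prop)
  have i4 : Integrable (fun x : E d => ‖x‖ ^ 4) π := h.integrable_of_continuous hc (by fun_prop)
  have e1 : ∫ x, k x ∂π = ∫ x, φ x ∂π - ∫ x, ψ x ∂π - φ 0 := by
    have i' : Integrable (fun x => φ x - ψ x) π := iφ.sub iψ
    rw [hk, integral_sub i' (integrable_const _), integral_sub iφ iψ]
    simp
  have e2 : |∫ x, k x ∂π - (∫ x, T x x x ∂π) / 6| ≤ C₄ * (Cm * η ^ 2) := by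
    rw [← integral_div, ← integral_sub ik iT]
    refine (norm_integral_le_of_norm_le (f := fun x => k x - T x x x / 6)
      (i4.const_mul C₄) (hν.mono fun x hx => h4 x hx)).trans ?_
    rw [integral_const_mul]
    exact mul_le_mul_of_nonneg_left hm hC₄
  rw [hψ] at e1
  rw [hQ] at e1
  set Q := ∫ x, ∫ ξ, β (gradient (F ξ) x) (gradient (F ξ) x) ∂P ∂π
  set q := ∫ ξ, β (gradient (F ξ) 0) (gradient (F ξ) 0) ∂P
  -- Three errors: the quartic remainder, the third moments, and the replacement of the averaged
  -- form by its value at `0`, which is of order `η` and carries a further factor `η`.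
  have e3 : ∫ x, φ x ∂π - φ 0 - η * (q / 2) = (∫ x, k x ∂π - (∫ x, T x x x ∂π) / 6) +
      (∫ x, T x x x ∂π) / 6 + η * ((Q - q) / 2) := by rw [e1]; ring
  rw [e3]
  refine (abs_add_three _ _ _).trans ?_
  rw [abs_div, abs_mul, abs_div, abs_of_pos hη, abs_of_pos (by norm_num : (0 : ℝ) < 6),
    abs_of_pos (by norm_num : (0 : ℝ) < 2)]
  have e4 := mul_le_mul_of_nonneg_left hq hη.le
  nlinarith

end Model

end StationaryExpansion

/-! ### Mixed and second derivatives. -/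

section Calculus

variable {X Y : Type*} [NormedAddCommGroup X] [NormedSpace ℝ X] [NormedAddCommGroup Y]
  [NormedSpace ℝ Y]

lemma fderiv_slice {Ψ : ℝ → X → Y} {t : ℝ} {x : X}
    (hΨ : DifferentiableAt ℝ (fun p : ℝ × X => Ψ p.1 p.2) (t, x)) :
    fderiv ℝ (Ψ t) x =
      (fderiv ℝ (fun p : ℝ × X => Ψ p.1 p.2) (t, x)) ∘L (ContinuousLinearMap.inr ℝ ℝ X) :=
  (hΨ.hasFDerivAt.comp (f := fun y => (t, y)) x (hasFDerivAt_prodMk_right t x)).fderiv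

lemma contDiff_fderiv_slice {Ψ : ℝ → X → Y} {n m : ℕ} (hnm : n + 1 ≤ m)
    (hΨ : ContDiff ℝ m fun p : ℝ × X => Ψ p.1 p.2) :
    ContDiff ℝ n fun p : ℝ × X => fderiv ℝ (Ψ p.1) p.2 := by
  have hd : Differentiable ℝ fun p : ℝ × X => Ψ p.1 p.2 :=
    hΨ.differentiable (by norm_cast; omega)
  have : (fun p : ℝ × X => fderiv ℝ (Ψ p.1) p.2) = fun p =>
      (fderiv ℝ (fun p : ℝ × X => Ψ p.1 p.2) p) ∘L (ContinuousLinearMap.inr ℝ ℝ X) :=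
    funext fun p => fderiv_slice (hd _)
  rw [this]
  exact (hΨ.fderiv_right (by exact_mod_cast hnm)).clm_comp contDiff_const

/-- Time derivatives commute with space derivatives. -/
lemma hasDerivAt_fderiv_swap {Ψ Ψ' : ℝ → X → Y} (hΨ : ContDiff ℝ 2 fun p : ℝ × X => Ψ p.1 p.2)
    (h' : ∀ t x, HasDerivAt (fun s => Ψ s x) (Ψ' t x) t) (t : ℝ) (x : X) :
    HasDerivAt (fun s => fderiv ℝ (Ψ s) x) (fderiv ℝ (Ψ' t) x) t := by
  set H : ℝ × X → Y := fun p => Ψ p.1 p.2 with hH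
  have hd : Differentiable ℝ H := hΨ.differentiable (by norm_num)
  have hd2 : Differentiable ℝ (fderiv ℝ H) :=
    (hΨ.fderiv_right (m := 1) (by norm_num)).differentiable one_ne_zero
  have e1 : ∀ s, fderiv ℝ (Ψ s) x = fderiv ℝ H (s, x) ∘L ContinuousLinearMap.inr ℝ ℝ X :=
    fun s => fderiv_slice (hd _)
  have e2 : ∀ y, Ψ' t y = fderiv ℝ H (t, y) (1, 0) := fun y =>
    (h' t y).unique ((hd (t, y)).hasFDerivAt.comp_hasDerivAt (f := fun s => (s, y)) t
      ((hasDerivAt_id t).prodMk (hasDerivAt_const t y)))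
  have d1 : HasDerivAt (fun s => fderiv ℝ H (s, x)) (fderiv ℝ (fderiv ℝ H) (t, x) (1, 0)) t :=
    (hd2 (t, x)).hasFDerivAt.comp_hasDerivAt (f := fun s => (s, x)) t
      ((hasDerivAt_id t).prodMk (hasDerivAt_const t x))
  have d2 : HasFDerivAt (fun y => fderiv ℝ H (t, y))
      (fderiv ℝ (fderiv ℝ H) (t, x) ∘L ContinuousLinearMap.inr ℝ ℝ X) x :=
    (hd2 (t, x)).hasFDerivAt.comp (f := fun y => (t, y)) x (hasFDerivAt_prodMk_right t x)
  have hs : IsSymmSndFDerivAt ℝ H (t, x) :=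
    hΨ.contDiffAt.isSymmSndFDerivAt (by simp)
  have e3 : fderiv ℝ (Ψ' t) x =
      fderiv ℝ (fderiv ℝ H) (t, x) (1, 0) ∘L ContinuousLinearMap.inr ℝ ℝ X := by
    have : Ψ' t = fun y => fderiv ℝ H (t, y) (1, 0) := funext e2
    rw [this]
    have d3 := d2.clm_apply (hasFDerivAt_const ((1 : ℝ), (0 : X)) x)
    rw [d3.fderiv]
    ext v
    simpa using hs (0, v) (1, 0)
  rw [e3]
  simp_rw [e1]
  exact (((ContinuousLinearMap.compL ℝ X (ℝ × X) Y).flip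
    (ContinuousLinearMap.inr ℝ ℝ X)).hasFDerivAt.comp_hasDerivAt t d1)

/-- The diagonal second derivative of a pairing at a zero of its second factor. -/
lemma fderiv_fderiv_clm_apply_self {c : X → X →L[ℝ] Y} {y : X → X} {x : X}
    (hc : ContDiffAt ℝ 2 c x) (hy : ContDiffAt ℝ 2 y x) (h0 : y x = 0) (v : X) :
    fderiv ℝ (fderiv ℝ fun z => c z (y z)) x v v =
      2 • fderiv ℝ c x v (fderiv ℝ y x v) + c x (fderiv ℝ (fderiv ℝ y) x v v) := by
  have dc : ∀ᶠ z in 𝓝 x, DifferentiableAt ℝ c z :=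
    (hc.eventually (by norm_num)).mono fun z hz => hz.differentiableAt (by norm_num)
  have dy : ∀ᶠ z in 𝓝 x, DifferentiableAt ℝ y z :=
    (hy.eventually (by norm_num)).mono fun z hz => hz.differentiableAt (by norm_num)
  have dc2 : DifferentiableAt ℝ (fderiv ℝ c) x :=
    (hc.fderiv_right (m := 1) (by norm_num)).differentiableAt one_ne_zero
  have dy2 : DifferentiableAt ℝ (fderiv ℝ y) x :=
    (hy.fderiv_right (m := 1) (by norm_num)).differentiableAt one_ne_zero
  have e1 : (fun z => fderiv ℝ (fun z => c z (y z)) z v) =ᶠ[𝓝 x]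
      fun z => c z (fderiv ℝ y z v) + fderiv ℝ c z v (y z) := by
    filter_upwards [dc, dy] with z h1 h2
    rw [fderiv_clm_apply h1 h2]
    simp
  have hk : ContDiffAt ℝ 2 (fun z => c z (y z)) x := hc.clm_apply hy
  have dk2 : DifferentiableAt ℝ (fderiv ℝ fun z => c z (y z)) x :=
    (hk.fderiv_right (m := 1) (by norm_num)).differentiableAt one_ne_zero
  have e2 : fderiv ℝ (fderiv ℝ fun z => c z (y z)) x v v =
      fderiv ℝ (fun z => fderiv ℝ (fun z => c z (y z)) z v) x v := by
    rw [fderiv_clm_apply dk2 (differentiableAt_const v)]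
    simp
  have hyv : DifferentiableAt ℝ (fun z => fderiv ℝ y z v) x :=
    dy2.clm_apply (differentiableAt_const v)
  have hcv : DifferentiableAt ℝ (fun z => fderiv ℝ c z v) x :=
    dc2.clm_apply (differentiableAt_const v)
  rw [e2, e1.fderiv_eq, fderiv_fun_add (dc.self_of_nhds.clm_apply hyv)
    (hcv.clm_apply dy.self_of_nhds), fderiv_clm_apply dc.self_of_nhds hyv,
    fderiv_clm_apply hcv dy.self_of_nhds, fderiv_clm_apply dy2 (differentiableAt_const v)]
  simp [h0, two_smul]
  abel

end Calculus

/-! ### Exponential decay from differential inequalities. -/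

section Decay

variable {X : Type*} [NormedAddCommGroup X] [InnerProductSpace ℝ X]

/-- The hypothesis makes $e^{2\gamma t}\|z\|^2$ nonincreasing on $t\ge0$. -/
lemma norm_le_exp_of_inner_le {z z' : ℝ → X} {γ : ℝ} (hz : ∀ t, HasDerivAt z (z' t) t)
    (h : ∀ t, 0 ≤ t → inner ℝ (z' t) (z t) ≤ -γ * ‖z t‖ ^ 2) {t : ℝ} (ht : 0 ≤ t) :
    ‖z t‖ ≤ Real.exp (-γ * t) * ‖z 0‖ := by
  have hd : ∀ s, HasDerivAt (fun s => Real.exp (2 * γ * s) * ‖z s‖ ^ 2)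
      (Real.exp (2 * γ * s) * (2 * γ) * ‖z s‖ ^ 2 +
        Real.exp (2 * γ * s) * (2 * inner ℝ (z s) (z' s))) s := fun s =>
    (((hasDerivAt_id s).const_mul (2 * γ)).exp.congr_deriv (by simp)).mul (hz s).norm_sq
  have ha : AntitoneOn (fun s => Real.exp (2 * γ * s) * ‖z s‖ ^ 2) (Ici 0) := by
    refine antitoneOn_of_deriv_nonpos (convex_Ici 0)
      (fun s _ => (hd s).continuousAt.continuousWithinAt)
      (fun s _ => (hd s).differentiableAt.differentiableWithinAt) fun s hs => ?_
    rw [interior_Ici] at hs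
    rw [(hd s).deriv]
    have h1 := h s (le_of_lt hs)
    rw [real_inner_comm] at h1
    have h2 := mul_le_mul_of_nonneg_left h1 (Real.exp_pos (2 * γ * s)).le
    nlinarith
  have h1 := ha self_mem_Ici (mem_Ici.2 ht) ht
  simp only [mul_zero, Real.exp_zero, one_mul] at h1
  have h2 : ‖z t‖ ^ 2 ≤ (Real.exp (-γ * t) * ‖z 0‖) ^ 2 := by
    have e : (Real.exp (-γ * t)) ^ 2 * Real.exp (2 * γ * t) = 1 := by
      rw [← Real.exp_nat_mul, ← Real.exp_add]
      simp; ring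
    calc ‖z t‖ ^ 2 = (Real.exp (-γ * t)) ^ 2 * (Real.exp (2 * γ * t) * ‖z t‖ ^ 2) := by
          rw [← mul_assoc, e, one_mul]
      _ ≤ (Real.exp (-γ * t)) ^ 2 * ‖z 0‖ ^ 2 := by gcongr
      _ = _ := by ring
  exact le_of_sq_le_sq h2 (by positivity)

/-- Put $N=e^{2\gamma t}\|z\|^2+1$. Then $N'\le2C\|z\|\le Ce^{-\gamma t}N$, the second bound being
$2a\le a^2+1$ with $a=e^{\gamma t}\|z\|$. The factor $p$ compensates this growth, so $Np$ is
nonincreasing. Adding $1$ avoids differentiating the norm at its zeros. -/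
lemma norm_le_exp_of_forced {z z' : ℝ → X} {γ C : ℝ} (hγ : 0 < γ) (hC : 0 ≤ C)
    (hz : ∀ t, HasDerivAt z (z' t) t) (h0 : z 0 = 0)
    (h : ∀ t, 0 ≤ t → inner ℝ (z' t) (z t) ≤ -γ * ‖z t‖ ^ 2 +
      C * Real.exp (-(2 * γ) * t) * ‖z t‖) {t : ℝ} (ht : 0 ≤ t) :
    ‖z t‖ ≤ Real.exp (C / γ) * Real.exp (-γ * t) := by
  set p : ℝ → ℝ := fun s => Real.exp (C / γ * Real.exp (-γ * s)) with hp
  have hpd : ∀ s, HasDerivAt p (p s * (C / γ * (Real.exp (-γ * s) * -γ))) s := fun s =>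
    ((((hasDerivAt_id s).const_mul (-γ)).exp.const_mul (C / γ)).exp).congr_deriv (by simp [hp])
  have hNd : ∀ s, HasDerivAt (fun s => Real.exp (2 * γ * s) * ‖z s‖ ^ 2 + 1)
      (Real.exp (2 * γ * s) * (2 * γ) * ‖z s‖ ^ 2 +
        Real.exp (2 * γ * s) * (2 * inner ℝ (z s) (z' s))) s := fun s =>
    ((((hasDerivAt_id s).const_mul (2 * γ)).exp.congr_deriv (by simp)).mul
      (hz s).norm_sq).add_const 1
  have ha : AntitoneOn (fun s => (Real.exp (2 * γ * s) * ‖z s‖ ^ 2 + 1) * p s) (Ici 0) := by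
    refine antitoneOn_of_deriv_nonpos (convex_Ici 0)
      (fun s _ => ((hNd s).mul (hpd s)).continuousAt.continuousWithinAt)
      (fun s _ => ((hNd s).mul (hpd s)).differentiableAt.differentiableWithinAt) fun s hs => ?_
    rw [interior_Ici] at hs
    have hder := ((hNd s).mul (hpd s)).deriv
    refine hder.le.trans ?_
    have h1 := h s (le_of_lt hs)
    rw [real_inner_comm] at h1
    set w := Real.exp (γ * s) with hw
    have hwp : 0 < w := Real.exp_pos _
    have e1 : Real.exp (2 * γ * s) = w ^ 2 := by
      rw [hw, ← Real.exp_nat_mul]; push_cast; ring_nf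
    have e2 : Real.exp (-γ * s) = w⁻¹ := by rw [hw, ← Real.exp_neg]; ring_nf
    have e3 : Real.exp (-(2 * γ) * s) = (w ^ 2)⁻¹ := by rw [← e1, ← Real.exp_neg]; ring_nf
    rw [e3] at h1
    rw [e1, e2]
    have h2 := mul_le_mul_of_nonneg_left h1 (by positivity : 0 ≤ 2 * w ^ 2)
    have e4 : 2 * w ^ 2 * (-γ * ‖z s‖ ^ 2 + C * (w ^ 2)⁻¹ * ‖z s‖) =
        -(2 * γ) * w ^ 2 * ‖z s‖ ^ 2 + 2 * C * ‖z s‖ := by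
      field_simp
    have e5 : C / γ * (w⁻¹ * -γ) = -(C * w⁻¹) := by field_simp
    rw [e4] at h2
    rw [e5]
    have h3 : 2 * ‖z s‖ ≤ (w ^ 2 * ‖z s‖ ^ 2 + 1) * w⁻¹ := by
      rw [← div_eq_mul_inv, le_div_iff₀ hwp]
      nlinarith [sq_nonneg (w * ‖z s‖ - 1)]
    have h4 := mul_le_mul_of_nonneg_left h3 hC
    have hps : 0 < p s := Real.exp_pos _
    have h5 : w ^ 2 * (2 * γ) * ‖z s‖ ^ 2 + w ^ 2 * (2 * inner ℝ (z s) (z' s)) ≤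
        C * ((w ^ 2 * ‖z s‖ ^ 2 + 1) * w⁻¹) := by linarith
    have h6 := mul_le_mul_of_nonneg_right h5 hps.le
    linarith
  have h1 := ha self_mem_Ici (mem_Ici.2 ht) ht
  have hp1 : 1 ≤ p t := Real.one_le_exp (by positivity)
  have hp0 : p 0 = Real.exp (C / γ) := by simp [hp]
  simp only [h0, norm_zero, ne_eq, OfNat.ofNat_ne_zero, not_false_eq_true, zero_pow, mul_zero,
    zero_add, one_mul] at h1
  rw [hp0] at h1
  have h2 : Real.exp (2 * γ * t) * ‖z t‖ ^ 2 ≤ Real.exp (C / γ) := by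
    have : 0 ≤ Real.exp (2 * γ * t) * ‖z t‖ ^ 2 := by positivity
    nlinarith
  have h3 : (1 : ℝ) ≤ Real.exp (C / γ) := Real.one_le_exp (by positivity)
  refine le_of_sq_le_sq ?_ (by positivity)
  have e : (Real.exp (-γ * t)) ^ 2 * Real.exp (2 * γ * t) = 1 := by
    rw [← Real.exp_nat_mul, ← Real.exp_add]
    simp; ring
  calc ‖z t‖ ^ 2 = (Real.exp (-γ * t)) ^ 2 * (Real.exp (2 * γ * t) * ‖z t‖ ^ 2) := by
        rw [← mul_assoc, e, one_mul]
    _ ≤ (Real.exp (-γ * t)) ^ 2 * (Real.exp (C / γ) * Real.exp (C / γ)) := by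
        exact mul_le_mul_of_nonneg_left (h2.trans (by nlinarith)) (by positivity)
    _ = _ := by ring

end Decay

/-! ### Characteristics and Duhamel's formula. -/

section Duhamel

variable {X : Type} [NormedAddCommGroup X] [NormedSpace ℝ X] [CompleteSpace X] {V : X → X}
  {Φ : ℝ → X → X}

namespace IsFlow

lemma hasDerivAt_comp_neg (h : IsFlow V Φ) {u : ℝ → X → ℝ} {t : ℝ} {x : X}
    (hu : DifferentiableAt ℝ (fun p : ℝ × X => u p.1 p.2) (t, x)) {u' : ℝ}
    (hu' : HasDerivAt (fun s => u s x) u' t) :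
    HasDerivAt (fun r => u (t - r) (Φ r x)) (fderiv ℝ (u t) x (V x) - u') 0 := by
  have h1 : HasDerivAt (fun r => (t - r, Φ r x)) ((-1 : ℝ), V x) 0 := by
    have := h.deriv x 0
    rw [h.zero] at this
    exact (((hasDerivAt_id (0 : ℝ)).const_sub t)).prodMk this
  have hp : (t - 0, Φ 0 x) = (t, x) := by rw [h.zero, sub_zero]
  have hu2 : HasFDerivAt (fun p : ℝ × X => u p.1 p.2)
      (fderiv ℝ (fun p : ℝ × X => u p.1 p.2) (t, x)) (t - 0, Φ 0 x) := by
    rw [hp]; exact hu.hasFDerivAt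
  have h2 := hu2.comp_hasDerivAt (f := fun r => (t - r, Φ r x)) 0 h1
  have e1 : u' = fderiv ℝ (fun p : ℝ × X => u p.1 p.2) (t, x) (1, 0) :=
    hu'.unique (hu.hasFDerivAt.comp_hasDerivAt (f := fun s => (s, x)) t
      ((hasDerivAt_id t).prodMk (hasDerivAt_const t x)))
  refine h2.congr_deriv ?_
  rw [fderiv_slice hu, e1, ContinuousLinearMap.comp_apply, ← map_sub]
  simp

/-- By the group law `φ (Φ (t - r) (Φ r x))` does not depend on `r`; its derivative at `r = 0` is
the transport equation. -/
lemma hasDerivAt_comp (h : IsFlow V Φ) {C : NNReal} (hV : LipschitzWith C V) {φ : X → ℝ}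
    (hφ : ContDiff ℝ 1 φ) (hΦ : ContDiff ℝ 1 fun p : ℝ × X => Φ p.1 p.2) (t : ℝ) (x : X) :
    HasDerivAt (fun s => φ (Φ s x)) (fderiv ℝ (fun y => φ (Φ t y)) x (V x)) t := by
  have hd : Differentiable ℝ fun p : ℝ × X => φ (Φ p.1 p.2) :=
    (hφ.comp hΦ).differentiable one_ne_zero
  have h1 : HasDerivAt (fun s => φ (Φ s x)) (fderiv ℝ φ (Φ t x) (V (Φ t x))) t :=
    ((hφ.differentiable one_ne_zero) _).hasFDerivAt.comp_hasDerivAt t (h.deriv x t)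
  have h2 := h.hasDerivAt_comp_neg (u := fun s y => φ (Φ s y)) (hd (t, x)) h1
  have h3 : (fun r => φ (Φ (t - r) (Φ r x))) = fun _ => φ (Φ t x) := by
    funext r
    rw [← h.add hV, sub_add_cancel]
  rw [h3] at h2
  have h4 := h2.unique (hasDerivAt_const 0 _)
  rw [sub_eq_zero] at h4
  rw [h4]
  exact h1

end IsFlow

/-- The Duhamel integral of the source `G`. -/
def duhamel (Φ : ℝ → X → X) (G : ℝ → X → ℝ) (t : ℝ) (x : X) : ℝ :=
  t * ∫ σ in (0 : ℝ)..1, G (t - t * σ) (Φ (t * σ) x)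

lemma duhamel_eq (Φ : ℝ → X → X) (G : ℝ → X → ℝ) (t : ℝ) (x : X) :
    duhamel Φ G t x = ∫ s in (0 : ℝ)..t, G (t - s) (Φ s x) := by
  have := intervalIntegral.smul_integral_comp_mul_left (a := 0) (b := 1)
    (f := fun s => G (t - s) (Φ s x)) (c := t)
  simpa [duhamel] using this

/-- This is why `duhamel` is rescaled to the unit interval: over a fixed interval, joint smoothness
in `(t, x)` is differentiation under the integral. -/
lemma contDiff_duhamel [FiniteDimensional ℝ X] {n : ℕ} {G : ℝ → X → ℝ}
    (hG : ContDiff ℝ n fun p : ℝ × X => G p.1 p.2)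
    (hΦ : ContDiff ℝ n fun p : ℝ × X => Φ p.1 p.2) :
    ContDiff ℝ n fun p : ℝ × X => duhamel Φ G p.1 p.2 := by
  refine contDiff_fst.mul (contDiff_integral_unitInterval
    (H := fun σ (p : ℝ × X) => G (p.1 - p.1 * σ) (Φ (p.1 * σ) p.2)) ?_)
  have h1 : ContDiff ℝ n fun q : ℝ × ℝ × X => q.2.1 * q.1 := by fun_prop
  exact hG.comp ((ContDiff.sub (by fun_prop) h1).prodMk
    (hΦ.comp (h1.prodMk (by fun_prop))))

namespace IsFlow

lemma hasDerivAt_duhamel [FiniteDimensional ℝ X] (h : IsFlow V Φ) {C : NNReal}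
    (hV : LipschitzWith C V) {G : ℝ → X → ℝ} (hG : ContDiff ℝ 1 fun p : ℝ × X => G p.1 p.2)
    (hΦ : ContDiff ℝ 1 fun p : ℝ × X => Φ p.1 p.2) (t : ℝ) (x : X) :
    HasDerivAt (fun s => duhamel Φ G s x) (fderiv ℝ (duhamel Φ G t) x (V x) + G t x) t := by
  have hd : Differentiable ℝ fun p : ℝ × X => duhamel Φ G p.1 p.2 :=
    (contDiff_duhamel (n := 1) hG hΦ).differentiable one_ne_zero
  have hc : Continuous fun s => G (t - s) (Φ s x) :=
    hG.continuous.comp ((continuous_const.sub continuous_id).prodMk (h.continuous_left x))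
  have h1 : HasDerivAt (fun s => duhamel Φ G s x) (_root_.deriv (fun s => duhamel Φ G s x) t) t :=
    DifferentiableAt.hasDerivAt ((hd (t, x)).comp (f := fun s => (s, x)) t
      ((differentiableAt_id).prodMk (differentiableAt_const x)))
  have h2 := h.hasDerivAt_comp_neg (hd (t, x)) h1
  have h3 : HasDerivAt (fun r => ∫ s in (0 : ℝ)..r, G (t - s) (Φ s x)) (G t x) 0 := by
    have := intervalIntegral.integral_hasDerivAt_right (hc.intervalIntegrable 0 0)
      hc.stronglyMeasurable.stronglyMeasurableAtFilter hc.continuousAt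
    simpa [h.zero] using this
  -- The Duhamel integral split at time `r`: the sum is constant, so its derivative at `r = 0`
  -- vanishes, which is the inhomogeneous equation.
  have h4 : (fun r => (∫ s in (0 : ℝ)..r, G (t - s) (Φ s x)) + duhamel Φ G (t - r) (Φ r x)) =
      fun _ => duhamel Φ G t x := by
    funext r
    rw [duhamel_eq, duhamel_eq]
    have : ∫ s in (0 : ℝ)..(t - r), G (t - r - s) (Φ s (Φ r x)) =
        ∫ s in r..t, G (t - s) (Φ s x) := by
      have := intervalIntegral.integral_comp_add_right (a := 0) (b := t - r)
        (fun s => G (t - s) (Φ s x)) r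
      rw [zero_add, sub_add_cancel] at this
      rw [← this]
      refine intervalIntegral.integral_congr fun s _ => ?_
      simp only [← h.add hV]
      ring_nf
    rw [this, intervalIntegral.integral_add_adjacent_intervals (hc.intervalIntegrable _ _)
      (hc.intervalIntegrable _ _)]
  have h5 := h3.fun_add h2
  rw [h4] at h5
  have h7 := h5.unique (hasDerivAt_const 0 _)
  refine h1.congr_deriv ?_
  linarith

end IsFlow

end Duhamel

/-! ### The transport equation on a ball: uniqueness, construction, cut-off. -/

section Transport

variable {d : ℕ} {Ξ : Type*} [MeasurableSpace Ξ] {P : Measure Ξ} {F : Ξ → E d → ℝ} {f : E d → ℝ}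
  {γ R r M : ℝ}

lemma inner_gradient_left (v : E d → ℝ) (x w : E d) : inner ℝ (gradient v x) w = fderiv ℝ v x w :=
  InnerProductSpace.toDual_symm_apply

lemma L1_eq (v : E d → ℝ) (x : E d) : L1 f v x = fderiv ℝ v x (-gradient f x) := by
  rw [L1, real_inner_comm, inner_gradient_left, map_neg]

lemma L1_congr {v w : E d → ℝ} {x : E d} (hvw : v =ᶠ[𝓝 x] w) : L1 f v x = L1 f w x := by
  rw [L1_eq, L1_eq, hvw.fderiv_eq]

lemma L2_eq (v : E d → ℝ) (x : E d) : L2 P F f v x =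
    -(1 / 4) * fderiv ℝ v x (gradient (fun y => ‖gradient f y‖ ^ 2) x) +
      1 / 2 * ∑ i, ∑ j, covMatrix P F f x i j *
        fderiv ℝ (fderiv ℝ v) x (EuclideanSpace.single j 1) (EuclideanSpace.single i 1) := by
  rw [L2, real_inner_comm, inner_gradient_left]
  simp [Matrix.trace, Matrix.mul_apply, hessMatrix, iteratedFDeriv_two_apply]

lemma L2_congr {v w : E d → ℝ} {x : E d} (hvw : v =ᶠ[𝓝 x] w) : L2 P F f v x = L2 P F f w x := by
  rw [L2_eq, L2_eq, hvw.fderiv_eq, hvw.fderiv.fderiv_eq]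

lemma eventuallyEq_of_eqOn_ball {v w : E d → ℝ} {x : E d} (hx : x ∈ ball (0 : E d) r)
    (hvw : ∀ y ∈ ball (0 : E d) r, v y = w y) : v =ᶠ[𝓝 x] w :=
  eventually_of_mem (isOpen_ball.mem_nhds hx) hvw

/-- `Φ` is the flow of a globally defined vector field which agrees with `-∇f` on the ball of
radius `r`. -/
structure LocalFlow (f : E d → ℝ) (γ r : ℝ) (V : E d → E d) (Φ : ℝ → E d → E d) : Prop where
  contDiff_field : ContDiff ℝ 4 V
  eq_neg_gradient : ∀ x ∈ ball (0 : E d) r, V x = -gradient f x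
  lipschitz : ∃ C, LipschitzWith C V
  flow : IsFlow V Φ
  norm_le : ∀ x ∈ ball (0 : E d) r, ∀ t, 0 ≤ t → ‖Φ t x‖ ≤ Real.exp (-γ * t) * ‖x‖
  mem_ball : ∀ x ∈ ball (0 : E d) r, ∀ t, 0 ≤ t → Φ t x ∈ ball (0 : E d) r
  inner_fderiv_le : ∀ x ∈ ball (0 : E d) r, ∀ v, inner ℝ (fderiv ℝ V x v) v ≤ -γ * ‖v‖ ^ 2

lemma LocalFlow.contDiff {V : E d → E d} {Φ : ℝ → E d → E d} (h : LocalFlow f γ r V Φ) :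
    ContDiff ℝ 4 fun p : ℝ × E d => Φ p.1 p.2 := by
  obtain ⟨C, hC⟩ := h.lipschitz
  exact h.flow.contDiff (n := 4) (by norm_num) h.contDiff_field hC

namespace IsTransportSolution

variable {h h' : ℝ → E d → ℝ} {g g' : E d → ℝ} {u u' : ℝ → E d → ℝ}

lemma mono (hu : IsTransportSolution f R h g u) (hr : r ≤ R) : IsTransportSolution f r h g u where
  contDiffOn := hu.contDiffOn.mono (prod_mono_right (ball_subset_ball hr))
  contDiffOn_space t ht := (hu.contDiffOn_space t ht).mono (ball_subset_ball hr)
  initial x hx := hu.initial x (ball_subset_ball hr hx)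
  pde t ht x hx := hu.pde t ht x (ball_subset_ball hr hx)

lemma congr (hu : IsTransportSolution f r h g u)
    (huu : ∀ t, 0 ≤ t → ∀ x ∈ ball (0 : E d) r, u' t x = u t x)
    (hh : ∀ t, 0 ≤ t → ∀ x ∈ ball (0 : E d) r, h' t x = h t x) :
    IsTransportSolution f r h' g u' where
  contDiffOn := hu.contDiffOn.congr fun p hp => huu p.1 hp.1 p.2 hp.2
  contDiffOn_space t ht := (hu.contDiffOn_space t ht).congr (huu t ht)
  initial x hx := (huu 0 le_rfl x hx).trans (hu.initial x hx)
  pde t ht x hx := by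
    rw [L1_congr (eventuallyEq_of_eqOn_ball hx (huu t ht)), hh t ht x hx]
    exact (hu.pde t ht x hx).congr (fun s hs => huu s hs x hx) (huu t ht x hx)

lemma of_forall_lt (hu : ∀ r, 0 < r → r < R → IsTransportSolution f r h g u) :
    IsTransportSolution f R h g u := by
  have key : ∀ x ∈ ball (0 : E d) R, ∃ r, 0 < r ∧ r < R ∧ x ∈ ball (0 : E d) r := by
    intro x hx
    rw [mem_ball_zero_iff] at hx
    have := norm_nonneg x
    exact ⟨(‖x‖ + R) / 2, by linarith, by linarith, by rw [mem_ball_zero_iff]; linarith⟩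
  refine ⟨fun p hp => ?_, fun t ht x hx => ?_, fun x hx => ?_, fun t ht x hx => ?_⟩
  · obtain ⟨r, h0, h1, h2⟩ := key p.2 hp.2
    refine ((hu r h0 h1).contDiffOn p ⟨hp.1, h2⟩).mono_of_mem_nhdsWithin ?_
    have : (univ ×ˢ ball (0 : E d) r) ∈ 𝓝 p :=
      (isOpen_univ.prod isOpen_ball).mem_nhds ⟨mem_univ _, h2⟩
    exact mem_nhdsWithin.2 ⟨_, isOpen_univ.prod isOpen_ball, ⟨mem_univ _, h2⟩,
      fun q hq => ⟨hq.2.1, hq.1.2⟩⟩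
  · obtain ⟨r, h0, h1, h2⟩ := key x hx
    exact (((hu r h0 h1).contDiffOn_space t ht).contDiffAt
      (isOpen_ball.mem_nhds h2)).contDiffWithinAt
  · obtain ⟨r, h0, h1, h2⟩ := key x hx
    exact (hu r h0 h1).initial x h2
  · obtain ⟨r, h0, h1, h2⟩ := key x hx
    exact (hu r h0 h1).pde t ht x h2

/-- Along characteristics, a solution of the transport equation changes by the source. -/
lemma hasDerivWithinAt_characteristic (hu : IsTransportSolution f r h g u) {V : E d → E d}
    {Φ : ℝ → E d → E d} (hΦ : LocalFlow f γ r V Φ) {x : E d} (hx : x ∈ ball (0 : E d) r) {t s : ℝ}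
    (hs : s ∈ Icc 0 t) :
    HasDerivWithinAt (fun s => u (t - s) (Φ s x)) (-h (t - s) (Φ s x)) (Icc 0 t) s := by
  have hy := hΦ.mem_ball x hx s hs.1
  have hts : 0 ≤ t - s := sub_nonneg.2 hs.2
  have hm : (t - s, Φ s x) ∈ Ici (0 : ℝ) ×ˢ ball (0 : E d) r := ⟨hts, hy⟩
  obtain ⟨D, hd⟩ : ∃ D, HasFDerivWithinAt (fun p : ℝ × E d => u p.1 p.2) D (Ici 0 ×ˢ ball 0 r)
      (t - s, Φ s x) := (hu.contDiffOn _ hm).differentiableWithinAt one_ne_zero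
  have h1 : HasDerivWithinAt (fun s => (t - s, Φ s x)) ((-1 : ℝ), V (Φ s x)) (Icc 0 t) s :=
    ((hasDerivWithinAt_id s _).const_sub t).prodMk (hΦ.flow.deriv x s).hasDerivWithinAt
  have h2 := hd.comp_hasDerivWithinAt (f := fun s => (t - s, Φ s x)) s h1
    fun σ hσ => ⟨sub_nonneg.2 hσ.2, hΦ.mem_ball x hx σ hσ.1⟩
  refine h2.congr_deriv ?_
  clear h2 h1
  have hv := hΦ.eq_neg_gradient _ hy
  generalize Φ s x = y at *
  generalize t - s = τ at *
  -- The one-sided time derivative is identified by uniqueness of derivatives within the half-line;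
  -- this covers `τ = 0` too.
  have e1 : D (1, 0) = L1 f (u τ) y + h τ y := by
    have h1 : HasDerivWithinAt (fun τ => u τ y) (D (1, 0)) (Ici 0) τ :=
      hd.comp_hasDerivWithinAt (f := fun τ => (τ, y)) τ
        ((hasDerivWithinAt_id _ _).prodMk (hasDerivWithinAt_const _ _ y)) fun τ hτ => ⟨hτ, hy⟩
    exact (uniqueDiffOn_Ici (0 : ℝ) _ hts).eq_deriv _ h1 (hu.pde _ hts y hy)
  have e2 : fderiv ℝ (u τ) y = D ∘L ContinuousLinearMap.inr ℝ ℝ (E d) := by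
    have h1 : HasFDerivWithinAt (u τ) (D ∘L ContinuousLinearMap.inr ℝ ℝ (E d))
        (ball 0 r) y :=
      hd.comp (f := fun z => (τ, z)) y (hasFDerivAt_prodMk_right τ y).hasFDerivWithinAt
        fun z hz => ⟨hts, hz⟩
    exact (h1.hasFDerivAt (isOpen_ball.mem_nhds hy)).fderiv
  have e3 : ((-1 : ℝ), V y) =
      -((1 : ℝ), (0 : E d)) + (ContinuousLinearMap.inr ℝ ℝ (E d)) (V y) := by
    simp
  rw [e3, map_add, map_neg, e1, ← ContinuousLinearMap.comp_apply, ← e2, L1_eq, hv]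
  ring

/-- Uniqueness for the transport equation. -/
lemma unique (hu : IsTransportSolution f r h g u) (hu' : IsTransportSolution f r h' g u')
    {V : E d → E d} {Φ : ℝ → E d → E d} (hΦ : LocalFlow f γ r V Φ)
    (hh : ∀ t, 0 ≤ t → ∀ x ∈ ball (0 : E d) r, h t x = h' t x) {t : ℝ} (ht : 0 ≤ t) {x : E d}
    (hx : x ∈ ball (0 : E d) r) : u t x = u' t x := by
  have hd : ∀ s ∈ Icc (0 : ℝ) t, HasDerivWithinAt
      (fun s => u (t - s) (Φ s x) - u' (t - s) (Φ s x)) 0 (Icc 0 t) s := by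
    intro s hs
    refine ((hu.hasDerivWithinAt_characteristic hΦ hx hs).sub
      (hu'.hasDerivWithinAt_characteristic hΦ hx hs)).congr_deriv ?_
    rw [hh _ (sub_nonneg.2 hs.2) _ (hΦ.mem_ball x hx s hs.1), sub_self]
  have hc := constant_of_derivWithin_zero (fun s hs => (hd s hs).differentiableWithinAt)
    (fun s hs => (hd s (Ico_subset_Icc_self hs)).derivWithin
      (uniqueDiffOn_Icc (hs.1.trans_lt hs.2) _ (Ico_subset_Icc_self hs))) t (right_mem_Icc.2 ht)
  simp only [sub_self, sub_zero, hΦ.flow.zero] at hc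
  have hy := hΦ.mem_ball x hx t ht
  rw [hu.initial _ hy, hu'.initial _ hy, sub_self] at hc
  exact sub_eq_zero.1 hc.symm

end IsTransportSolution

namespace LocalFlow

variable {V : E d → E d} {Φ : ℝ → E d → E d} (hΦ : LocalFlow f γ r V Φ)
include hΦ

lemma isTransportSolution_comp {φ φ' : E d → ℝ} (hφ : ContDiff ℝ 4 φ)
    (hφ' : ∀ x ∈ ball (0 : E d) r, φ x = φ' x) :
    IsTransportSolution f r (fun _ _ => 0) φ' fun t x => φ (Φ t x) := by
  obtain ⟨C, hC⟩ := hΦ.lipschitz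
  have hcd : ContDiff ℝ 4 fun p : ℝ × E d => φ (Φ p.1 p.2) := hφ.comp hΦ.contDiff
  refine ⟨(hcd.of_le (by norm_num)).contDiffOn, fun t _ => ?_, fun x hx => ?_, fun t _ x hx => ?_⟩
  · exact ((hcd.comp (contDiff_const.prodMk contDiff_id)).of_le (by norm_num)).contDiffOn
  · rw [hΦ.flow.zero, hφ' x hx]
  · rw [L1_eq, ← hΦ.eq_neg_gradient x hx, add_zero]
    exact (hΦ.flow.hasDerivAt_comp hC (hφ.of_le (by norm_num))
      (hΦ.contDiff.of_le (by norm_num)) t x).hasDerivWithinAt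

lemma isTransportSolution_duhamel {G h : ℝ → E d → ℝ}
    (hG : ContDiff ℝ 2 fun p : ℝ × E d => G p.1 p.2)
    (hGh : ∀ t, 0 ≤ t → ∀ x ∈ ball (0 : E d) r, G t x = h t x) :
    IsTransportSolution f r h (fun _ => 0) (duhamel Φ G) := by
  obtain ⟨C, hC⟩ := hΦ.lipschitz
  have hcd : ContDiff ℝ 2 fun p : ℝ × E d => duhamel Φ G p.1 p.2 :=
    contDiff_duhamel (n := 2) hG (hΦ.contDiff.of_le (by norm_num))
  refine ⟨(hcd.of_le (by norm_num)).contDiffOn, fun t _ => ?_, fun x hx => ?_, fun t ht x hx => ?_⟩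
  · exact (hcd.comp (contDiff_const.prodMk contDiff_id)).contDiffOn
  · simp [duhamel]
  · rw [L1_eq, ← hΦ.eq_neg_gradient x hx, ← hGh t ht x hx]
    exact (hΦ.flow.hasDerivAt_duhamel hC (hG.of_le (by norm_num))
      (hΦ.contDiff.of_le (by norm_num)) t x).hasDerivWithinAt

end LocalFlow

/-- Outside the ball nothing is known of `g`, but the product vanishes beyond `χ.rOut`, so the two
regimes overlap. -/
lemma contDiff_bump_smul {Y : Type*} [NormedAddCommGroup Y] [NormedSpace ℝ Y] {n : ℕ}
    (χ : ContDiffBump (0 : E d)) (hχ : χ.rOut < R) {g : E d → Y}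
    (hg : ContDiffOn ℝ n g (ball 0 R)) :
    ContDiff ℝ n fun x => χ x • g x := by
  rw [contDiff_iff_contDiffAt]
  intro x
  by_cases hx : x ∈ ball (0 : E d) R
  · exact (χ.contDiff.contDiffAt).smul (hg.contDiffAt (isOpen_ball.mem_nhds hx))
  · have hx' : x ∉ closedBall (0 : E d) χ.rOut := by
      rw [mem_ball, not_lt] at hx
      rw [mem_closedBall, not_le]
      linarith
    refine (contDiffAt_const (c := (0 : Y))).congr_of_eventuallyEq ?_
    filter_upwards [isClosed_closedBall.isOpen_compl.mem_nhds hx'] with y hy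
    rw [mem_compl_iff, mem_closedBall, not_le] at hy
    rw [χ.zero_of_le_dist hy.le, zero_smul]

/-- A cut-off function. -/
lemma exists_bump {r R : ℝ} (hr : 0 < r) (hR : r < R) :
    ∃ χ : ContDiffBump (0 : E d), χ.rOut < R ∧ ∀ x ∈ ball (0 : E d) r, χ x = 1 :=
  ⟨⟨r, (r + R) / 2, hr, by linarith⟩, by dsimp only; linarith, fun x hx =>
    ContDiffBump.one_of_mem_closedBall _ (ball_subset_closedBall hx)⟩

end Transport

/-! ### The localized gradient flow and the source term. -/

namespace Model

variable {d : ℕ} {Ξ : Type*} [MeasurableSpace Ξ] {P : Measure Ξ} [IsProbabilityMeasure P]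
  {F : Ξ → E d → ℝ} {f : E d → ℝ} {γ R r M : ℝ} (h : Model P F f γ R M)
include h

theorem exists_localFlow (hr : 0 < r) (hR : r < R) : ∃ V Φ, LocalFlow f γ r V Φ := by
  obtain ⟨χ, hχ, hχ1⟩ := exists_bump (d := d) hr hR
  set V : E d → E d := fun x => χ x • (-gradient f x) with hV
  have hVc : ContDiff ℝ 6 V := contDiff_bump_smul (n := 6) χ hχ h.contDiffOn.neg
  have hcs : HasCompactSupport V := χ.hasCompactSupport.smul_right
  obtain ⟨C, hC⟩ := ContDiff.lipschitzWith_of_hasCompactSupport hcs hVc (by norm_num)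
  obtain ⟨B, hB⟩ := hcs.exists_bound_of_continuous hVc.continuous
  obtain ⟨Φ, hΦ⟩ := exists_isFlow hC hB
  have hVeq : ∀ x ∈ ball (0 : E d) r, V x = -gradient f x := fun x hx => by
    simp only [hV, hχ1 x hx, one_smul]
  have hγ := h.gamma_pos
  -- The cut-off keeps the field pointing inward everywhere. This first gives invariance of the
  -- smaller ball, where the field is exactly `-gradient f` and the decay rate `γ` becomes
  -- available.
  have hin : ∀ x, inner ℝ (V x) x ≤ 0 := by
    intro x
    by_cases hx : x ∈ ball (0 : E d) R
    · simp only [hV, inner_smul_left, inner_neg_left, conj_trivial, mul_neg]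
      have h1 := h.inner_ge hx
      have h2 : 0 ≤ inner ℝ (gradient f x) x := le_trans (by positivity) h1
      have h3 := mul_nonneg (χ.nonneg (x := x)) h2
      linarith
    · have : χ x = 0 := χ.zero_of_le_dist (by rw [mem_ball, not_lt] at hx; linarith)
      simp [hV, this]
  have hmem : ∀ x ∈ ball (0 : E d) r, ∀ t, 0 ≤ t → Φ t x ∈ ball (0 : E d) r := by
    intro x hx t ht
    have := norm_le_exp_of_inner_le (γ := 0) (fun s => hΦ.deriv x s)
      (fun s _ => by simpa using hin _) ht
    rw [mem_ball_zero_iff] at *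
    refine lt_of_le_of_lt ?_ hx
    simpa [hΦ.zero] using this
  refine ⟨V, Φ, hVc.of_le (by norm_num), hVeq, ⟨C, hC⟩, hΦ, fun x hx t ht => ?_, hmem,
    fun x hx v => ?_⟩
  · have := norm_le_exp_of_inner_le (γ := γ) (fun s => hΦ.deriv x s)
      (fun s hs => by
        have hm := hmem x hx s hs
        have := h.inner_ge (ball_subset_ball hR.le hm)
        rw [hVeq _ hm, inner_neg_left]
        linarith) ht
    simpa [hΦ.zero] using this
  · have hxR := ball_subset_ball hR.le hx
    have h0 : V =ᶠ[𝓝 x] fun y => -gradient f y :=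
      eventually_of_mem (isOpen_ball.mem_nhds hx) hVeq
    have h1 : fderiv ℝ V x = -fderiv ℝ (gradient f) x := by
      rw [h0.fderiv_eq, fderiv_fun_neg]
    have h2 := inner_fderiv_ge (V := gradient f) (γ := γ) (x := x)
      ((h.contDiffOn.contDiffAt (isOpen_ball.mem_nhds hxR)).differentiableAt (by norm_num))
      (eventually_of_mem (isOpen_ball.mem_nhds hxR) fun y hy => h.mono y hy x hxR) v
    rw [h1]
    simp only [neg_apply, inner_neg_left]
    linarith

lemma covMatrix_eq {x : E d} (hx : x ∈ ball (0 : E d) R) (i j : Fin d) :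
    covMatrix P F f x i j =
      (∫ ξ, inner ℝ (gradient (F ξ) x) (EuclideanSpace.single i 1) *
        inner ℝ (gradient (F ξ) x) (EuclideanSpace.single j 1) ∂P) -
      gradient f x i * gradient f x j := by
  have hc : ∀ i, ∫ ξ, gradient (F ξ) x i ∂P = gradient f x i := fun i =>
    h.integral_clm (EuclideanSpace.proj i : E d →L[ℝ] ℝ) hx
  have i1 : Integrable (fun ξ => gradient (F ξ) x i * gradient (F ξ) x j) P :=
    h.integrable_comp (k := fun g => g i * g j) (by fun_prop) hx
  have i2 : ∀ i, Integrable (fun ξ => gradient (F ξ) x i) P := fun i =>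
    h.integrable_comp (k := fun g => g i) (by fun_prop) hx
  have e : ∀ ξ, (gradient (F ξ) x - gradient f x) i * (gradient (F ξ) x - gradient f x) j =
      gradient (F ξ) x i * gradient (F ξ) x j - (gradient f x j * gradient (F ξ) x i +
        gradient f x i * gradient (F ξ) x j) + gradient f x i * gradient f x j := by
    intro ξ
    simp only [PiLp.sub_apply]
    ring
  simp only [covMatrix, Matrix.of_apply, e, EuclideanSpace.inner_single_right]
  have i3 : Integrable (fun ξ => gradient f x j * gradient (F ξ) x i +
      gradient f x i * gradient (F ξ) x j) P := ((i2 i).const_mul _).add ((i2 j).const_mul _)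
  have i4 : Integrable (fun ξ => gradient (F ξ) x i * gradient (F ξ) x j -
      (gradient f x j * gradient (F ξ) x i + gradient f x i * gradient (F ξ) x j)) P := i1.sub i3
  rw [integral_add i4 (integrable_const _), integral_sub i1 i3,
    integral_add ((i2 i).const_mul _) ((i2 j).const_mul _), integral_const_mul, integral_const_mul,
    hc, hc]
  simp
  ring

lemma contDiffOn_covMatrix (i j : Fin d) :
    ContDiffOn ℝ 2 (fun x => covMatrix P F f x i j) (ball 0 R) := by
  have hg : ∀ i, ContDiffOn ℝ 2 (fun x => gradient f x i) (ball 0 R) := fun i =>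
    (EuclideanSpace.proj i : E d →L[ℝ] ℝ).contDiff.comp_contDiffOn
      (h.contDiffOn.of_le (by norm_num))
  exact ((h.contDiffOn_cross _ _).sub ((hg i).mul (hg j))).congr fun x hx => h.covMatrix_eq hx i j

lemma contDiffOn_gradient_sq :
    ContDiffOn ℝ 2 (gradient fun y => ‖gradient f y‖ ^ 2) (ball 0 R) := by
  have h1 : ContDiffOn ℝ 6 (fun y => ‖gradient f y‖ ^ 2) (ball 0 R) := h.contDiffOn.norm_sq ℝ
  rw [gradient_eq_comp]
  exact (InnerProductSpace.toDual ℝ (E d)).symm.toContinuousLinearEquiv.contDiff.comp_contDiffOn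
    (h1.fderiv_of_isOpen isOpen_ball (by norm_num))

/-- The source `𝓛₂ u₀` extended from the ball of radius `r` to a `C²` function. -/
lemma exists_source (hr : 0 < r) (hR : r < R) {u : ℝ → E d → ℝ}
    (hu : ContDiff ℝ 4 fun p : ℝ × E d => u p.1 p.2) :
    ∃ G : ℝ → E d → ℝ, ContDiff ℝ 2 (fun p : ℝ × E d => G p.1 p.2) ∧
      ∀ t, ∀ x ∈ ball (0 : E d) r, G t x = L2 P F f (u t) x := by
  obtain ⟨χ, hχ, hχ1⟩ := exists_bump (d := d) hr hR
  have hc := contDiff_bump_smul (n := 2) χ hχ h.contDiffOn_gradient_sq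
  have hS := fun i j => contDiff_bump_smul (n := 2) χ hχ (h.contDiffOn_covMatrix i j)
  have h1 : ContDiff ℝ 3 fun p : ℝ × E d => fderiv ℝ (u p.1) p.2 :=
    contDiff_fderiv_slice (n := 3) (m := 4) (by norm_num) hu
  have h2 : ContDiff ℝ 2 fun p : ℝ × E d => fderiv ℝ (fderiv ℝ (u p.1)) p.2 :=
    contDiff_fderiv_slice (Ψ := fun t x => fderiv ℝ (u t) x) (n := 2) (m := 3) (by norm_num) h1
  refine ⟨fun t x => -(1 / 4) * fderiv ℝ (u t) x (χ x • gradient (fun y => ‖gradient f y‖ ^ 2) x) +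
      1 / 2 * ∑ i, ∑ j, (χ x • covMatrix P F f x i j) *
        fderiv ℝ (fderiv ℝ (u t)) x (EuclideanSpace.single j 1) (EuclideanSpace.single i 1),
    ?_, fun t x hx => ?_⟩
  · refine (contDiff_const.mul ((h1.of_le (by norm_num)).clm_apply (hc.comp contDiff_snd))).add
      (contDiff_const.mul (ContDiff.sum fun i _ => ContDiff.sum fun j _ =>
        ((hS i j).comp contDiff_snd).mul
          ((h2.clm_apply contDiff_const).clm_apply contDiff_const)))
  · simp only [hχ1 x hx, one_smul, L2_eq]

end Model

/-! ### Second derivatives of compositions. -/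

section SecondDerivative

variable {X Y Z : Type*} [NormedAddCommGroup X] [NormedSpace ℝ X] [NormedAddCommGroup Y]
  [NormedSpace ℝ Y] [NormedAddCommGroup Z] [NormedSpace ℝ Z]

lemma fderiv_fderiv_comp_apply {g : Y → Z} {k : X → Y} (hg : ContDiff ℝ 2 g) (hk : ContDiff ℝ 2 k)
    (x v w : X) : fderiv ℝ (fderiv ℝ fun y => g (k y)) x w v =
      fderiv ℝ (fderiv ℝ g) (k x) (fderiv ℝ k x w) (fderiv ℝ k x v) +
        fderiv ℝ g (k x) (fderiv ℝ (fderiv ℝ k) x w v) := by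
  have dg : Differentiable ℝ g := hg.differentiable (by norm_num)
  have dk : Differentiable ℝ k := hk.differentiable (by norm_num)
  have dg2 : Differentiable ℝ (fderiv ℝ g) :=
    (hg.fderiv_right (m := 1) (by norm_num)).differentiable one_ne_zero
  have dk2 : Differentiable ℝ (fderiv ℝ k) :=
    (hk.fderiv_right (m := 1) (by norm_num)).differentiable one_ne_zero
  have e1 : (fderiv ℝ fun y => g (k y)) = fun y => (fderiv ℝ g (k y)) ∘L (fderiv ℝ k y) :=
    funext fun y => fderiv_fun_comp y (dg _) (dk _)
  have e2 : fderiv ℝ (fun y => fderiv ℝ g (k y)) x = fderiv ℝ (fderiv ℝ g) (k x) ∘L fderiv ℝ k x :=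
    fderiv_fun_comp x (dg2 _) (dk _)
  rw [e1, fderiv_clm_comp (c := fun y => fderiv ℝ g (k y)) ((dg2 _).comp x (dk x)) (dk2 x), e2]
  simp [add_comm]

lemma norm_le_of_unit₂ {A : X →L[ℝ] Y →L[ℝ] Z} {C : ℝ} (hC : 0 ≤ C)
    (h : ∀ v w, ‖v‖ = 1 → ‖w‖ = 1 → ‖A v w‖ ≤ C) : ‖A‖ ≤ C :=
  ContinuousLinearMap.opNorm_le_of_unit_norm hC fun v hv =>
    ContinuousLinearMap.opNorm_le_of_unit_norm hC fun w hw => h v w hv hw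

end SecondDerivative

/-! ### Decay of the first and second variations of the flow. -/

namespace LocalFlow

variable {d : ℕ} {f : E d → ℝ} {γ r : ℝ} {V : E d → E d} {Φ : ℝ → E d → E d}
  (hΦ : LocalFlow f γ r V Φ)
include hΦ

lemma contDiff_slice (t : ℝ) : ContDiff ℝ 4 (Φ t) :=
  hΦ.contDiff.comp (contDiff_const.prodMk contDiff_id)

lemma hasDerivAt_fderiv (t : ℝ) (x : E d) :
    HasDerivAt (fun s => fderiv ℝ (Φ s) x) (fderiv ℝ (fun y => V (Φ t y)) x) t :=
  hasDerivAt_fderiv_swap (hΦ.contDiff.of_le (by norm_num)) (fun t x => hΦ.flow.deriv x t) t x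

lemma hasDerivAt_fderiv_fderiv (t : ℝ) (x : E d) :
    HasDerivAt (fun s => fderiv ℝ (fderiv ℝ (Φ s)) x)
      (fderiv ℝ (fderiv ℝ (fun y => V (Φ t y))) x) t :=
  hasDerivAt_fderiv_swap (Ψ := fun s x => fderiv ℝ (Φ s) x)
    (Ψ' := fun s x => fderiv ℝ (fun y => V (Φ s y)) x)
    (contDiff_fderiv_slice (n := 2) (m := 4) (by norm_num) hΦ.contDiff) hΦ.hasDerivAt_fderiv t x

/-- The space derivative solves the equation linearized along the orbit, and the derivative of the
field is at most `-γ` as a quadratic form there. -/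
lemma norm_fderiv_le {x : E d} (hx : x ∈ ball (0 : E d) r) {t : ℝ} (ht : 0 ≤ t) :
    ‖fderiv ℝ (Φ t) x‖ ≤ Real.exp (-γ * t) := by
  refine ContinuousLinearMap.opNorm_le_bound _ (Real.exp_pos _).le fun v => ?_
  have h0 : fderiv ℝ (Φ 0) x v = v := by
    have : Φ 0 = id := funext hΦ.flow.zero
    rw [this, fderiv_id]; rfl
  have hd : ∀ s, HasDerivAt (fun s => fderiv ℝ (Φ s) x v)
      (fderiv ℝ V (Φ s x) (fderiv ℝ (Φ s) x v)) s := by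
    intro s
    refine ((hΦ.hasDerivAt_fderiv s x).clm_apply (hasDerivAt_const s v)).congr_deriv ?_
    rw [fderiv_fun_comp x (hΦ.contDiff_field.differentiable (by norm_num) _)
      ((hΦ.contDiff_slice s).differentiable (by norm_num) _)]
    simp
  have := norm_le_exp_of_inner_le (γ := γ) hd
    (fun s hs => hΦ.inner_fderiv_le _ (hΦ.mem_ball x hx s hs) _) ht
  rwa [h0] at this

-- The second variation starts at `0` and solves the same linearized equation, forced by the second
-- derivative of `V` evaluated at two first variations. The forcing is of size $e^{-2\gamma t}$, as
-- `norm_le_exp_of_forced` requires.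
set_option maxSynthPendingDepth 5 in
lemma exists_norm_fderiv_fderiv_le (hγ : 0 < γ) : ∃ C, 0 ≤ C ∧ ∀ x ∈ ball (0 : E d) r,
    ∀ t, 0 ≤ t → ‖fderiv ℝ (fderiv ℝ (Φ t)) x‖ ≤ C * Real.exp (-γ * t) := by
  have hV2 : Continuous (fderiv ℝ (fderiv ℝ V)) :=
    ((hΦ.contDiff_field.fderiv_right (m := 3) (by norm_num)).fderiv_right (m := 2)
      (by norm_num)).continuous
  obtain ⟨B, hB⟩ : ∃ B, ∀ x ∈ ball (0 : E d) r, ‖fderiv ℝ (fderiv ℝ V) x‖ ≤ B :=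
    exists_bound_of_continuous hV2 r
  refine ⟨Real.exp (|B| / γ), (Real.exp_pos _).le, fun x hx t ht => ?_⟩
  refine norm_le_of_unit₂ (by positivity) fun w v hw hv => ?_
  have h0 : fderiv ℝ (fderiv ℝ (Φ 0)) x w v = 0 := by
    have : Φ 0 = id := funext hΦ.flow.zero
    have h1 : fderiv ℝ (Φ 0) = fun _ => ContinuousLinearMap.id ℝ (E d) := by
      rw [this]; funext y; exact fderiv_id
    rw [h1]; simp
  have hd : ∀ s, HasDerivAt (fun s => fderiv ℝ (fderiv ℝ (Φ s)) x w v)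
      (fderiv ℝ (fderiv ℝ V) (Φ s x) (fderiv ℝ (Φ s) x w) (fderiv ℝ (Φ s) x v) +
        fderiv ℝ V (Φ s x) (fderiv ℝ (fderiv ℝ (Φ s)) x w v)) s := by
    intro s
    refine (((hΦ.hasDerivAt_fderiv_fderiv s x).clm_apply (hasDerivAt_const s w)).clm_apply
      (hasDerivAt_const s v)).congr_deriv ?_
    rw [← fderiv_fderiv_comp_apply (hΦ.contDiff_field.of_le (by norm_num))
      ((hΦ.contDiff_slice s).of_le (by norm_num))]
    simp
  refine norm_le_exp_of_forced hγ (abs_nonneg B) hd h0 (fun s hs => ?_) ht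
  have hm := hΦ.mem_ball x hx s hs
  rw [inner_add_left]
  have h1 := hΦ.inner_fderiv_le _ hm (fderiv ℝ (fderiv ℝ (Φ s)) x w v)
  have hY : ∀ v : E d, ‖v‖ = 1 → ‖fderiv ℝ (Φ s) x v‖ ≤ Real.exp (-γ * s) := fun v hv => by
    have := (fderiv ℝ (Φ s) x).le_of_opNorm_le (hΦ.norm_fderiv_le hx hs) v
    rwa [hv, mul_one] at this
  have h2 : ‖fderiv ℝ (fderiv ℝ V) (Φ s x) (fderiv ℝ (Φ s) x w) (fderiv ℝ (Φ s) x v)‖ ≤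
      |B| * Real.exp (-(2 * γ) * s) := by
    refine (ContinuousLinearMap.le_opNorm₂ _ _ _).trans ?_
    have e : Real.exp (-(2 * γ) * s) = Real.exp (-γ * s) * Real.exp (-γ * s) := by
      rw [← Real.exp_add]; ring_nf
    rw [e, ← mul_assoc]
    have := (hB _ hm).trans (le_abs_self B)
    have := hY v hv
    have := hY w hw
    gcongr
  have h3 := (real_inner_le_norm (fderiv ℝ (fderiv ℝ V) (Φ s x) (fderiv ℝ (Φ s) x w)
    (fderiv ℝ (Φ s) x v)) (fderiv ℝ (fderiv ℝ (Φ s)) x w v)).trans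
    (mul_le_mul_of_nonneg_right h2 (norm_nonneg _))
  linarith

lemma exists_jet_decay (hγ : 0 < γ) {φ : E d → ℝ} (hφ : ContDiff ℝ 4 φ) :
    ∃ C, 0 ≤ C ∧ ∀ x ∈ ball (0 : E d) r, ∀ t, 0 ≤ t →
      ‖fderiv ℝ (fun y => φ (Φ t y)) x‖ ≤ C * Real.exp (-γ * t) ∧
      ‖fderiv ℝ (fderiv ℝ fun y => φ (Φ t y)) x‖ ≤ C * Real.exp (-γ * t) := by
  have c1 : ContDiff ℝ 3 (fderiv ℝ φ) := hφ.fderiv_right (by norm_num)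
  obtain ⟨B₁, hB₁⟩ := exists_bound_of_continuous c1.continuous r
  obtain ⟨B₂, hB₂⟩ := exists_bound_of_continuous
    (c1.fderiv_right (m := 2) (by norm_num)).continuous r
  obtain ⟨K, hK0, hK⟩ := hΦ.exists_norm_fderiv_fderiv_le hγ
  refine ⟨|B₁| + (|B₂| + |B₁| * K), by positivity, fun x hx t ht => ?_⟩
  have hm := hΦ.mem_ball x hx t ht
  have b1 := (hB₁ _ hm).trans (le_abs_self B₁)
  have b2 := (hB₂ _ hm).trans (le_abs_self B₂)
  have y1 := hΦ.norm_fderiv_le hx ht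
  have y2 := hK x hx t ht
  set e := Real.exp (-γ * t)
  have he : 0 < e := Real.exp_pos _
  have he1 : e ≤ 1 := Real.exp_le_one_iff.2 (by nlinarith)
  have k0 : 0 ≤ |B₂| * e := by positivity
  have k1 : 0 ≤ |B₁| * K * e := by positivity
  have k2 : 0 ≤ |B₁| * e := by positivity
  constructor
  · rw [fderiv_fun_comp x (hφ.differentiable (by norm_num) _)
      ((hΦ.contDiff_slice t).differentiable (by norm_num) _)]
    refine (ContinuousLinearMap.opNorm_comp_le _ _).trans ?_
    have := mul_le_mul b1 y1 (norm_nonneg _) (abs_nonneg B₁)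
    linarith
  · refine norm_le_of_unit₂ (by positivity) fun w v hw hv => ?_
    rw [fderiv_fderiv_comp_apply (hφ.of_le (by norm_num))
      ((hΦ.contDiff_slice t).of_le (by norm_num))]
    have hY : ∀ v : E d, ‖v‖ = 1 → ‖fderiv ℝ (Φ t) x v‖ ≤ e := fun v hv => by
      have := (fderiv ℝ (Φ t) x).le_of_opNorm_le y1 v
      rwa [hv, mul_one] at this
    have z1 : ‖fderiv ℝ (fderiv ℝ φ) (Φ t x) (fderiv ℝ (Φ t) x w) (fderiv ℝ (Φ t) x v)‖ ≤
        |B₂| * e := by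
      refine (ContinuousLinearMap.le_opNorm₂ _ _ _).trans ?_
      have h1 := mul_le_mul b2 (hY w hw) (norm_nonneg _) (abs_nonneg _)
      have h2 := mul_le_mul h1 ((hY v hv).trans he1) (norm_nonneg _) k0
      linarith
    have z2 : ‖fderiv ℝ φ (Φ t x) (fderiv ℝ (fderiv ℝ (Φ t)) x w v)‖ ≤ |B₁| * K * e := by
      have h0 : ‖fderiv ℝ (fderiv ℝ (Φ t)) x w v‖ ≤ K * e := by
        have := (ContinuousLinearMap.le_opNorm₂ (fderiv ℝ (fderiv ℝ (Φ t)) x) w v)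
        rw [hw, hv, mul_one, mul_one] at this
        exact this.trans y2
      have h1 := (fderiv ℝ φ (Φ t x)).le_opNorm (fderiv ℝ (fderiv ℝ (Φ t)) x w v)
      have h2 := mul_le_mul b1 h0 (norm_nonneg _) (abs_nonneg _)
      linarith
    have := norm_add_le (fderiv ℝ (fderiv ℝ φ) (Φ t x) (fderiv ℝ (Φ t) x w) (fderiv ℝ (Φ t) x v))
      (fderiv ℝ φ (Φ t x) (fderiv ℝ (fderiv ℝ (Φ t)) x w v))
    linarith

end LocalFlow

/-! ### Exponentially decaying integrands on the half-line. -/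

section ImproperIntegral

variable {Y : Type*} [NormedAddCommGroup Y] [NormedSpace ℝ Y]

lemma integrableOn_of_exp_decay {a : ℝ → Y} (ha : Continuous a) {γ C : ℝ} (hγ : 0 < γ)
    (hb : ∀ t, 0 ≤ t → ‖a t‖ ≤ C * Real.exp (-γ * t)) : IntegrableOn a (Ioi 0) := by
  refine Integrable.mono' ((exp_neg_integrableOn_Ioi 0 hγ).const_mul C) ha.aestronglyMeasurable ?_
  filter_upwards [self_mem_ae_restrict (measurableSet_Ioi (a := (0 : ℝ)))] with t ht
    using hb t (le_of_lt ht)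

lemma tendsto_zero_of_exp_decay {a : ℝ → Y} {γ C : ℝ} (hγ : 0 < γ)
    (hb : ∀ t, 0 ≤ t → ‖a t‖ ≤ C * Real.exp (-γ * t)) : Tendsto a atTop (𝓝 0) := by
  have h1 : Tendsto (fun t => C * Real.exp (-γ * t)) atTop (𝓝 0) := by
    have := (Real.tendsto_exp_atBot.comp
      (tendsto_id.const_mul_atTop_of_neg (neg_neg_of_pos hγ))).const_mul C
    simpa using this
  exact squeeze_zero_norm' ((eventually_ge_atTop 0).mono hb) h1

lemma integral_deriv_of_exp_decay [CompleteSpace Y] {a a' : ℝ → Y} {γ C : ℝ} (hγ : 0 < γ)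
    (hd : ∀ t, HasDerivAt a (a' t) t) (hi : IntegrableOn a' (Ioi 0))
    (hb : ∀ t, 0 ≤ t → ‖a t‖ ≤ C * Real.exp (-γ * t)) : ∫ t in Ioi (0 : ℝ), a' t = -a 0 := by
  rw [integral_Ioi_of_hasDerivAt_of_tendsto (hd 0).continuousAt.continuousWithinAt
    (fun t _ => hd t) hi (tendsto_zero_of_exp_decay hγ hb), zero_sub]

end ImproperIntegral

/-! ### The two-jet of the solution of the Poisson equation. -/

section Jets

variable {d : ℕ} {f : E d → ℝ} {γ r : ℝ} {V : E d → E d} {Φ : ℝ → E d → E d}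

set_option maxSynthPendingDepth 5 in
/-- The time integrals `α`, `β` of the first two derivatives at `0` of `φ ∘ Φ_t` provide a quadratic
function whose image under the generator `∇f · ∇` has the two-jet of `φ`. -/
lemma LocalFlow.exists_jet (hΦ : LocalFlow f γ r V Φ) (hγ : 0 < γ) (hr : 0 < r)
    (h0 : gradient f 0 = 0) {φ φ' : E d → ℝ} (hφ : ContDiff ℝ 4 φ)
    (hφ' : ∀ x ∈ ball (0 : E d) r, φ' x = φ x) :
    ∃ (α : E d →L[ℝ] ℝ) (β : E d →L[ℝ] E d →L[ℝ] ℝ) (ψ : E d → ℝ),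
      (ψ = fun x => α (gradient f x) + (β x (gradient f x) + β (gradient f x) x) / 2) ∧
      fderiv ℝ (fun x => φ' x - ψ x) 0 = 0 ∧
      (∀ v, fderiv ℝ (fderiv ℝ fun x => φ' x - ψ x) 0 v v = 0) ∧
      ∀ v w, IntegrableOn (fun t => fderiv ℝ (fderiv ℝ fun y => φ (Φ t y)) 0 v w) (Ioi 0) ∧
        ∫ t in Ioi (0 : ℝ), fderiv ℝ (fderiv ℝ fun y => φ (Φ t y)) 0 v w = β v w := by
  have hz : (0 : E d) ∈ ball (0 : E d) r := mem_ball_self hr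
  obtain ⟨L, hL⟩ := hΦ.lipschitz
  set u : ℝ → E d → ℝ := fun t y => φ (Φ t y) with hu
  have hV0 : V 0 = 0 := by rw [hΦ.eq_neg_gradient 0 hz, h0, neg_zero]
  have c0 : ContDiff ℝ 4 fun p : ℝ × E d => u p.1 p.2 := hφ.comp hΦ.contDiff
  have c1 : ContDiff ℝ 3 fun p : ℝ × E d => fderiv ℝ (u p.1) p.2 :=
    contDiff_fderiv_slice (n := 3) (m := 4) (by norm_num) c0
  have c2 : ContDiff ℝ 2 fun p : ℝ × E d => fderiv ℝ (fderiv ℝ (u p.1)) p.2 :=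
    contDiff_fderiv_slice (Ψ := fun t x => fderiv ℝ (u t) x) (n := 2) (m := 3) (by norm_num) c1
  have s0 : ∀ t, ContDiff ℝ 4 (u t) := fun t => c0.comp (contDiff_const.prodMk contDiff_id)
  have s1 : ∀ t, ContDiff ℝ 3 (fderiv ℝ (u t)) := fun t => (s0 t).fderiv_right (by norm_num)
  have hp : ∀ t x, HasDerivAt (fun s => u s x) (fderiv ℝ (u t) x (V x)) t := fun t x =>
    hΦ.flow.hasDerivAt_comp hL (hφ.of_le (by norm_num)) (hΦ.contDiff.of_le (by norm_num)) t x
  have hp1 : ∀ t x, HasDerivAt (fun s => fderiv ℝ (u s) x)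
      (fderiv ℝ (fun y => fderiv ℝ (u t) y (V y)) x) t :=
    hasDerivAt_fderiv_swap (c0.of_le (by norm_num)) hp
  have hp2 : ∀ t x, HasDerivAt (fun s => fderiv ℝ (fderiv ℝ (u s)) x)
      (fderiv ℝ (fderiv ℝ fun y => fderiv ℝ (u t) y (V y)) x) t :=
    hasDerivAt_fderiv_swap (Ψ := fun s x => fderiv ℝ (u s) x)
      (Ψ' := fun s x => fderiv ℝ (fun y => fderiv ℝ (u s) y (V y)) x) (c1.of_le (by norm_num)) hp1
  obtain ⟨C, hC0, hC⟩ := hΦ.exists_jet_decay hγ hφ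
  have dV : Differentiable ℝ V := hΦ.contDiff_field.differentiable (by norm_num)
  have ca : Continuous fun t => fderiv ℝ (u t) 0 :=
    c1.continuous.comp (continuous_id.prodMk continuous_const)
  have cb : Continuous fun t => fderiv ℝ (fderiv ℝ (u t)) 0 :=
    c2.continuous.comp (continuous_id.prodMk continuous_const)
  have ia : IntegrableOn (fun t => fderiv ℝ (u t) 0) (Ioi 0) :=
    integrableOn_of_exp_decay ca hγ fun t ht => (hC 0 hz t ht).1
  have ib : IntegrableOn (fun t => fderiv ℝ (fderiv ℝ (u t)) 0) (Ioi 0) :=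
    integrableOn_of_exp_decay cb hγ fun t ht => (hC 0 hz t ht).2
  set α := ∫ t in Ioi (0 : ℝ), fderiv ℝ (u t) 0 with hα
  set β := ∫ t in Ioi (0 : ℝ), fderiv ℝ (fderiv ℝ (u t)) 0 with hβ
  have ia' : ∀ v, IntegrableOn (fun t => fderiv ℝ (u t) 0 v) (Ioi 0) := fun v =>
    ia.apply_continuousLinearMap v
  have ib' : ∀ v, IntegrableOn (fun t => fderiv ℝ (fderiv ℝ (u t)) 0 v) (Ioi 0) := fun v =>
    ib.apply_continuousLinearMap v
  have ib2 : ∀ v w, IntegrableOn (fun t => fderiv ℝ (fderiv ℝ (u t)) 0 v w) (Ioi 0) := fun v w =>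
    (ib' v).apply_continuousLinearMap w
  have hαv : ∀ v, ∫ t in Ioi (0 : ℝ), fderiv ℝ (u t) 0 v = α v := fun v =>
    (ContinuousLinearMap.integral_apply ia v).symm
  have hβv : ∀ v w, ∫ t in Ioi (0 : ℝ), fderiv ℝ (fderiv ℝ (u t)) 0 v w = β v w := fun v w => by
    rw [hβ, ContinuousLinearMap.integral_apply ib v, ContinuousLinearMap.integral_apply (ib' v) w]
  have hβs : ∀ v w, β v w = β w v := fun v w => by
    rw [← hβv, ← hβv]
    refine integral_congr_ae (Eventually.of_forall fun t => ?_)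
    exact ((s0 t).contDiffAt.isSymmSndFDerivAt (by simp; norm_num)) v w
  have hu0 : u 0 = φ := by funext y; simp [hu, hΦ.flow.zero]
  -- the two linear relations between the jets
  have r1 : ∀ v, α (fderiv ℝ V 0 v) = -fderiv ℝ φ 0 v := by
    intro v
    have hd : ∀ t, HasDerivAt (fun s => fderiv ℝ (u s) 0 v)
        (fderiv ℝ (u t) 0 (fderiv ℝ V 0 v)) t := by
      intro t
      refine ((hp1 t 0).clm_apply (hasDerivAt_const t v)).congr_deriv ?_
      rw [fderiv_clm_apply ((s1 t).differentiable (by norm_num) _) (dV _)]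
      simp [hV0]
    have := integral_deriv_of_exp_decay (C := C * ‖v‖) hγ hd (ia' _) fun t ht => by
      refine ((fderiv ℝ (u t) 0).le_of_opNorm_le (hC 0 hz t ht).1 v).trans (le_of_eq (by ring))
    rw [hαv, hu0] at this
    exact this
  have r2 : ∀ v, 2 * β v (fderiv ℝ V 0 v) + α (fderiv ℝ (fderiv ℝ V) 0 v v) =
      -fderiv ℝ (fderiv ℝ φ) 0 v v := by
    intro v
    have hd : ∀ t, HasDerivAt (fun s => fderiv ℝ (fderiv ℝ (u s)) 0 v v)
        (2 * fderiv ℝ (fderiv ℝ (u t)) 0 v (fderiv ℝ V 0 v) +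
          fderiv ℝ (u t) 0 (fderiv ℝ (fderiv ℝ V) 0 v v)) t := by
      intro t
      refine (((hp2 t 0).clm_apply (hasDerivAt_const t v)).clm_apply
        (hasDerivAt_const t v)).congr_deriv ?_
      have := fderiv_fderiv_clm_apply_self (c := fderiv ℝ (u t)) (y := V) (x := 0)
        ((s1 t).of_le (by norm_num)).contDiffAt
        (hΦ.contDiff_field.of_le (by norm_num)).contDiffAt hV0 v
      simp [this]
    have := integral_deriv_of_exp_decay (C := C * ‖v‖ * ‖v‖) hγ hd
      (((ib2 _ _).const_mul 2).add (ia' _)) fun t ht => by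
        refine (ContinuousLinearMap.le_opNorm₂ _ v v).trans ?_
        have := mul_le_mul_of_nonneg_right (hC 0 hz t ht).2 (by positivity : 0 ≤ ‖v‖ * ‖v‖)
        linarith
    rw [integral_add ((ib2 _ _).const_mul 2) (ia' _), integral_const_mul, hαv, hβv, hu0] at this
    exact this
  -- The derivative of the quadratic function `α x + β x x / 2`.
  set c : E d → E d →L[ℝ] ℝ := fun x => α + (2⁻¹ : ℝ) • (β x + β.flip x) with hc
  have hcc : ContDiff ℝ 2 c := by
    refine contDiff_const.add (ContDiff.const_smul _ (β.contDiff.add β.flip.contDiff))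
  have hcd : ∀ v, fderiv ℝ c 0 v = β v := by
    intro v
    have : HasFDerivAt c ((2⁻¹ : ℝ) • (β + β.flip)) 0 :=
      ((β.hasFDerivAt.add β.flip.hasFDerivAt).const_smul (2⁻¹ : ℝ)).const_add α
    rw [this.fderiv]
    ext w
    simp [hβs w v]
    ring
  have hc0 : c 0 = α := by simp [hc]
  set ψ : E d → ℝ := fun x => α (gradient f x) + (β x (gradient f x) + β (gradient f x) x) / 2
    with hψ
  have hkey : (fun x => φ' x - ψ x) =ᶠ[𝓝 0] fun x => φ x + c x (V x) := by
    filter_upwards [isOpen_ball.mem_nhds hz] with x hx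
    rw [hφ' x hx, hΦ.eq_neg_gradient x hx]
    simp [hψ, hc]
    ring
  have hk2 : ContDiff ℝ 2 fun x => c x (V x) :=
    hcc.clm_apply (hΦ.contDiff_field.of_le (by norm_num))
  have dφ : Differentiable ℝ φ := hφ.differentiable (by norm_num)
  have dk : Differentiable ℝ fun x => c x (V x) := hk2.differentiable (by norm_num)
  refine ⟨α, β, ψ, rfl, ?_, fun v => ?_, fun v w => ⟨ib2 v w, hβv v w⟩⟩
  · rw [hkey.fderiv_eq, fderiv_fun_add (dφ _) (dk _),
      fderiv_clm_apply (hcc.differentiable (by norm_num) _) (dV _)]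
    ext v
    simp [hV0, hc0, r1]
  · have e : (fderiv ℝ fun x => φ x + c x (V x)) =
        fun x => fderiv ℝ φ x + fderiv ℝ (fun x => c x (V x)) x :=
      funext fun x => fderiv_fun_add (dφ _) (dk _)
    rw [hkey.fderiv.fderiv_eq, e, fderiv_fun_add
      ((hφ.fderiv_right (m := 3) (by norm_num)).differentiable (by norm_num) _)
      ((hk2.fderiv_right (m := 1) (by norm_num)).differentiable (by norm_num) _)]
    have := fderiv_fderiv_clm_apply_self (c := c) (y := V) (x := 0) hcc.contDiffAt
      (hΦ.contDiff_field.of_le (by norm_num)).contDiffAt hV0 v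
    rw [_root_.add_apply, _root_.add_apply, this, hcd, hc0]
    have := r2 v
    simp only [nsmul_eq_mul, Nat.cast_ofNat]
    linarith

end Jets

/-! ### Long-time limit of the Duhamel integral. -/

section Limit

variable {d : ℕ} {f : E d → ℝ} {γ r : ℝ} {V : E d → E d} {Φ : ℝ → E d → E d}

/-- A source which decays exponentially on the ball produces a convergent Duhamel integral. -/
lemma LocalFlow.tendsto_duhamel (hΦ : LocalFlow f γ r V Φ) (hγ : 0 < γ) {G : ℝ → E d → ℝ}
    (hG : Continuous fun p : ℝ × E d => G p.1 p.2) {C : ℝ}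
    (hC : ∀ t, 0 ≤ t → ∀ x ∈ ball (0 : E d) r, ‖G t x‖ ≤ C * Real.exp (-γ * t))
    {x : E d} (hx : x ∈ ball (0 : E d) r) :
    Tendsto (fun t => duhamel Φ G t x) atTop (𝓝 (∫ s in Ioi (0 : ℝ), G s 0)) := by
  have hΦc : Continuous fun t => Φ t x := hΦ.flow.continuous_left x
  have hΦ0 : Tendsto (fun t => Φ t x) atTop (𝓝 0) :=
    tendsto_zero_of_exp_decay (C := ‖x‖) hγ fun t ht =>
      (hΦ.norm_le x hx t ht).trans (le_of_eq (mul_comm _ _))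
  -- After time reversal the source is taken at time `s` and at the point `Φ (t - s) x`, which tends
  -- to `0` for fixed `s`. Dominated convergence then removes the dependence on `x`.
  have e : ∀ t, 0 ≤ t → ∫ s in Ioi (0 : ℝ), (Iic t).indicator (fun s => G s (Φ (t - s) x)) s =
      duhamel Φ G t x := by
    intro t ht
    rw [duhamel_eq]
    have h1 := intervalIntegral.integral_comp_sub_left (a := 0) (b := t)
      (fun s => G s (Φ (t - s) x)) t
    simp only [sub_sub_cancel, sub_zero, sub_self] at h1
    rw [h1, intervalIntegral.integral_of_le ht, setIntegral_indicator measurableSet_Iic,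
      Ioi_inter_Iic]
  have hlim : Tendsto (fun t => ∫ s in Ioi (0 : ℝ),
      (Iic t).indicator (fun s => G s (Φ (t - s) x)) s) atTop (𝓝 (∫ s in Ioi (0 : ℝ), G s 0)) := by
    refine tendsto_integral_filter_of_dominated_convergence (fun s => |C| * Real.exp (-γ * s))
      (Eventually.of_forall fun t => ?_) (Eventually.of_forall fun t => ?_)
      ((exp_neg_integrableOn_Ioi 0 hγ).const_mul |C|) (Eventually.of_forall fun s => ?_)
    · exact ((hG.comp (continuous_id.prodMk (hΦc.comp (continuous_const.sub continuous_id))))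
        |>.aestronglyMeasurable).indicator measurableSet_Iic
    · filter_upwards [self_mem_ae_restrict (measurableSet_Ioi (a := (0 : ℝ)))] with s hs
      by_cases hst : s ∈ Iic t
      · rw [indicator_of_mem hst]
        refine (hC s (le_of_lt hs) _ (hΦ.mem_ball x hx _ (sub_nonneg.2 hst))).trans ?_
        exact mul_le_mul_of_nonneg_right (le_abs_self C) (Real.exp_pos _).le
      · rw [indicator_of_notMem hst, norm_zero]
        positivity
    · have h1 : Tendsto (fun t => G s (Φ (t - s) x)) atTop (𝓝 (G s 0)) := by
        have h2 : Tendsto (fun t => Φ (t - s) x) atTop (𝓝 0) :=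
          hΦ0.comp (tendsto_atTop_add_const_right _ (-s) tendsto_id)
        exact ((hG.comp (continuous_const.prodMk continuous_id)).tendsto 0).comp h2
      refine h1.congr' ?_
      filter_upwards [eventually_ge_atTop s] with t ht
      rw [indicator_of_mem (mem_Iic.2 ht)]
  exact hlim.congr' ((eventually_ge_atTop 0).mono e)

end Limit

/-! ### The operator `L2` at the origin and its bounds. -/

namespace Model

variable {d : ℕ} {Ξ : Type*} [MeasurableSpace Ξ] {P : Measure Ξ} [IsProbabilityMeasure P]
  {F : Ξ → E d → ℝ} {f : E d → ℝ} {γ R r M : ℝ} (h : Model P F f γ R M)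
include h

lemma exists_bound_on_ball (hR : r < R) {Y : Type*} [NormedAddCommGroup Y] {q : E d → Y}
    (hq : ContinuousOn q (ball 0 R)) : ∃ B, 0 ≤ B ∧ ∀ x ∈ ball (0 : E d) r, ‖q x‖ ≤ B := by
  obtain ⟨B, hB⟩ := (isCompact_closedBall (0 : E d) r).exists_bound_of_continuousOn
    (hq.mono (closedBall_subset_ball hR))
  exact ⟨|B|, abs_nonneg B, fun x hx => (hB x (ball_subset_closedBall hx)).trans (le_abs_self B)⟩

/-- Transfers the decay of the first two derivatives of `u₀` to the source `L2 P F f (u₀ t)`; the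
coefficients are bounded on the smaller ball by compactness. -/
lemma exists_L2_le (hR : r < R) : ∃ K, 0 ≤ K ∧ ∀ x ∈ ball (0 : E d) r, ∀ (v : E d → ℝ) (ε : ℝ),
    ‖fderiv ℝ v x‖ ≤ ε → ‖fderiv ℝ (fderiv ℝ v) x‖ ≤ ε → ‖L2 P F f v x‖ ≤ K * ε := by
  obtain ⟨A, hA0, hA⟩ := h.exists_bound_on_ball hR h.contDiffOn_gradient_sq.continuousOn
  choose B hB0 hB using fun i j =>
    h.exists_bound_on_ball hR (h.contDiffOn_covMatrix i j).continuousOn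
  refine ⟨1 / 4 * A + 1 / 2 * ∑ i, ∑ j, B i j, add_nonneg (by positivity)
    (mul_nonneg (by norm_num) (Finset.sum_nonneg fun i _ => Finset.sum_nonneg fun j _ => hB0 i j)),
    fun x hx v ε h1 h2 => ?_⟩
  have hε : 0 ≤ ε := (norm_nonneg _).trans h1
  rw [L2_eq, add_mul]
  refine (norm_add_le _ _).trans (add_le_add ?_ ?_)
  · rw [norm_mul, norm_neg, Real.norm_of_nonneg (by norm_num : (0 : ℝ) ≤ 1 / 4), mul_assoc]
    refine mul_le_mul_of_nonneg_left ?_ (by norm_num)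
    rw [mul_comm A]
    exact (ContinuousLinearMap.le_opNorm _ _).trans
      (mul_le_mul h1 (hA x hx) (norm_nonneg _) hε)
  · rw [norm_mul, Real.norm_of_nonneg (by norm_num : (0 : ℝ) ≤ 1 / 2), mul_assoc, Finset.sum_mul]
    refine mul_le_mul_of_nonneg_left ((norm_sum_le _ _).trans (Finset.sum_le_sum fun i _ => ?_))
      (by norm_num)
    rw [Finset.sum_mul]
    refine (norm_sum_le _ _).trans (Finset.sum_le_sum fun j _ => ?_)
    rw [norm_mul]
    refine mul_le_mul (hB i j x hx) ?_ (norm_nonneg _) (hB0 i j)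
    have := ContinuousLinearMap.le_opNorm₂ (fderiv ℝ (fderiv ℝ v) x)
      (EuclideanSpace.single j (1 : ℝ)) (EuclideanSpace.single i (1 : ℝ))
    simp only [PiLp.norm_single, norm_one, mul_one] at this
    exact this.trans h2

lemma gradient_sq_zero : gradient (fun y => ‖gradient f y‖ ^ 2) 0 = 0 := by
  have : IsLocalMin (fun y => ‖gradient f y‖ ^ 2) 0 := Eventually.of_forall fun y => by
    simpa only [h.gradient_zero, norm_zero, ne_eq, OfNat.ofNat_ne_zero, not_false_eq_true,
      zero_pow] using sq_nonneg ‖gradient f y‖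
  rw [gradient, this.fderiv_eq_zero, map_zero]

lemma L2_zero (v : E d → ℝ) : L2 P F f v 0 = 1 / 2 * ∑ i, ∑ j,
    (∫ ξ, inner ℝ (gradient (F ξ) 0) (EuclideanSpace.single i 1) *
      inner ℝ (gradient (F ξ) 0) (EuclideanSpace.single j 1) ∂P) *
      fderiv ℝ (fderiv ℝ v) 0 (EuclideanSpace.single j 1) (EuclideanSpace.single i 1) := by
  rw [L2_eq, h.gradient_sq_zero, map_zero, mul_zero, zero_add]
  simp_rw [h.covMatrix_eq h.zero_mem, h.gradient_zero]
  simp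

/-- The first order coefficient of the stationary expansion, as a time integral. -/
lemma integral_L2_zero {w : ℝ → E d → ℝ} {β : E d →L[ℝ] E d →L[ℝ] ℝ}
    (hw : ∀ v v', IntegrableOn (fun t => fderiv ℝ (fderiv ℝ (w t)) 0 v v') (Ioi 0) ∧
      ∫ t in Ioi (0 : ℝ), fderiv ℝ (fderiv ℝ (w t)) 0 v v' = β v v') :
    IntegrableOn (fun t => L2 P F f (w t) 0) (Ioi 0) ∧
      ∫ t in Ioi (0 : ℝ), L2 P F f (w t) 0 =
        (∫ ξ, β (gradient (F ξ) 0) (gradient (F ξ) 0) ∂P) / 2 := by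
  simp_rw [h.L2_zero]
  have i1 : ∀ i j : Fin d, IntegrableOn (fun t =>
      (∫ ξ, inner ℝ (gradient (F ξ) 0) (EuclideanSpace.single i 1) *
      inner ℝ (gradient (F ξ) 0) (EuclideanSpace.single j 1) ∂P) *
      fderiv ℝ (fderiv ℝ (w t)) 0 (EuclideanSpace.single j 1) (EuclideanSpace.single i 1))
      (Ioi 0) := fun i j => (hw _ _).1.const_mul _
  refine ⟨(integrable_finsetSum _ fun i _ => integrable_finsetSum _ fun j _ => i1 i j).const_mul _,
    ?_⟩
  rw [integral_const_mul, integral_finsetSum _ fun i _ => integrable_finsetSum _ fun j _ => i1 i j,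
    h.integral_bilin_eq β h.zero_mem, Finset.sum_comm]
  simp_rw [integral_finsetSum _ fun j _ => i1 _ j, integral_const_mul, (hw _ _).2]
  rw [one_div_mul_eq_div]
  congr 1
  refine Finset.sum_congr rfl fun i _ => Finset.sum_congr rfl fun j _ => ?_
  rw [mul_comm]
  simp only [EuclideanSpace.basisFun_apply, mul_comm]

end Model

/-! ### Gluing the expansions on smaller balls. -/

section Expansion

variable {d : ℕ} {Ξ : Type*} [MeasurableSpace Ξ] {P : Measure Ξ} {F : Ξ → E d → ℝ} {f : E d → ℝ}
  {γ R r M : ℝ} {φ : E d → ℝ} {u₀ u₁ u₀' u₁' : ℝ → E d → ℝ}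

lemma IsExpansion.mono (hu : IsExpansion P F f R φ u₀ u₁) (hr : r ≤ R) :
    IsExpansion P F f r φ u₀ u₁ :=
  ⟨hu.1.mono hr, hu.2.mono hr⟩

lemma IsExpansion.unique (hu : IsExpansion P F f r φ u₀ u₁) (hu' : IsExpansion P F f r φ u₀' u₁')
    {V : E d → E d} {Φ : ℝ → E d → E d} (hΦ : LocalFlow f γ r V Φ) {t : ℝ} (ht : 0 ≤ t) {x : E d}
    (hx : x ∈ ball (0 : E d) r) :
    u₀ t x = u₀' t x ∧ u₁ t x = u₁' t x ∧ L2 P F f (u₀ t) x = L2 P F f (u₀' t) x := by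
  have h0 : ∀ t, 0 ≤ t → ∀ x ∈ ball (0 : E d) r, u₀ t x = u₀' t x := fun t ht x hx =>
    hu.1.unique hu'.1 hΦ (fun _ _ _ _ => rfl) ht hx
  have h2 : ∀ t, 0 ≤ t → ∀ x ∈ ball (0 : E d) r, L2 P F f (u₀ t) x = L2 P F f (u₀' t) x :=
    fun t ht x hx => L2_congr (eventuallyEq_of_eqOn_ball hx (h0 t ht))
  exact ⟨h0 t ht x hx, hu.2.unique hu'.2 hΦ h2 ht hx, h2 t ht x hx⟩

namespace Model

variable [IsProbabilityMeasure P] (h : Model P F f γ R M)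
include h

/-- The expansion on a smaller ball, its long time limit, and the two-jet of `φ`. -/
theorem exists_local_expansion (hr : 0 < r) (hR : r < R) (hφ : ContDiffOn ℝ 4 φ (ball 0 R)) {B : ℝ}
    (hφb : ∀ x ∈ ball (0 : E d) R, ‖φ x‖ ≤ B) :
    ∃ V Φ u₀ u₁, LocalFlow f γ r V Φ ∧ IsExpansion P F f r φ u₀ u₁ ∧
      IntegrableOn (fun s => L2 P F f (u₀ s) 0) (Ioi 0) ∧
      (∀ x ∈ ball (0 : E d) r,
        Tendsto (fun t => u₁ t x) atTop (𝓝 (∫ s in Ioi (0 : ℝ), L2 P F f (u₀ s) 0))) ∧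
      ∃ C, 0 ≤ C ∧ ∀ η b, Contracting F η γ b R →
        |(∫ x, φ x ∂(Contracting.statLaw P F η)) - φ 0 -
          η * ∫ s in Ioi (0 : ℝ), L2 P F f (u₀ s) 0| ≤ C * η ^ 2 := by
  have hγ := h.gamma_pos
  obtain ⟨V, Φ, hΦ⟩ := h.exists_localFlow hr hR
  obtain ⟨χ, hχ, hχ1⟩ := exists_bump (d := d) hr hR
  have hc : ContDiff ℝ 4 fun x => χ x • φ x := contDiff_bump_smul (n := 4) χ hχ hφ
  have he : ∀ x ∈ ball (0 : E d) r, χ x • φ x = φ x := fun x hx => by rw [hχ1 x hx, one_smul]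
  set φ' : E d → ℝ := fun x => χ x • φ x
  obtain ⟨G, hG, hGL⟩ := h.exists_source hr hR (u := fun t x => φ' (Φ t x))
    (hc.comp hΦ.contDiff)
  obtain ⟨α, β, ψ, hψ, j1, j2, hβ⟩ := hΦ.exists_jet hγ hr h.gradient_zero hc
    fun x hx => (he x hx).symm
  obtain ⟨C, hC0, hC⟩ := hΦ.exists_jet_decay hγ hc
  obtain ⟨K, hK0, hK⟩ := h.exists_L2_le hR
  obtain ⟨i1, i2⟩ := h.integral_L2_zero hβ
  have hz : (0 : E d) ∈ ball (0 : E d) r := mem_ball_self hr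
  refine ⟨V, Φ, fun t x => φ' (Φ t x), duhamel Φ G, hΦ,
    ⟨hΦ.isTransportSolution_comp hc he, hΦ.isTransportSolution_duhamel hG fun t _ => hGL t⟩,
    i1, fun x hx => ?_, ?_⟩
  · have := hΦ.tendsto_duhamel hγ hG.continuous (C := K * C) (fun t ht y hy => by
      rw [hGL t y hy, mul_assoc]
      exact hK y hy _ _ (hC y hy t ht).1 (hC y hy t ht).2) hx
    simp_rw [hGL _ 0 hz] at this
    exact this
  · rw [i2]
    exact h.exists_second_order_bound (hφ.contDiffAt (isOpen_ball.mem_nhds h.zero_mem))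
      hφ.continuousOn hφb α β hψ j1 j2

/-- Existence of the expansion. -/
theorem exists_expansion (hφ : ContDiffOn ℝ 4 φ (ball 0 R)) {B : ℝ}
    (hφb : ∀ x ∈ ball (0 : E d) R, ‖φ x‖ ≤ B) :
    ∃ u₀ u₁, IsExpansion P F f R φ u₀ u₁ := by
  have hex : ∀ r, ∃ U₀ U₁ : ℝ → E d → ℝ, 0 < r → r < R → IsExpansion P F f r φ U₀ U₁ := by
    intro r
    by_cases hr : 0 < r ∧ r < R
    · obtain ⟨V, Φ, U₀, U₁, -, hU, -⟩ := h.exists_local_expansion hr.1 hr.2 hφ hφb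
      exact ⟨U₀, U₁, fun _ _ => hU⟩
    · exact ⟨0, 0, fun h0 h1 => absurd ⟨h0, h1⟩ hr⟩
  choose U₀ U₁ hU using hex
  -- A radius strictly between `‖x‖` and `R`. The value at `x` is read off from the solution on that
  -- ball; by uniqueness every other admissible radius gives the same value.
  set ρ : E d → ℝ := fun x => (‖x‖ + R) / 2
  have key : ∀ r, 0 < r → r < R → ∀ t, 0 ≤ t → ∀ x ∈ ball (0 : E d) r,
      U₀ (ρ x) t x = U₀ r t x ∧ U₁ (ρ x) t x = U₁ r t x := by
    intro r hr hrR t ht x hx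
    have hx' := mem_ball_zero_iff.1 hx
    have hn := norm_nonneg x
    have h1 : 0 < ρ x := by simp only [ρ]; linarith
    have h2 : ρ x < R := by simp only [ρ]; linarith
    have h3 : x ∈ ball (0 : E d) (min (ρ x) r) := by
      rw [mem_ball_zero_iff, lt_min_iff]
      exact ⟨by simp only [ρ]; linarith, hx'⟩
    obtain ⟨V, Φ, hΦ⟩ := h.exists_localFlow (lt_min h1 hr) ((min_le_right _ _).trans_lt hrR)
    have := ((hU _ h1 h2).mono (min_le_left (ρ x) r)).unique
      ((hU r hr hrR).mono (min_le_right (ρ x) r)) hΦ ht h3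
    exact ⟨this.1, this.2.1⟩
  refine ⟨fun t x => U₀ (ρ x) t x, fun t x => U₁ (ρ x) t x,
    IsTransportSolution.of_forall_lt fun r hr hrR => ?_,
    IsTransportSolution.of_forall_lt fun r hr hrR => ?_⟩
  · exact (hU r hr hrR).1.congr (fun t ht x hx => (key r hr hrR t ht x hx).1)
      fun _ _ _ _ => rfl
  · exact (hU r hr hrR).2.congr (fun t ht x hx => (key r hr hrR t ht x hx).2) fun t ht x hx =>
      L2_congr (eventuallyEq_of_eqOn_ball hx fun y hy => (key r hr hrR t ht y hy).1)

/-- The long time behaviour of the expansion and the expansion of the stationary law. -/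
theorem exists_stationary_expansion_bound (hφ : ContDiffOn ℝ 4 φ (ball 0 R)) {B : ℝ}
    (hφb : ∀ x ∈ ball (0 : E d) R, ‖φ x‖ ≤ B) :
    ∃ C, 0 ≤ C ∧ ∀ u₀ u₁, IsExpansion P F f R φ u₀ u₁ →
      IntegrableOn (fun s => L2 P F f (u₀ s) 0) (Ioi 0) ∧
      (∀ x ∈ ball (0 : E d) R,
        Tendsto (fun t => u₁ t x) atTop (𝓝 (∫ s in Ioi (0 : ℝ), L2 P F f (u₀ s) 0))) ∧
      ∀ η b, Contracting F η γ b R →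
        |(∫ x, φ x ∂(Contracting.statLaw P F η)) - φ 0 -
          η * ∫ s in Ioi (0 : ℝ), L2 P F f (u₀ s) 0| ≤ C * η ^ 2 := by
  have hR := h.radius_pos
  -- The stationary expansion involves `u₀` only near the origin, so one fixed radius suffices and
  -- `C` is chosen before the expansion; the limit at `x` below needs a ball containing `x`.
  obtain ⟨V, Φ, w₀, w₁, hΦ, hw, hi, -, C, hC0, hC⟩ :=
    h.exists_local_expansion (half_pos hR) (half_lt_self hR) hφ hφb
  refine ⟨C, hC0, fun u₀ u₁ hu => ?_⟩
  have e1 : ∀ s ∈ Ioi (0 : ℝ), L2 P F f (w₀ s) 0 = L2 P F f (u₀ s) 0 := fun s hs =>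
    (hw.unique (hu.mono (half_lt_self hR).le) hΦ (le_of_lt hs) (mem_ball_self (half_pos hR))).2.2
  have e2 : ∫ s in Ioi (0 : ℝ), L2 P F f (w₀ s) 0 = ∫ s in Ioi (0 : ℝ), L2 P F f (u₀ s) 0 :=
    setIntegral_congr_fun measurableSet_Ioi e1
  refine ⟨hi.congr_fun e1 measurableSet_Ioi, fun x hx => ?_, fun η b hc => e2 ▸ hC η b hc⟩
  have hx' := mem_ball_zero_iff.1 hx
  have hn := norm_nonneg x
  have hr : 0 < (‖x‖ + R) / 2 := by linarith
  have hrR : (‖x‖ + R) / 2 < R := by linarith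
  have hxr : x ∈ ball (0 : E d) ((‖x‖ + R) / 2) := by rw [mem_ball_zero_iff]; linarith
  obtain ⟨V', Φ', v₀, v₁, hΦ', hv, -, hlim, -⟩ := h.exists_local_expansion hr hrR hφ hφb
  have e3 : ∫ s in Ioi (0 : ℝ), L2 P F f (v₀ s) 0 = ∫ s in Ioi (0 : ℝ), L2 P F f (u₀ s) 0 :=
    setIntegral_congr_fun measurableSet_Ioi fun s hs =>
      (hv.unique (hu.mono hrR.le) hΦ' (le_of_lt hs) (mem_ball_self hr)).2.2
  rw [← e3]
  refine (hlim x hxr).congr' ?_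
  filter_upwards [eventually_ge_atTop 0] with t ht
  exact (hv.unique (hu.mono hrR.le) hΦ' ht hxr).2.1

end Model

end Expansion

/-! ### Deriving `Contracting` and `Model` from the standing assumptions. -/

section Verification

variable {d : ℕ} {Ξ : Type*} [MeasurableSpace Ξ] {P : Measure Ξ} {F : Ξ → E d → ℝ}
  {f : E d → ℝ} {γ b R₁ R L M η : ℝ}

lemma norm_iteratedFDeriv_gradient (g : E d → ℝ) (x : E d) (j : ℕ) :
    ‖iteratedFDeriv ℝ j (gradient g) x‖ = ‖iteratedFDeriv ℝ (j + 1) g x‖ := by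
  rw [← norm_iteratedFDeriv_fderiv]
  exact (InnerProductSpace.toDual ℝ (E d)).symm.norm_iteratedFDeriv_comp_left (fderiv ℝ g) x j

lemma contDiff_gradient {g : E d → ℝ} {n : ℕ} (hg : ContDiff ℝ (n + 1) g) :
    ContDiff ℝ n (gradient g) :=
  (InnerProductSpace.toDual ℝ (E d)).symm.toContinuousLinearEquiv.contDiff.comp
    (hg.fderiv_right le_rfl)

lemma contDiffOn_gradient {g : E d → ℝ} {n : ℕ} (hg : ContDiffOn ℝ (n + 1) g (ball 0 R)) :
    ContDiffOn ℝ n (gradient g) (ball 0 R) :=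
  (InnerProductSpace.toDual ℝ (E d)).symm.toContinuousLinearEquiv.contDiff.comp_contDiffOn
    (hg.fderiv_of_isOpen isOpen_ball le_rfl)

namespace StandingAssumption

variable (hA : StandingAssumption P F f γ b R₁)
include hA

lemma measurable_gradient : Measurable fun p : E d × Ξ => gradient (F p.2) p.1 :=
  SGD.measurable_gradient hA.measurable fun ξ => (hA.contDiff ξ).of_le (by norm_num)

lemma gradient_mono (hR : R ≤ R₁) (ξ : Ξ) {x y : E d} (hx : x ∈ ball (0 : E d) R)
    (hy : y ∈ ball (0 : E d) R) :
    γ * ‖x - y‖ ^ 2 ≤ inner ℝ (gradient (F ξ) x - gradient (F ξ) y) (x - y) :=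
  gradient_strongly_monotone ((hA.contDiff ξ).differentiable (by norm_num)) (hA.convex ξ)
    (ball_subset_ball hR hx) (ball_subset_ball hR hy)

lemma radius_pos (hR₀ : 16 * b / (3 * γ) < R) : 0 < R := by
  have := hA.gamma_pos
  have := hA.b_pos
  exact lt_trans (by positivity) hR₀

theorem contracting (hR₀ : 16 * b / (3 * γ) < R) (hR₁ : R ≤ R₁)
    (hL : ∀ ξ, ∀ x ∈ ball (0 : E d) R, ‖iteratedFDeriv ℝ 2 (F ξ) x‖ ≤ L)
    (hη : Admissible γ b R L η) : Contracting F η γ b R := by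
  have hγ := hA.gamma_pos
  have hb := hA.b_pos
  obtain ⟨h1, h2, h3⟩ := hη
  have h4 : η * γ ≤ 1 / 2 := by
    have := h2.trans (min_le_left _ _)
    rw [le_div_iff₀ (by positivity)] at this
    linarith
  refine ⟨hA.measurable_gradient, h1, hγ, h4, ?_, hA.gradient_zero_le, fun ξ => ?_⟩
  · have hR := hA.radius_pos hR₀
    rw [div_lt_iff₀ (by positivity)] at hR₀
    nlinarith [mul_pos hγ hR]
  · exact lipschitzOnWith_gradientStep (hA.contDiff ξ) h1.le (by linarith) h3
      (fun x hx y hy => hA.gradient_mono hR₁ ξ hx hy) (hL ξ) (hA.radius_pos hR₀).ne'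

variable [IsProbabilityMeasure P]

/-- Leibniz bounds the derivatives of the product uniformly in `ξ`; the binomial coefficients sum to
at most `2 ^ 2`. -/
lemma contDiffOn_cross (hF : ∀ ξ, CkBound 7 (ball 0 R) M (F ξ)) (v w : E d) : ContDiffOn ℝ 2
    (fun x => ∫ ξ, inner ℝ (gradient (F ξ) x) v * inner ℝ (gradient (F ξ) x) w ∂P) (ball 0 R) := by
  have hc : ∀ ξ v, ContDiff ℝ 2 fun x => inner ℝ (gradient (F ξ) x) v := fun ξ v =>
    (contDiff_gradient (n := 2) (hA.contDiff ξ)).inner ℝ contDiff_const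
  have hb : ∀ ξ (v : E d) (j : ℕ), j ≤ 2 → ∀ x ∈ ball (0 : E d) R,
      ‖iteratedFDeriv ℝ j (fun x => inner ℝ (gradient (F ξ) x) v) x‖ ≤ ‖v‖ * |M| := by
    intro ξ v j hj x hx
    have e : (fun x => inner ℝ (gradient (F ξ) x) v) = innerSL ℝ v ∘ gradient (F ξ) := by
      funext x; simp
    rw [e]
    refine ((innerSL ℝ v).norm_iteratedFDeriv_comp_left (N := 2)
      (contDiff_gradient (n := 2) (hA.contDiff ξ)).contDiffAt (by exact_mod_cast hj)).trans ?_
    rw [innerSL_apply_norm, norm_iteratedFDeriv_gradient]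
    exact mul_le_mul_of_nonneg_left (((hF ξ).2 (j + 1) (by omega) x hx).trans (le_abs_self M))
      (norm_nonneg v)
  have hm : ∀ x, Measurable fun ξ => gradient (F ξ) x := fun x =>
    hA.measurable_gradient.comp (measurable_const.prodMk measurable_id)
  refine contDiffOn_integral (n := 2)
    (g := fun ξ x => inner ℝ (gradient (F ξ) x) v * inner ℝ (gradient (F ξ) x) w)
    (M := 2 ^ 2 * ((‖v‖ * |M|) * (‖w‖ * |M|))) isOpen_ball (fun x _ => ?_)
    (fun ξ => ((hc ξ v).mul (hc ξ w)).contDiffOn) fun ξ j hj x hx => ?_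
  · exact (((hm x).inner measurable_const).mul
      ((hm x).inner measurable_const)).stronglyMeasurable
  · refine (norm_iteratedFDeriv_mul_le (hc ξ v) (hc ξ w) x (by exact_mod_cast hj)).trans ?_
    calc _ ≤ ∑ i ∈ Finset.range (j + 1), (j.choose i : ℝ) * ((‖v‖ * |M|) * (‖w‖ * |M|)) := by
          refine Finset.sum_le_sum fun i hi => ?_
          rw [mul_assoc]
          have hi' := Finset.mem_range.1 hi
          refine mul_le_mul_of_nonneg_left (mul_le_mul (hb ξ v i (by omega) x hx)
            (hb ξ w (j - i) (by omega) x hx) (norm_nonneg _) (by positivity)) (by positivity)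
      _ = 2 ^ j * ((‖v‖ * |M|) * (‖w‖ * |M|)) := by
          rw [← Finset.sum_mul]
          congr 1
          exact_mod_cast Nat.sum_range_choose j
      _ ≤ _ := by
          gcongr
          norm_num

theorem model (hR₀ : 16 * b / (3 * γ) < R) (hR₁ : R ≤ R₁)
    (hF : ∀ ξ, CkBound 7 (ball 0 R) M (F ξ)) : Model P F f γ R |M| := by
  have hR := hA.radius_pos hR₀
  have hmean : ∀ x, gradient f x = ∫ ξ, gradient (F ξ) x ∂P := fun x => (hA.unbiased x).gradient
  have hm : ∀ x, Measurable fun ξ => gradient (F ξ) x := fun x =>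
    hA.measurable_gradient.comp (measurable_const.prodMk measurable_id)
  have h6 : ContDiffOn ℝ 6 (gradient f) (ball 0 R) := by
    have := contDiffOn_integral (μ := P) (n := 6) (g := fun ξ => gradient (F ξ)) (M := M)
      (isOpen_ball (x := (0 : E d)) (ε := R)) (fun x _ => (hm x).stronglyMeasurable)
      (fun ξ => contDiffOn_gradient (n := 6) (hF ξ).1)
      (fun ξ j hj x hx => by
        rw [norm_iteratedFDeriv_gradient]
        exact (hF ξ).2 (j + 1) (by omega) x hx)
    exact this.congr fun x _ => hmean x
  refine ⟨hA.measurable_gradient, hA.gamma_pos, hR, abs_nonneg M, fun ξ x hx => ?_,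
    fun x _ => hmean x, fun x hx y hy => ?_, ?_, h6, hA.contDiffOn_cross hF, fun v w => ?_⟩
  · have := (hF ξ).2 1 (by norm_num) x hx
    rw [← norm_iteratedFDeriv_gradient (F ξ) x 0, norm_iteratedFDeriv_zero] at this
    exact this.trans (le_abs_self M)
  · have i1 : Integrable (fun ξ => gradient (F ξ) x - gradient (F ξ) y) P :=
      (hA.integrable_gradient x).sub (hA.integrable_gradient y)
    rw [hmean, hmean, ← integral_sub (hA.integrable_gradient x) (hA.integrable_gradient y),
      real_inner_comm, ← integral_inner i1]
    have i2 : Integrable (fun ξ => inner ℝ (x - y) (gradient (F ξ) x - gradient (F ξ) y)) P :=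
      i1.const_inner (x - y)
    have := integral_mono (integrable_const _) i2 fun ξ => by
      have := hA.gradient_mono hR₁ ξ hx hy
      rw [real_inner_comm] at this
      exact this
    simpa using this
  · rw [gradient, hA.isLocalMin.fderiv_eq_zero, map_zero]
  -- Regularity of `f` is available only through its gradient, an average of smooth gradients; this
  -- suffices for symmetry of the second derivative at `0`.
  · have hfd : fderiv ℝ f = fun x => InnerProductSpace.toDual ℝ (E d) (gradient f x) := by
      funext x; simp [gradient]
    have hd : DifferentiableAt ℝ (fderiv ℝ f) 0 := by
      rw [hfd]
      exact (InnerProductSpace.toDual ℝ (E d)).toContinuousLinearEquiv.differentiableAt.comp 0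
        ((h6.contDiffAt (isOpen_ball.mem_nhds (mem_ball_self hR))).differentiableAt (by norm_num))
    rw [inner_fderiv_gradient hd, real_inner_comm, inner_fderiv_gradient hd]
    exact second_derivative_symmetric_of_eventually (Eventually.of_forall fun y =>
      (hA.unbiased y).differentiableAt.hasFDerivAt) hd.hasFDerivAt v w

end StandingAssumption

lemma Contracting.law_dirac (hc : Contracting F η γ b R) [IsProbabilityMeasure P] (x : E d)
    (n : ℕ) : law P F η (Measure.dirac x) n = (iidLaw P).map fun ω => iter F η x ω n := by
  rw [law, Measure.dirac_prod, Measure.map_map (hc.measurable_iter n) measurable_prodMk_left]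
  rfl

/-- From $1-\eta\gamma\le e^{-\eta\gamma}$ and $n\eta\gamma\ge\log(1/\eta)$; this fixes `K = 1 / γ`.
-/
lemma pow_le_of_log_le (hγ : 0 < γ) (hη : 0 < η) (hηγ : η * γ ≤ 1) {n : ℕ}
    (hn : 1 / γ * (1 / η * Real.log (1 / η)) ≤ n) : (1 - η * γ) ^ n ≤ η := by
  have h1 : 1 - η * γ ≤ Real.exp (-(η * γ)) := by
    have := Real.add_one_le_exp (-(η * γ))
    linarith
  have h2 : Real.log (1 / η) ≤ n * (η * γ) := by
    have e : Real.log (1 / η) = (1 / γ * (1 / η * Real.log (1 / η))) * (η * γ) := by field_simp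
    rw [e]
    exact mul_le_mul_of_nonneg_right hn (by positivity)
  calc (1 - η * γ) ^ n ≤ Real.exp (-(η * γ)) ^ n := pow_le_pow_left₀ (by linarith) h1 n
    _ = Real.exp (-(n * (η * γ))) := by rw [← Real.exp_nat_mul]; ring_nf
    _ ≤ Real.exp (-Real.log (1 / η)) := Real.exp_le_exp.2 (neg_le_neg h2)
    _ = η := by rw [one_div, Real.log_inv, neg_neg, Real.exp_log hη]

end Verification

end SGD

end

/-! ### The main theorem. -/

theorem corollary2 {d : ℕ} {Ξ : Type*} [MeasurableSpace Ξ] (P : Measure Ξ) [IsProbabilityMeasure P]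
    (F : Ξ → SGD.E d → ℝ) (f : SGD.E d → ℝ) (γ b R₁ R L : ℝ)
    (hA : SGD.StandingAssumption P F f γ b R₁)
    (hR₀ : 16 * b / (3 * γ) < R) (hR₁ : R ≤ R₁)
    (hF : ∃ M, ∀ ξ, SGD.CkBound 7 (ball 0 R) M (F ξ))
    (hL : ∀ ξ, ∀ x ∈ ball (0 : SGD.E d) R, ‖iteratedFDeriv ℝ 2 (F ξ) x‖ ≤ L) :
    ∃ K > 0, ∃ π : ℝ → Measure (SGD.E d),
      -- the limiting measure of SGD with step size `η`
      (∀ η, SGD.Admissible γ b R L η →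
        IsProbabilityMeasure (π η) ∧ SGD.law P F η (π η) 1 = π η ∧
        ∀ μ₀ : Measure (SGD.E d), IsProbabilityMeasure μ₀ → μ₀ (closedBall 0 R)ᶜ = 0 →
          Tendsto (fun n => SGD.W2 (SGD.law P F η μ₀ n) (π η)) atTop (𝓝 0)) ∧
      ∀ φ : SGD.E d → ℝ, (∃ M, SGD.CkBound 6 (ball 0 R) M φ) →
        (∃ u₀ u₁, SGD.IsExpansion P F f R φ u₀ u₁) ∧
        ∃ C > 0,
          (∀ η, SGD.Admissible γ b R L η → ∀ n : ℕ, K * (1 / η * Real.log (1 / η)) ≤ n →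
            ∀ x ∈ ball (0 : SGD.E d) R,
              Integrable (fun ω => φ (SGD.iter F η x ω n)) (SGD.iidLaw P) ∧
              |(∫ ω, φ (SGD.iter F η x ω n) ∂(SGD.iidLaw P)) - φ 0| ≤ C * η) ∧
          ∀ u₀ u₁, SGD.IsExpansion P F f R φ u₀ u₁ →
            IntegrableOn (fun s => SGD.L2 P F f (u₀ s) 0) (Ioi 0) ∧
            (∀ x ∈ ball (0 : SGD.E d) R,
              Tendsto (fun t => u₁ t x) atTop (𝓝 (∫ s in Ioi (0 : ℝ), SGD.L2 P F f (u₀ s) 0))) ∧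
            ∀ η, SGD.Admissible γ b R L η →
              Integrable φ (π η) ∧
              |(∫ x, φ x ∂(π η)) - φ 0 - η * ∫ s in Ioi (0 : ℝ), SGD.L2 P F f (u₀ s) 0|
                ≤ C * η ^ 2 := by
  obtain ⟨M, hM⟩ := hF
  have hγ := hA.gamma_pos
  have hR := hA.radius_pos hR₀
  have h := hA.model hR₀ hR₁ hM
  have hc : ∀ η, SGD.Admissible γ b R L η → SGD.Contracting F η γ b R := fun η hη =>
    hA.contracting hR₀ hR₁ hL hη
  refine ⟨1 / γ, by positivity, fun η => SGD.Contracting.statLaw P F η, fun η hη =>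
    ⟨(hc η hη).isProbabilityMeasure_statLaw hR, (hc η hη).law_statLaw hR 1,
      fun μ₀ hμ₀ hμ => (hc η hη).tendsto_W2 hR μ₀ hμ⟩, fun φ hφ => ?_⟩
  obtain ⟨B, hφ6, hφB⟩ := hφ
  have hφ4 : ContDiffOn ℝ 4 φ (ball 0 R) := hφ6.of_le (by norm_num)
  have hφb : ∀ x ∈ ball (0 : SGD.E d) R, ‖φ x‖ ≤ B := fun x hx => by
    simpa using hφB 0 (by norm_num) x hx
  have hφ2 : ContDiffAt ℝ 2 φ 0 :=
    (hφ4.contDiffAt (isOpen_ball.mem_nhds (mem_ball_self hR))).of_le (by norm_num)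
  obtain ⟨C₁, hC₁, h1⟩ := h.exists_bias_bound hφ2 hφ4.continuousOn hφb
  obtain ⟨C₂, hC₂, h2⟩ := h.exists_stationary_expansion_bound hφ4 hφb
  -- The factor `2` is from `(1 - η * γ) ^ n + η ≤ 2 * η`; one constant serves both estimates.
  refine ⟨h.exists_expansion hφ4 hφb, 2 * C₁ + C₂, by positivity, fun η hη n hn x hx => ?_,
    fun u₀ u₁ hu => ?_⟩
  · have hcη := hc η hη
    have hmi : Measurable fun ω => SGD.iter F η x ω n :=
      (hcη.measurable_iter n).comp measurable_prodMk_left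
    have hpr : IsProbabilityMeasure ((SGD.iidLaw P).map fun ω => SGD.iter F η x ω n) :=
      Measure.isProbabilityMeasure_map hmi.aemeasurable
    have hae : ∀ᵐ y ∂((SGD.iidLaw P).map fun ω => SGD.iter F η x ω n),
        y ∈ ball (0 : SGD.E d) R := by
      refine (ae_map_iff hmi.aemeasurable
        (isOpen_ball (x := (0 : SGD.E d)) (ε := R)).measurableSet).2 ?_
      exact Eventually.of_forall fun ω => hcη.iter_mem_ball hR hx ω n
    have hi := SGD.integrable_of_continuousOn hae hφ4.continuousOn hφb
    have hb := h1 η b hcη n x hx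
    rw [hcη.law_dirac, integral_map hmi.aemeasurable hi.aestronglyMeasurable] at hb
    refine ⟨hi.comp_measurable hmi, hb.trans ?_⟩
    have hη0 := hcη.eta_pos
    have := SGD.pow_le_of_log_le hγ hη0 (by have := hcη.eta_gamma; linarith) hn
    nlinarith [mul_le_mul_of_nonneg_left this hC₁.le, mul_nonneg hC₂ hη0.le]
  · obtain ⟨a1, a2, a3⟩ := h2 u₀ u₁ hu
    refine ⟨a1, a2, fun η hη => ?_⟩
    have hcη := hc η hη
    have := hcη.isProbabilityMeasure_statLaw (P := P) hR
    refine ⟨SGD.integrable_of_continuousOn (h.ae_mem_statLaw hcη) hφ4.continuousOn hφb,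
      (a3 η b hcη).trans ?_⟩
    exact mul_le_mul_of_nonneg_right (by linarith) (by positivity)
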